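/- Let $K$ be a field of characteristic $0$. A simplicial complex on a finite ordered vertex set $\{x_1,\dots,x_n\}$ is a set $\Gamma$ of subsets of $\{x_1,\dots,x_n\}$ closed under taking subsets (it need not contain all singletons, and may be empty). Its Stanley–Reisner ideal is $I_\Gamma=(\prod_{x_i\in F}x_i : F\subseteq\{x_1,\dots,x_n\},\ F\notin\Gamma)\subseteq S=K[x_1,\dots,x_n]$. For a graded ideal $I\subseteq S$ let $\mathrm{gin}(I)$ be its generic initial ideal, that is, the ideal of initial terms of $\varphi(I)$ for all $\varphi$ in a nonempty Zariski open subset of $\mathrm{GL}_n(K)$, with respect to the degree reverse lexicographic order induced by $x_1>\dots>x_n$. For a monomial $u=x_{i_1}x_{i_2}\cdots x_{i_t}$ with $i_1\le i_2\le\dots\le i_t$ put $u^\sigma=x_{i_1}x_{i_2+1}\cdots x_{i_t+t-1}$, and for a monomial ideal $I$ with minimal monomial generators $u_1,\dots,u_s$ let $I^\sigma=(u_1^\sigma,\dots,u_s^\sigma)$, in a polynomial ring with sufficiently many variables. The symmetric algebraic shifted complex $\Delta^s(\Gamma)$ of $\Gamma$ is the unique simplicial complex on $\{x_1,\dots,x_n\}$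 with $$I_{\Delta^s(\Gamma)}=\mathrm{gin}(I_\Gamma)^\sigma .$$ For complexes on another ordered vertex set, such as $\{x_{n+1},\dots,x_{n+m}\}$, it is defined in the same way, with respect to the polynomial ring in those variables. **Theorem.** The complex $\Delta^s(\Gamma)$ is well defined: for every simplicial complex $\Gamma$ on $\{x_1,\dots,x_n\}$ exactly one simplicial complex on $\{x_1,\dots,x_n\}$ has the defining property above. Moreover, let $\Gamma_1$ be a simplicial complex on the vertex set $\{x_1,\dots,x_n\}$, let $\Gamma_2$ be a simplicial complex on the vertex set $\{x_{n+1},\dots,x_{n+m}\}$, and let $\Gamma_1\uplus\Gamma_2$ denote their disjoint union, on the vertex set $\{x_1,\dots,x_{n+m}\}$. Then $$\Delta^s(\Gamma_1\uplus\Gamma_2)=\Delta^s\bigl(\Delta^s(\Gamma_1)\uplus\Delta^s(\Gamma_2)\bigr).$$ -/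

import Mathlib

namespace SymmetricShifting

open MvPolynomial

/-- A simplicial complex on the vertex set `{x_1, …, x_n}` (indexed by `Fin n`): a set of subsets
of the vertex set that is closed under inclusion. Neither the presence of all singletons nor that
of the empty face is required. -/
abbrev Complex (n : ℕ) : Type := LowerSet (Finset (Fin n))

/-- The disjoint union of a complex on the first `n` vertices and a complex on the last `m`
vertices, as a complex on all `n + m` vertices. -/
def disjointUnion {n m : ℕ} (Γ₁ : Complex n) (Γ₂ : Complex m) : Complex (n + m) where
  carrier := {F | (∃ G ∈ Γ₁, F = G.map (Fin.castAddEmb m)) ∨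
    (∃ G ∈ Γ₂, F = G.map (Fin.natAddEmb n))}
  lower' := by
    intro F F' hF' hF
    rcases hF with ⟨G, hG, rfl⟩ | ⟨G, hG, rfl⟩
    · obtain ⟨G', hG', rfl⟩ := Finset.subset_map_iff.mp hF'
      exact Or.inl ⟨G', Γ₁.lower hG' hG, rfl⟩
    · obtain ⟨G', hG', rfl⟩ := Finset.subset_map_iff.mp hF'
      exact Or.inr ⟨G', Γ₂.lower hG' hG, rfl⟩

/-- The Stanley-Reisner ideal, generated by the squarefree monomials of the non-faces. -/
noncomputable def stanleyReisnerIdeal (K : Type*) [Field K] {n : ℕ} (Γ : Complex n) :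
    Ideal (MvPolynomial (Fin n) K) :=
  Ideal.span {p | ∃ F : Finset (Fin n), F ∉ Γ ∧ p = ∏ i ∈ F, X i}

/-! ### The degree reverse lexicographic order with `x_1 > ⋯ > x_n` -/

/-- The exponent vector `a` is sent to its partial sums: the `i`-th entry is
`a_1 + ⋯ + a_{n - i}` for `i = 0, …, n - 1`. The degree reverse lexicographic order is the
lexicographic order on these vectors, see `degRevLex_lt_iff`. -/
noncomputable def partialSums (n : ℕ) : (Fin n →₀ ℕ) →+ (Fin n →₀ ℕ) where
  toFun a := Finsupp.equivFunOnFinite.symm fun i => ∑ j ∈ Finset.Iic i.rev, a j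
  map_zero' := by ext; simp
  map_add' a b := by ext; simp [Finset.sum_add_distrib]

theorem partialSums_apply {n : ℕ} (a : Fin n →₀ ℕ) (i : Fin n) :
    partialSums n a i = ∑ j ∈ Finset.Iic i.rev, a j := rfl

theorem sum_Iic_injective {n : ℕ} {a b : Fin n →₀ ℕ} (i : Fin n)
    (h : ∀ k ≤ i, ∑ j ∈ Finset.Iic k, a j = ∑ j ∈ Finset.Iic k, b j) : a i = b i := by
  have e : ∀ c : Fin n →₀ ℕ, ∑ j ∈ Finset.Iic i, c j = (∑ j ∈ Finset.Iio i, c j) + c i := by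
    intro c
    rw [← Finset.Iio_insert i, Finset.sum_insert (by simp), add_comm]
  have hlt : ∑ j ∈ Finset.Iio i, a j = ∑ j ∈ Finset.Iio i, b j := by
    rcases Nat.eq_zero_or_pos i.val with h0 | h0
    · have : Finset.Iio i = ∅ := by
        ext j; simp [Fin.lt_def, h0]
      simp [this]
    · have : Finset.Iio i = Finset.Iic (⟨i.val - 1, by omega⟩ : Fin n) := by
        ext j; simp only [Finset.mem_Iio, Finset.mem_Iic, Fin.lt_def, Fin.le_def]; omega
      rw [this]
      exact h _ (by simp [Fin.le_def])
  have := h i le_rfl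
  rw [e a, e b, hlt] at this
  omega

theorem partialSums_injective (n : ℕ) : Function.Injective (partialSums n) := by
  intro a b h
  ext i
  refine sum_Iic_injective i fun k _ => ?_
  have := DFunLike.congr_fun h k.rev
  simpa [partialSums_apply] using this

/-- Exponent vectors, to be ordered by the degree reverse lexicographic order. -/
def DegRevLex (n : ℕ) : Type := Fin n →₀ ℕ

noncomputable instance (n : ℕ) : AddCommMonoid (DegRevLex n) :=
  inferInstanceAs (AddCommMonoid (Fin n →₀ ℕ))

/-- The lexicographic order on partial sums. -/
noncomputable def DegRevLex.toPartialSums {n : ℕ} (a : DegRevLex n) : Lex (Fin n →₀ ℕ) :=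
  toLex (partialSums n a)

noncomputable instance (n : ℕ) : LinearOrder (DegRevLex n) :=
  LinearOrder.lift' DegRevLex.toPartialSums
    (fun _ _ h => partialSums_injective n (toLex.injective h))

theorem DegRevLex.le_def {n : ℕ} {a b : DegRevLex n} :
    a ≤ b ↔ a.toPartialSums ≤ b.toPartialSums := Iff.rfl

theorem DegRevLex.toPartialSums_add {n : ℕ} (a b : DegRevLex n) :
    (a + b).toPartialSums = a.toPartialSums + b.toPartialSums :=
  congrArg toLex (map_add (partialSums n) a b)

instance (n : ℕ) : IsOrderedAddMonoid (DegRevLex n) where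
  add_le_add_left a b h c := by
    rw [DegRevLex.le_def] at h ⊢
    rw [DegRevLex.toPartialSums_add, DegRevLex.toPartialSums_add]
    exact add_le_add_left h _

instance (n : ℕ) : WellFoundedLT (DegRevLex n) :=
  ⟨InvImage.wf DegRevLex.toPartialSums (wellFounded_lt (α := Lex (Fin n →₀ ℕ)))⟩

/-- The degree reverse lexicographic order on the monomials in `x_1 > ⋯ > x_n`. -/
noncomputable def degRevLex (n : ℕ) : MonomialOrder (Fin n) where
  syn := DegRevLex n
  toSyn := { toEquiv := Equiv.refl (Fin n →₀ ℕ), map_add' := fun _ _ => rfl }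
  toSyn_monotone := by
    intro a b h
    refine Finsupp.toLex_monotone (fun i => ?_)
    exact Finset.sum_le_sum fun j _ => h j

theorem sum_Iic_add_sum_Ioi {n : ℕ} (c : Fin n →₀ ℕ) (k : Fin n) :
    ∑ j ∈ Finset.Iic k, c j + ∑ j ∈ Finset.Ioi k, c j = c.degree := by
  rw [Finsupp.degree_eq_sum, ← Finset.sum_union]
  · congr 1
    ext j
    simpa using le_or_gt j k
  · rw [Finset.disjoint_left]
    intro j h1 h2
    simp only [Finset.mem_Iic, Finset.mem_Ioi] at h1 h2
    exact absurd h1 (not_le.mpr h2)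

theorem toPartialSums_lt_of {n : ℕ} {a b : Fin n →₀ ℕ} (h : a.degree < b.degree ∨
    a.degree = b.degree ∧ ∃ i, b i < a i ∧ ∀ j, i < j → a j = b j) :
    toLex (partialSums n a) < toLex (partialSums n b) := by
  rw [Finsupp.Lex.lt_iff]
  rcases h with h | ⟨h, i, hi, hj⟩
  · have hn : 0 < n := by
      rcases Nat.eq_zero_or_pos n with rfl | hn
      · simp [Finsupp.degree_eq_sum] at h
      · exact hn
    refine ⟨⟨0, hn⟩, fun j hj => absurd hj (by simp [Fin.lt_def]), ?_⟩
    have e : ∀ c : Fin n →₀ ℕ, partialSums n c ⟨0, hn⟩ = c.degree := by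
      intro c
      rw [partialSums_apply, Finsupp.degree_eq_sum]
      congr 1
      ext j
      simp only [Finset.mem_Iic, Fin.le_def, Fin.val_rev, Finset.mem_univ, iff_true]
      omega
    simpa [e] using h
  · have hge : ∀ k, i ≤ k → ∑ j ∈ Finset.Iic k, a j = ∑ j ∈ Finset.Iic k, b j := by
      intro k hk
      have h1 := sum_Iic_add_sum_Ioi a k
      have h2 := sum_Iic_add_sum_Ioi b k
      have h3 : ∑ j ∈ Finset.Ioi k, a j = ∑ j ∈ Finset.Ioi k, b j :=
        Finset.sum_congr rfl fun j hjk => hj j (hk.trans_lt (Finset.mem_Ioi.mp hjk))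
      omega
    have e : ∀ c : Fin n →₀ ℕ, ∑ j ∈ Finset.Iic i, c j = (∑ j ∈ Finset.Iio i, c j) + c i := by
      intro c
      rw [← Finset.Iio_insert i, Finset.sum_insert (by simp), add_comm]
    have hlt : ∑ j ∈ Finset.Iio i, a j < ∑ j ∈ Finset.Iio i, b j := by
      have := hge i le_rfl
      rw [e a, e b] at this
      omega
    have h0 : 0 < i.val := by
      by_contra h0
      have : Finset.Iio i = ∅ := by
        ext j; simp only [Finset.mem_Iio, Fin.lt_def, Finset.notMem_empty, iff_false]; omega
      simp [this] at hlt
    have hI : Finset.Iio i = Finset.Iic (⟨i.val - 1, by omega⟩ : Fin n) := by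
      ext j; simp only [Finset.mem_Iio, Finset.mem_Iic, Fin.lt_def, Fin.le_def]; omega
    refine ⟨Fin.rev ⟨i.val - 1, by omega⟩, fun j hjl => ?_, ?_⟩
    · refine hge j.rev ?_
      simp only [Fin.lt_def, Fin.le_def, Fin.val_rev] at hjl ⊢
      omega
    · rw [hI] at hlt
      simpa [partialSums_apply] using hlt

open scoped MonomialOrder in
/-- `x^a < x^b` if and only if `|a| < |b|`, or `|a| = |b|` and `a_i > b_i` at the last index `i`
at which `a` and `b` differ. -/
theorem degRevLex_lt_iff {n : ℕ} {a b : Fin n →₀ ℕ} :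
    a ≺[degRevLex n] b ↔ a.degree < b.degree ∨
      a.degree = b.degree ∧ ∃ i, b i < a i ∧ ∀ j, i < j → a j = b j := by
  change toLex (partialSums n a) < toLex (partialSums n b) ↔ _
  refine ⟨fun hab => ?_, toPartialSums_lt_of⟩
  by_contra hne
  refine lt_asymm hab (toPartialSums_lt_of ?_)
  push Not at hne
  obtain ⟨hle, hne⟩ := hne
  rcases hle.lt_or_eq with h | h
  · exact Or.inl h
  · refine Or.inr ⟨h, ?_⟩
    have hab' : a ≠ b := fun h => by simp [h] at hab
    have hS : (Finset.univ.filter fun i => a i ≠ b i).Nonempty := by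
      obtain ⟨i, hi⟩ := DFunLike.ne_iff.mp hab'
      exact ⟨i, by simpa using hi⟩
    have hmem := Finset.max'_mem _ hS
    set i := Finset.max' _ hS with hidef
    have hmax : ∀ j, i < j → a j = b j := by
      intro j hj
      by_contra hj'
      exact absurd hj (not_lt.mpr (Finset.le_max' _ j (by simpa using hj')))
    refine ⟨i, ?_, fun j hj => (hmax j hj).symm⟩
    have hi : a i ≠ b i := by simpa using hmem
    by_contra hcon
    obtain ⟨j, hj, hj'⟩ := hne h.symm i (by omega)
    exact hj' (hmax j hj)

/-! ### Generic initial ideals -/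

/-- The ideal of initial terms with respect to the degree reverse lexicographic order. -/
noncomputable def initialIdeal {K : Type*} [Field K] {n : ℕ} (I : Ideal (MvPolynomial (Fin n) K)) :
    Ideal (MvPolynomial (Fin n) K) :=
  Ideal.span ((degRevLex n).leadingTerm '' (I : Set (MvPolynomial (Fin n) K)))

/-- The linear change of coordinates `x_j ↦ ∑ i, A i j * x_i`. -/
noncomputable def linearSubst {K : Type*} [Field K] {n : ℕ} (A : Matrix (Fin n) (Fin n) K) :
    MvPolynomial (Fin n) K →ₐ[K] MvPolynomial (Fin n) K :=
  aeval fun j => ∑ i, C (A i j) * X i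

/-- `J` is the generic initial ideal of `I`: one has `in(φ(I)) = J` for all `φ` in a nonempty
Zariski open subset of `GL_n(K)`. It suffices to consider the basic open sets, where a nonzero
polynomial `P` in the matrix entries does not vanish. -/
def IsGenericInitialIdeal {K : Type*} [Field K] {n : ℕ} (I J : Ideal (MvPolynomial (Fin n) K)) :
    Prop :=
  ∃ P : MvPolynomial (Fin n × Fin n) K, P ≠ 0 ∧
    ∀ A : Matrix (Fin n) (Fin n) K, A.det ≠ 0 → eval (fun e => A e.1 e.2) P ≠ 0 →
      initialIdeal (I.map (linearSubst A)) = J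

/-! ### The operation `σ` -/

/-- For `x^a = x_{i_1} ⋯ x_{i_t}` with `i_1 ≤ ⋯ ≤ i_t`, the monomial
`x_{i_1} x_{i_2 + 1} ⋯ x_{i_t + t - 1}` in a polynomial ring with variables indexed by `ℕ`. -/
noncomputable def sigmaMonomial (K : Type*) [Field K] {n : ℕ} (a : Fin n →₀ ℕ) :
    MvPolynomial ℕ K :=
  ((a.toMultiset.sort (· ≤ ·)).mapIdx fun k i => (X (i.val + k) : MvPolynomial ℕ K)).prod

/-- For a monomial ideal `I`, the ideal `I^σ` generated by the `m^σ`, where `m` runs over the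
minimal monomial generators of `I`, that is over the monomials in `I` that are minimal under
divisibility. -/
noncomputable def sigmaIdeal {K : Type*} [Field K] {n : ℕ} (I : Ideal (MvPolynomial (Fin n) K)) :
    Ideal (MvPolynomial ℕ K) :=
  Ideal.span (sigmaMonomial K '' {a | Minimal (fun b => monomial b (1 : K) ∈ I) a})

/-! ### Symmetric algebraic shifting -/

/-- The defining property `I_Δ = gin(I_Γ)^σ` of the symmetric algebraic shifted complex `Δ` of `Γ`.
Here `K[x_1, …, x_n]` is viewed as a subring of the polynomial ring with variables indexed by `ℕ`,
in which `gin(I_Γ)^σ` lives. -/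
def IsSymmetricShift (K : Type*) [Field K] {n : ℕ} (Γ Δ : Complex n) : Prop :=
  ∃ J, IsGenericInitialIdeal (stanleyReisnerIdeal K Γ) J ∧
    (stanleyReisnerIdeal K Δ).map (rename (R := K) (Fin.val : Fin n → ℕ)) = sigmaIdeal J

/-- The symmetric algebraic shifted complex `Δ^s(Γ)`: the complex with `I_{Δ^s(Γ)} = gin(I_Γ)^σ`. -/
noncomputable def symmetricShift (K : Type*) [Field K] {n : ℕ} (Γ : Complex n) : Complex n :=
  Classical.epsilon (IsSymmetricShift K Γ)

end SymmetricShifting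

/-! Write gin(Γ) for the set of exponents of the generic initial ideal of the Stanley–Reisner ideal
of Γ. The complex Δ^s(Γ) is a function of gin(Γ), so the identity follows from two facts:
gin(Δ^s(Γ)) = gin(Γ) (`gin_symmetricShift`), and gin(Γ₁ ⊎ Γ₂) depends only on gin(Γ₁) and gin(Γ₂)
(`gin_disjointUnion_congr`).

Initial ideals are handled inside the face ring: b is an initial exponent of a family f if f^b is a
combination of smaller monomials in f of the same degree (`initSet`). The other monomials of an
initial segment form a basis of its span (`IsSegment.finrank_span`), so equalities between sets of
exponents reduce to an inclusion and a dimension count. For generic linear forms the initial set is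
constant (`eventually_initSet_eq`), and in characteristic 0 it is strongly stable
(`stronglyStable_genSet`).

For well-definedness, the minimal generators x_{i_1} ⋯ x_{i_t} of gin(Γ) must satisfy i_t + t - 1 ≤
n (`sigmaBounded_gin`). Eliminating variables with the last r generic forms bounds the number of
standard monomials in the first n - r variables from above. Induction on r shows that the bound is
attained in degrees above r, and then multiplication by the last remaining variable keeps these
monomials standard.

For gin(Δ^s(Γ)) = gin(Γ), let U = gin(Γ). The inclusion of U is reduced to one generator u: the
complex of U is contained in the complex attached to u alone, whose gin lies in an intersection of
ideals (x_1, …, x_i)^k containing u, and a count forces equality there. The map σ supplies the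
counts, since it turns monomials into sets, and sets and monomials with prescribed support are
counted by the same binomial coefficient. A last count gives equality with U (`gin_shiftComplex`).

For disjoint unions, K[Γ₁ ⊎ Γ₂] embeds in K[Γ₁] × K[Γ₂] with the same positive-degree part. On the
segments below some x_1 x^b the span of the monomials splits as a product, so numbers of standard
monomials add up. These numbers determine a strongly stable set in positive degrees
(`StronglyStable.mem_iff_of_ncard_sdiff_headSegment_eq`); degree 0 is compared directly. -/

namespace SymmetricShifting

open MvPolynomial Filter

/-! ### Zariski-generic points and polynomial functions -/

section Generic

variable {K : Type*} [Field K] {σ τ : Type*}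

/-- The filter of sets of points of affine space that contain a nonempty basic Zariski open set. -/
def zariski (σ K : Type*) [Field K] : Filter (σ → K) where
  sets := {s | ∃ P : MvPolynomial σ K, P ≠ 0 ∧ ∀ x, eval x P ≠ 0 → x ∈ s}
  univ_sets := ⟨1, one_ne_zero, fun _ _ => trivial⟩
  sets_of_superset := by
    rintro s t ⟨P, hP, h⟩ hst
    exact ⟨P, hP, fun x hx => hst (h x hx)⟩
  inter_sets := by
    rintro s t ⟨P, hP, h⟩ ⟨Q, hQ, h'⟩
    refine ⟨P * Q, mul_ne_zero hP hQ, fun x hx => ?_⟩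
    rw [map_mul] at hx
    exact ⟨h x (left_ne_zero_of_mul hx), h' x (right_ne_zero_of_mul hx)⟩

theorem eventually_zariski {p : (σ → K) → Prop} :
    (∀ᶠ x in zariski σ K, p x) ↔
      ∃ P : MvPolynomial σ K, P ≠ 0 ∧ ∀ x, eval x P ≠ 0 → p x := Iff.rfl

/-- A nonzero polynomial over an infinite field has a nonzero value. Hence one point satisfies any
finite number of generic conditions at once, which is how `.exists` is used throughout. -/
instance [Infinite K] : (zariski σ K).NeBot := by
  rw [← empty_mem_iff_bot.not.trans neBot_iff.symm]
  · rintro ⟨P, hP, h⟩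
    refine hP (MvPolynomial.funext fun x => ?_)
    by_contra hx
    exact h x (by simpa using hx)

theorem eventually_eval_ne_zero {P : MvPolynomial σ K} (hP : P ≠ 0) :
    ∀ᶠ x in zariski σ K, eval x P ≠ 0 :=
  ⟨P, hP, fun _ h => h⟩

theorem tendsto_comp_zariski {e : σ → τ} (he : Function.Injective e) :
    Tendsto (fun x : τ → K => x ∘ e) (zariski τ K) (zariski σ K) := by
  rintro s ⟨P, hP, h⟩
  refine ⟨rename e P, fun h0 => hP (rename_injective e he (by simpa using h0)), fun x hx => ?_⟩
  rw [eval_rename] at hx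
  exact h _ hx

variable {R : Type*} [CommRing R] [Algebra K R]

/-- Polynomial functions on affine space with values in a `K`-algebra. -/
noncomputable def polyFun (σ K R : Type*) [Field K] [CommRing R] [Algebra K R] : Subring ((σ → K) → R) :=
  (RingHom.pi fun x : σ → K => (eval fun i => algebraMap K R (x i) :
    MvPolynomial σ R →+* R)).range

theorem mem_polyFun {g : (σ → K) → R} :
    g ∈ polyFun σ K R ↔
      ∃ P : MvPolynomial σ R, ∀ x, g x = eval (fun i => algebraMap K R (x i)) P := by
  constructor
  · rintro ⟨P, rfl⟩
    exact ⟨P, fun x => rfl⟩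
  · rintro ⟨P, h⟩
    exact ⟨P, _root_.funext fun x => (h x).symm⟩

theorem const_mem_polyFun (r : R) : (fun _ => r) ∈ polyFun σ K R :=
  mem_polyFun.2 ⟨C r, fun x => by simp⟩

theorem coord_mem_polyFun (i : σ) : (fun x => x i) ∈ polyFun σ K K :=
  mem_polyFun.2 ⟨X i, fun x => by simp⟩

theorem algebraMap_mem_polyFun {g : (σ → K) → K} (hg : g ∈ polyFun σ K K) :
    (fun x => algebraMap K R (g x)) ∈ polyFun σ K R := by
  obtain ⟨P, hP⟩ := mem_polyFun.1 hg
  refine mem_polyFun.2 ⟨map (algebraMap K R) P, fun x => ?_⟩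
  rw [hP, eval_map, eval₂_comp]
  rfl

theorem sum_mem_polyFun {ι : Type*} {s : Finset ι} {g : ι → (σ → K) → R}
    (h : ∀ i ∈ s, g i ∈ polyFun σ K R) : (fun x => ∑ i ∈ s, g i x) ∈ polyFun σ K R := by
  convert sum_mem h using 1
  ext x; simp

theorem prod_mem_polyFun {ι : Type*} {s : Finset ι} {g : ι → (σ → K) → R}
    (h : ∀ i ∈ s, g i ∈ polyFun σ K R) : (fun x => ∏ i ∈ s, g i x) ∈ polyFun σ K R := by
  convert prod_mem h using 1
  ext x; simp

theorem mul_mem_polyFun {g h : (σ → K) → R} (hg : g ∈ polyFun σ K R) (hh : h ∈ polyFun σ K R) :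
    (fun x => g x * h x) ∈ polyFun σ K R := mul_mem hg hh

theorem smul_mem_polyFun {g : (σ → K) → K} {h : (σ → K) → R} (hg : g ∈ polyFun σ K K)
    (hh : h ∈ polyFun σ K R) : (fun x => g x • h x) ∈ polyFun σ K R := by
  simp_rw [Algebra.smul_def]
  exact mul_mem_polyFun (algebraMap_mem_polyFun hg) hh

theorem linearMap_mem_polyFun (l : R →ₗ[K] K) {g : (σ → K) → R} (hg : g ∈ polyFun σ K R) :
    (fun x => l (g x)) ∈ polyFun σ K K := by
  obtain ⟨P, hP⟩ := mem_polyFun.1 hg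
  have : (fun x => l (g x)) =
      fun x => ∑ d ∈ P.support, l (coeff d P) * ∏ i ∈ d.support, x i ^ d i := by
    ext x
    rw [hP, eval_eq, map_sum]
    refine Finset.sum_congr rfl fun d _ => ?_
    rw [mul_comm, mul_comm (l _), ← smul_eq_mul (a := ∏ i ∈ d.support, x i ^ d i), ← map_smul,
      Algebra.smul_def]
    simp
  rw [this]
  refine sum_mem_polyFun fun d _ => mul_mem_polyFun (const_mem_polyFun _)
    (prod_mem_polyFun fun i _ => ?_)
  exact pow_mem (coord_mem_polyFun i) (d i)

theorem comp_mem_polyFun {g : (σ → K) → K} (hg : g ∈ polyFun σ K K) {h : (τ → K) → σ → K}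
    (hh : ∀ i, (fun x => h x i) ∈ polyFun τ K K) : (fun x => g (h x)) ∈ polyFun τ K K := by
  obtain ⟨P, hP⟩ := mem_polyFun.1 hg
  have : (fun x => g (h x)) =
      fun x => ∑ d ∈ P.support, coeff d P * ∏ i ∈ d.support, h x i ^ d i := by
    ext x
    rw [hP, eval_eq]
    rfl
  rw [this]
  refine sum_mem_polyFun fun d _ => mul_mem_polyFun (const_mem_polyFun _)
    (prod_mem_polyFun fun i _ => ?_)
  exact pow_mem (hh i) (d i)

theorem eventually_ne_zero_of_polyFun {g : (σ → K) → K} (hg : g ∈ polyFun σ K K) {x₀ : σ → K}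
    (h : g x₀ ≠ 0) : ∀ᶠ x in zariski σ K, g x ≠ 0 := by
  obtain ⟨P, hP⟩ := mem_polyFun.1 hg
  refine ⟨P, ?_, fun x hx => ?_⟩
  · rintro rfl
    simp [hP] at h
  · rw [Set.mem_ofPred_eq, hP]
    exact hx

theorem det_mem_polyFun {ι : Type*} [Fintype ι] [DecidableEq ι] {M : (σ → K) → Matrix ι ι K}
    (h : ∀ i j, (fun x => M x i j) ∈ polyFun σ K K) :
    (fun x => (M x).det) ∈ polyFun σ K K := by
  simp_rw [Matrix.det_apply, Units.smul_def, zsmul_eq_mul]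
  exact sum_mem_polyFun fun p _ => mul_mem_polyFun (const_mem_polyFun _)
    (prod_mem_polyFun fun i _ => h _ _)

theorem exists_dual_of_linearIndependent {V ι : Type*} [AddCommGroup V] [Module K V] [DecidableEq ι]
    {v : ι → V} (hv : LinearIndependent K v) :
    ∃ l : ι → (V →ₗ[K] K), ∀ i j, l i (v j) = if i = j then 1 else 0 := by
  obtain ⟨L, hL⟩ := LinearMap.exists_leftInverse_of_injective
    (Finsupp.linearCombination K v) (LinearMap.ker_eq_bot.2 hv)
  refine ⟨fun i => (Finsupp.lapply i) ∘ₗ L, fun i j => ?_⟩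
  have := LinearMap.congr_fun hL (Finsupp.single j 1)
  simp only [LinearMap.comp_apply, Finsupp.linearCombination_single, one_smul,
    LinearMap.id_apply] at this
  simp [this, Finsupp.single_apply, eq_comm]

theorem exists_dual_of_linearIndepOn {V ι : Type*} [AddCommGroup V] [Module K V] [DecidableEq ι]
    {v : ι → V} {s : Set ι} (hv : LinearIndepOn K v s) :
    ∃ l : ι → (V →ₗ[K] K), ∀ i ∈ s, ∀ j ∈ s, l i (v j) = if i = j then 1 else 0 := by
  classical
  obtain ⟨l, hl⟩ := exists_dual_of_linearIndependent hv
  refine ⟨fun i => if h : i ∈ s then l ⟨i, h⟩ else 0, fun i hi j hj => ?_⟩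
  have := hl ⟨i, hi⟩ ⟨j, hj⟩
  simp only [Subtype.mk.injEq] at this
  simpa [hi] using this

/-- Linear independence is a Zariski open condition. -/
theorem eventually_linearIndependent {ι : Type*} [Finite ι] {v : ι → (σ → K) → R}
    (hv : ∀ i, v i ∈ polyFun σ K R) {x₀ : σ → K} (h : LinearIndependent K fun i => v i x₀) :
    ∀ᶠ x in zariski σ K, LinearIndependent K fun i => v i x := by
  classical
  have := Fintype.ofFinite ι
  obtain ⟨l, hl⟩ := exists_dual_of_linearIndependent h
  -- The functionals are dual to the vectors at `x₀`, so this determinant is 1 there and therefore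
  -- generically nonzero. Independence of the images under `l` pulls back to the vectors.
  have hdet : ∀ᶠ x in zariski σ K, (Matrix.of fun i j => l j (v i x)).det ≠ 0 := by
    refine eventually_ne_zero_of_polyFun (x₀ := x₀)
      (det_mem_polyFun fun i j => linearMap_mem_polyFun _ (hv i)) ?_
    have : (Matrix.of fun i j => l j (v i x₀)) = 1 := by
      ext i j
      simp [hl, Matrix.one_apply, eq_comm]
    rw [this, Matrix.det_one]
    exact one_ne_zero
  filter_upwards [hdet] with x hx
  exact LinearIndependent.of_comp (LinearMap.pi l)
    (Matrix.linearIndependent_rows_of_det_ne_zero hx)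

/-- The rank of a finite polynomial family of vectors is generically constant. -/
theorem exists_eventually_finrank_span_eq {ι : Type*} {T : Set ι} (hT : T.Finite)
    {v : ι → (σ → K) → R} (hv : ∀ i, v i ∈ polyFun σ K R) :
    ∃ r, ∀ᶠ x in zariski σ K,
      Module.finrank K (Submodule.span K ((fun i => v i x) '' T)) = r := by
  classical
  lift T to Finset ι using hT
  set rk : (σ → K) → ℕ := fun x => Module.finrank K (Submodule.span K ((fun i => v i x) '' T))
  have hfin : ∀ x, FiniteDimensional K (Submodule.span K ((fun i => v i x) '' T)) := fun x =>
    FiniteDimensional.span_of_finite K (T.finite_toSet.image _)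
  have hle : ∀ x, rk x ≤ T.card := by
    intro x
    have := finrank_span_finset_le_card (R := K) (T.image fun i => v i x)
    rw [Finset.coe_image] at this
    exact this.trans Finset.card_image_le
  have hbdd : BddAbove (Set.range rk) := ⟨T.card, by rintro _ ⟨x, rfl⟩; exact hle x⟩
  -- The generic rank is the maximal one: a basis chosen at a point of maximal rank stays
  -- independent on an open set.
  obtain ⟨x₀, hx₀⟩ := Nat.sSup_mem (Set.range_nonempty rk) hbdd
  have hmax : ∀ x, rk x ≤ rk x₀ := fun x => hx₀ ▸ le_csSup hbdd ⟨x, rfl⟩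
  refine ⟨rk x₀, ?_⟩
  obtain ⟨b, hbT, hb0, hspan, hli⟩ := exists_linearIndepOn_extension
    (linearIndepOn_empty K fun i => v i x₀) (Set.empty_subset (T : Set ι))
  have hbfin : Finite b := (T.finite_toSet.subset hbT).to_subtype
  have := Fintype.ofFinite b
  have hcard : rk x₀ = Fintype.card b := by
    rw [← finrank_span_eq_card (R := K) (b := fun i : b => v i x₀) hli]
    have : Submodule.span K ((fun i => v i x₀) '' T) =
        Submodule.span K (Set.range fun i : b => v i x₀) := by
      refine le_antisymm (Submodule.span_le.2 ?_) (Submodule.span_mono ?_)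
      · rw [← Set.image_eq_range (fun i => v i x₀) b]
        exact hspan
      · rintro _ ⟨i, rfl⟩
        exact ⟨i, hbT i.2, rfl⟩
    change Module.finrank K (Submodule.span K _) = _
    rw [this]
  filter_upwards [eventually_linearIndependent (v := fun i : b => v i) (fun i => hv i) hli]
    with x hx
  refine le_antisymm (hmax x) ?_
  rw [hcard, ← finrank_span_eq_card (R := K) hx]
  have := hfin x
  refine Submodule.finrank_mono (Submodule.span_mono ?_)
  rintro _ ⟨i, rfl⟩
  exact ⟨i, hbT i.2, rfl⟩

end Generic

end SymmetricShifting

namespace SymmetricShifting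

open MvPolynomial Filter
open scoped MonomialOrder

/-! ### Initial exponents of a family of elements of an algebra -/

section Init

variable {K : Type*} [Field K] {R : Type*} [CommRing R] [Algebra K R] {N : ℕ}

/-- The monomial `f^b` in a family of elements `f`. -/
noncomputable def mon (f : Fin N → R) (b : Fin N →₀ ℕ) : R := b.prod fun i e => f i ^ e

@[simp] theorem mon_zero (f : Fin N → R) : mon f 0 = 1 := Finsupp.prod_zero_index

theorem mon_add (f : Fin N → R) (a b : Fin N →₀ ℕ) : mon f (a + b) = mon f a * mon f b :=
  Finsupp.prod_add_index' (fun _ => pow_zero _) fun _ _ _ => pow_add _ _ _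

@[simp] theorem mon_single (f : Fin N → R) (i : Fin N) : mon f (Finsupp.single i 1) = f i := by
  simp [mon]

theorem mon_eq_prod (f : Fin N → R) (b : Fin N →₀ ℕ) : mon f b = ∏ i, f i ^ b i :=
  Finsupp.prod_fintype _ _ fun _ => pow_zero _

theorem map_mon {R' F : Type*} [CommRing R'] [FunLike F R R'] [RingHomClass F R R'] (ψ : F)
    (f : Fin N → R) (b : Fin N →₀ ℕ) : ψ (mon f b) = mon (fun i => ψ (f i)) b := by
  simp [mon_eq_prod, map_prod]

theorem mon_X (b : Fin N →₀ ℕ) : mon (X : Fin N → MvPolynomial (Fin N) K) b = monomial b 1 := by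
  rw [monomial_eq, C_1, one_mul]
  rfl

theorem mon_mem_polyFun {σ : Type*} {f : Fin N → (σ → K) → R} (hf : ∀ i, f i ∈ polyFun σ K R)
    (b : Fin N →₀ ℕ) : (fun x => mon (fun i => f i x) b) ∈ polyFun σ K R := by
  simp_rw [mon_eq_prod]
  exact prod_mem_polyFun fun i _ => pow_mem (hf i) _

variable (K) in
/-- The exponents `b` for which `f^b` is a linear combination of smaller monomials in `f` of the
same degree. -/
def initSet (f : Fin N → R) : Set (Fin N →₀ ℕ) :=
  {b | mon f b ∈ Submodule.span K (mon f '' {c | c.degree = b.degree ∧ c ≺[degRevLex N] b})}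

theorem mem_initSet {f : Fin N → R} {b : Fin N →₀ ℕ} : b ∈ initSet K f ↔
    mon f b ∈ Submodule.span K (mon f '' {c | c.degree = b.degree ∧ c ≺[degRevLex N] b}) :=
  Iff.rfl

theorem add_lt_add_degRevLex {a b : Fin N →₀ ℕ} (c : Fin N →₀ ℕ) (h : a ≺[degRevLex N] b) :
    (a + c) ≺[degRevLex N] (b + c) := by
  rw [map_add, map_add]
  exact add_lt_add_left h _

theorem lt_of_add_lt_add_degRevLex {a b : Fin N →₀ ℕ} (c : Fin N →₀ ℕ)
    (h : (a + c) ≺[degRevLex N] (b + c)) : a ≺[degRevLex N] b := by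
  rw [map_add, map_add] at h
  exact lt_of_add_lt_add_right h

theorem add_mem_initSet {f : Fin N → R} {b : Fin N →₀ ℕ} (hb : b ∈ initSet K f)
    (a : Fin N →₀ ℕ) : b + a ∈ initSet K f := by
  rw [mem_initSet] at hb ⊢
  rw [mon_add, mul_comm]
  have := Submodule.mem_map_of_mem (f := LinearMap.mulLeft K (mon f a)) hb
  rw [Submodule.map_span] at this
  refine Submodule.span_mono ?_ this
  rintro _ ⟨_, ⟨c, ⟨hc, hcb⟩, rfl⟩, rfl⟩
  refine ⟨c + a, ⟨?_, add_lt_add_degRevLex a hcb⟩, ?_⟩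
  · rw [map_add, map_add, hc]
  · simp [mon_add, mul_comm]

theorem mem_initSet_of_le {f : Fin N → R} {a b : Fin N →₀ ℕ} (hb : a ∈ initSet K f)
    (h : a ≤ b) : b ∈ initSet K f := by
  obtain ⟨c, rfl⟩ := exists_add_of_le h
  exact add_mem_initSet hb c

/-- An injective homomorphism creates no new relations. This later permits working in a product of
face rings instead of the face ring of a disjoint union. -/
theorem initSet_comp {R' : Type*} [CommRing R'] [Algebra K R'] (ψ : R →ₐ[K] R')
    (hψ : Function.Injective ψ) (f : Fin N → R) :
    initSet K (fun i => ψ (f i)) = initSet K f := by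
  ext b
  rw [mem_initSet, mem_initSet]
  have : (mon (fun i => ψ (f i)) '' {c | c.degree = b.degree ∧ c ≺[degRevLex N] b}) =
      ψ.toLinearMap '' (mon f '' {c | c.degree = b.degree ∧ c ≺[degRevLex N] b}) := by
    rw [Set.image_image]
    refine Set.image_congr fun c _ => ?_
    exact (map_mon ψ f c).symm
  rw [this, ← Submodule.map_span, ← map_mon ψ]
  exact Function.Injective.mem_set_image (f := ψ.toLinearMap) hψ

theorem initSet_subset_map {R' : Type*} [CommRing R'] [Algebra K R'] (ψ : R →ₐ[K] R')
    (f : Fin N → R) : initSet K f ⊆ initSet K (fun i => ψ (f i)) := by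
  intro b hb
  rw [mem_initSet] at hb ⊢
  rw [← map_mon ψ]
  have := Submodule.mem_map_of_mem (f := ψ.toLinearMap) hb
  rw [Submodule.map_span, Set.image_image] at this
  have e : (mon (fun i => ψ (f i)) '' {c | c.degree = b.degree ∧ c ≺[degRevLex N] b}) =
      (fun c => ψ (mon f c)) '' {c | c.degree = b.degree ∧ c ≺[degRevLex N] b} :=
    Set.image_congr fun c _ => (map_mon ψ f c).symm
  rw [e]
  exact this

/-- An initial segment of the exponents of degree `d`. -/
structure IsSegment (d : ℕ) (T : Set (Fin N →₀ ℕ)) : Prop where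
  degree_eq : ∀ c ∈ T, c.degree = d
  mem_of_lt : ∀ c ∈ T, ∀ c' : Fin N →₀ ℕ, c'.degree = d → c' ≺[degRevLex N] c → c' ∈ T

theorem IsSegment.finite {d : ℕ} {T : Set (Fin N →₀ ℕ)} (h : IsSegment d T) : T.Finite :=
  (Finsupp.finite_of_degree_eq d).subset h.degree_eq

theorem isSegment_lt (b : Fin N →₀ ℕ) :
    IsSegment b.degree {c | c.degree = b.degree ∧ c ≺[degRevLex N] b} :=
  ⟨fun _ h => h.1, fun _ h _ h1 h2 => ⟨h1, h2.trans h.2⟩⟩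

theorem isSegment_le (b : Fin N →₀ ℕ) :
    IsSegment b.degree {c | c.degree = b.degree ∧ c ≼[degRevLex N] b} :=
  ⟨fun _ h => h.1, fun _ h _ h1 h2 => ⟨h1, h2.le.trans h.2⟩⟩

theorem isSegment_degree (d : ℕ) : IsSegment d {c : Fin N →₀ ℕ | c.degree = d} :=
  ⟨fun _ h => h, fun _ _ _ h _ => h⟩

/-- An initial monomial is rewritten by smaller ones of the same degree, which stay in the segment;
the order is well-founded, so only standard monomials remain. -/
theorem IsSegment.span_eq {d : ℕ} {T : Set (Fin N →₀ ℕ)} (h : IsSegment d T) (f : Fin N → R) :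
    Submodule.span K (mon f '' T) = Submodule.span K (mon f '' (T \ initSet K f)) := by
  refine le_antisymm (Submodule.span_le.2 ?_)
    (Submodule.span_mono (Set.image_mono Set.sdiff_subset))
  have key : ∀ s : (degRevLex N).syn, ∀ c ∈ T, (degRevLex N).toSyn c = s →
      mon f c ∈ Submodule.span K (mon f '' (T \ initSet K f)) := by
    intro s
    induction s using WellFoundedLT.induction with
    | ind s ih =>
      rintro c hc rfl
      by_cases hi : c ∈ initSet K f
      · refine Submodule.span_le.2 ?_ (mem_initSet.1 hi)
        rintro _ ⟨c', ⟨h1, h2⟩, rfl⟩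
        exact ih _ h2 c' (h.mem_of_lt c hc c' (h1.trans (h.degree_eq c hc)) h2) rfl
      · exact Submodule.subset_span ⟨c, ⟨hc, hi⟩, rfl⟩
  rintro _ ⟨c, hc, rfl⟩
  exact key _ c hc rfl

/-- In a nontrivial relation the largest monomial with nonzero coefficient would be a combination of
smaller ones, hence initial. -/
theorem linearIndepOn_compl_initSet (d : ℕ) (f : Fin N → R) :
    LinearIndepOn K (mon f) ({c | c.degree = d} \ initSet K f) := by
  classical
  rw [linearIndepOn_iff']
  intro s g hs hsum
  by_contra! hne
  obtain ⟨i, his, hi0⟩ := hne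
  obtain ⟨m, hm, hmax⟩ := Finset.exists_max_image (s.filter fun i => g i ≠ 0)
    (degRevLex N).toSyn ⟨i, by simp [his, hi0]⟩
  rw [Finset.mem_filter] at hm
  refine (hs hm.1).2 ?_
  rw [← Finset.sum_filter_add_sum_filter_not s (fun i => g i ≠ 0)] at hsum
  have h0 : ∑ x ∈ s with ¬g x ≠ 0, g x • mon f x = 0 :=
    Finset.sum_eq_zero fun x hx => by
      rw [Finset.mem_filter, not_not] at hx
      simp [hx.2]
  rw [h0, add_zero, ← Finset.add_sum_erase _ _ (Finset.mem_filter.2 hm)] at hsum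
  rw [mem_initSet]
  have : mon f m = -((g m)⁻¹ • ∑ x ∈ (s.filter fun i => g i ≠ 0).erase m, g x • mon f x) := by
    rw [eq_neg_iff_add_eq_zero, ← smul_right_injective R hm.2 |>.eq_iff, smul_add, smul_smul,
      mul_inv_cancel₀ hm.2, one_smul, hsum, smul_zero]
  rw [this]
  refine neg_mem (Submodule.smul_mem _ _ (Submodule.sum_mem _ fun x hx => Submodule.smul_mem _ _
    (Submodule.subset_span ⟨x, ⟨?_, ?_⟩, rfl⟩)))
  · rw [Finset.mem_erase, Finset.mem_filter] at hx
    exact (hs hx.2.1).1.trans (hs hm.1).1.symm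
  · rw [Finset.mem_erase] at hx
    exact lt_of_le_of_ne (hmax x hx.2) fun h => hx.1 ((degRevLex N).toSyn.injective h)

theorem IsSegment.finrank_span {d : ℕ} {T : Set (Fin N →₀ ℕ)} (h : IsSegment d T)
    (f : Fin N → R) :
    Module.finrank K (Submodule.span K (mon f '' T)) = (T \ initSet K f).ncard := by
  classical
  rw [h.span_eq f]
  have hli : LinearIndepOn K (mon f) (T \ initSet K f) :=
    (linearIndepOn_compl_initSet d f).mono (Set.sdiff_subset_sdiff_left h.degree_eq)
  have hfin : Fintype ↑(T \ initSet K f) := (h.finite.subset Set.sdiff_subset).fintype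
  rw [Set.image_eq_range, finrank_span_eq_card hli, Set.ncard_eq_toFinset_card',
    Set.toFinset_card]

/-- The span of the monomials of degree `d` in a family of elements. -/
def degSpan (K : Type*) [Field K] {R : Type*} [CommRing R] [Algebra K R] {N : ℕ}
    (g : Fin N → R) (d : ℕ) : Submodule K R :=
  Submodule.span K (mon g '' {c | c.degree = d})

theorem mon_mem_degSpan (g : Fin N → R) (c : Fin N →₀ ℕ) : mon g c ∈ degSpan K g c.degree :=
  Submodule.subset_span ⟨c, rfl, rfl⟩

theorem mul_mem_degSpan {g : Fin N → R} {d e : ℕ} {x y : R} (hx : x ∈ degSpan K g d)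
    (hy : y ∈ degSpan K g e) : x * y ∈ degSpan K g (d + e) := by
  have h := Submodule.mul_mem_mul hx hy
  rw [degSpan, degSpan, Submodule.span_mul_span] at h
  refine Submodule.span_mono ?_ h
  rintro _ ⟨_, ⟨a, ha, rfl⟩, _, ⟨b, hb, rfl⟩, rfl⟩
  refine ⟨a + b, ?_, mon_add g a b⟩
  change (a + b).degree = d + e
  rw [map_add, ha, hb]

theorem mem_degSpan_one {g : Fin N → R} {x : R} (hx : x ∈ Submodule.span K (Set.range g)) :
    x ∈ degSpan K g 1 := by
  refine Submodule.span_mono ?_ hx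
  rintro _ ⟨i, rfl⟩
  exact ⟨Finsupp.single i 1, Finsupp.degree_single i 1, mon_single g i⟩

/-- An exponent of positive degree is the sum of a unit vector and another exponent. -/
theorem exists_eq_add_single {σ : Type*} {b : σ →₀ ℕ} {i : σ} (h : b i ≠ 0) :
    ∃ c, b = c + Finsupp.single i 1 :=
  ⟨b - Finsupp.single i 1, (tsub_add_cancel_of_le (by
    rw [Finsupp.single_le_iff]; omega)).symm⟩

theorem mon_mem_degSpan_of_mem {M : ℕ} {f : Fin N → R} {g : Fin M → R}
    (h : ∀ i, f i ∈ Submodule.span K (Set.range g)) (c : Fin N →₀ ℕ) :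
    mon f c ∈ degSpan K g c.degree := by
  induction c using Finsupp.induction_linear with
  | zero =>
    rw [mon_zero, map_zero]
    exact Submodule.subset_span ⟨0, map_zero _, mon_zero g⟩
  | add a b ha hb =>
    rw [mon_add, map_add]
    exact mul_mem_degSpan ha hb
  | single i e =>
    induction e with
    | zero =>
      rw [Finsupp.single_zero, mon_zero, map_zero]
      exact Submodule.subset_span ⟨0, map_zero _, mon_zero g⟩
    | succ e ih =>
      rw [Finsupp.single_add, mon_add, map_add, mon_single, Finsupp.degree_single i 1]
      exact mul_mem_degSpan ih (mem_degSpan_one (h i))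

theorem degSpan_le_of_mem {M : ℕ} {f : Fin N → R} {g : Fin M → R}
    (h : ∀ i, f i ∈ Submodule.span K (Set.range g)) (d : ℕ) :
    degSpan K f d ≤ degSpan K g d := by
  refine Submodule.span_le.2 ?_
  rintro _ ⟨c, rfl, rfl⟩
  exact mon_mem_degSpan_of_mem h c

theorem ncard_compl_initSet (f : Fin N → R) (d : ℕ) :
    ({c | c.degree = d} \ initSet K f).ncard = Module.finrank K (degSpan K f d) :=
  ((isSegment_degree d).finrank_span f).symm

end Init

end SymmetricShifting

namespace SymmetricShifting

open MvPolynomial Filter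
open scoped MonomialOrder

/-! ### Generic initial exponents -/

section Order

variable {N : ℕ}

theorem single_lt_single_degRevLex {i j : Fin N} (h : i < j) :
    (Finsupp.single j 1) ≺[degRevLex N] (Finsupp.single i 1) := by
  rw [degRevLex_lt_iff]
  refine Or.inr ⟨by simp, j, ?_, fun k hk => ?_⟩
  · rw [Finsupp.single_eq_of_ne h.ne', Finsupp.single_eq_same]; exact one_pos
  · rw [Finsupp.single_eq_of_ne hk.ne', Finsupp.single_eq_of_ne (h.trans hk).ne']

theorem add_single_lt_add_single_degRevLex (c : Fin N →₀ ℕ) {i j : Fin N} (h : i < j) :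
    (c + Finsupp.single j 1) ≺[degRevLex N] (c + Finsupp.single i 1) := by
  rw [add_comm c, add_comm c]
  exact add_lt_add_degRevLex c (single_lt_single_degRevLex h)

/-- A set of exponents is strongly stable if it is closed under multiplication by monomials, and
under replacing a variable by one with a smaller index. -/
structure StronglyStable (U : Set (Fin N →₀ ℕ)) : Prop where
  add_mem : ∀ a ∈ U, ∀ c, a + c ∈ U
  exchange : ∀ (a : Fin N →₀ ℕ) (i j : Fin N), i < j → a + Finsupp.single j 1 ∈ U →
    a + Finsupp.single i 1 ∈ U

theorem StronglyStable.mem_of_le {U : Set (Fin N →₀ ℕ)} (hU : StronglyStable U)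
    {a b : Fin N →₀ ℕ} (ha : a ∈ U) (h : a ≤ b) : b ∈ U := by
  obtain ⟨c, rfl⟩ := exists_add_of_le h
  exact hU.add_mem a ha c

end Order

/-! ### Generic linear forms and the constancy of their initial exponents -/

section Generic

variable {K : Type*} [Field K] {R : Type*} [CommRing R] [Algebra K R] {n N : ℕ}

/-- The family of linear combinations of `v` with the coefficients given by the columns of `B`. -/
def lin (v : Fin n → R) (B : Fin n × Fin N → K) (i : Fin N) : R := ∑ j, B (j, i) • v j

theorem lin_mem_polyFun (v : Fin n → R) (i : Fin N) :
    (fun B : Fin n × Fin N → K => lin v B i) ∈ polyFun (Fin n × Fin N) K R :=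
  sum_mem_polyFun fun _ _ => smul_mem_polyFun (coord_mem_polyFun _) (const_mem_polyFun _)

theorem lin_mem_span (v : Fin n → R) (B : Fin n × Fin N → K) (i : Fin N) :
    lin v B i ∈ Submodule.span K (Set.range v) :=
  Submodule.sum_mem _ fun j _ => Submodule.smul_mem _ _ (Submodule.subset_span ⟨j, rfl⟩)

theorem map_lin {R' : Type*} [CommRing R'] [Algebra K R'] (ψ : R →ₐ[K] R') (v : Fin n → R)
    (B : Fin n × Fin N → K) (i : Fin N) : ψ (lin v B i) = lin (fun j => ψ (v j)) B i := by
  simp [lin]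

theorem mem_span_lin_of_isUnit (v : Fin n → R) (B : Fin n × Fin n → K)
    (h : (Matrix.of fun i j => B (i, j)).det ≠ 0) (j : Fin n) :
    v j ∈ Submodule.span K (Set.range (lin v B)) := by
  set M : Matrix (Fin n) (Fin n) K := Matrix.of fun i j => B (i, j)
  have hM : M * M⁻¹ = 1 := Matrix.mul_nonsing_inv M (isUnit_iff_ne_zero.2 h)
  have : v j = ∑ i, M⁻¹ i j • lin v B i := by
    simp_rw [lin, Finset.smul_sum, smul_smul]
    rw [Finset.sum_comm]
    simp_rw [← Finset.sum_smul]
    have : ∀ k, ∑ i, M⁻¹ i j * B (k, i) = if k = j then 1 else 0 := by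
      intro k
      rw [← Matrix.one_apply, ← hM, Matrix.mul_apply]
      exact Finset.sum_congr rfl fun i _ => mul_comm _ _
    simp [this]
  rw [this]
  exact Submodule.sum_mem _ fun i _ => Submodule.smul_mem _ _ (Submodule.subset_span ⟨i, rfl⟩)

theorem eventually_det_submatrix_ne_zero {m : ℕ} {e : Fin m → Fin n} {e' : Fin m → Fin N}
    (he : Function.Injective e) (he' : Function.Injective e') :
    ∀ᶠ B in zariski (Fin n × Fin N) K, (Matrix.of fun i j => B (e i, e' j)).det ≠ 0 := by
  classical
  -- The partial permutation matrix with ones at the positions `(e i, e' i)` has the identity as the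
  -- chosen submatrix.
  refine eventually_ne_zero_of_polyFun (x₀ := fun p => if ∃ i, p = (e i, e' i) then 1 else 0)
    (det_mem_polyFun fun i j => coord_mem_polyFun _) ?_
  have : (Matrix.of fun i j => (fun p : Fin n × Fin N =>
      if ∃ i, p = (e i, e' i) then (1 : K) else 0) (e i, e' j)) = 1 := by
    ext i j
    simp only [Matrix.of_apply, Matrix.one_apply, Prod.mk.injEq]
    congr 1
    simp only [eq_iff_iff]
    constructor
    · rintro ⟨k, h1, h2⟩
      rw [he h1, he' h2]
    · rintro rfl
      exact ⟨i, rfl, rfl⟩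
  rw [this, Matrix.det_one]
  exact one_ne_zero

theorem eventually_mem_span_lin (v : Fin n → R) {e : Fin n → Fin N} (he : Function.Injective e) :
    ∀ᶠ B in zariski (Fin n × Fin N) K,
      ∀ j, v j ∈ Submodule.span K (Set.range fun k => lin v B (e k)) := by
  filter_upwards [eventually_det_submatrix_ne_zero Function.injective_id he] with B hB j
  exact mem_span_lin_of_isUnit v (fun p => B (p.1, e p.2)) hB j

theorem eventually_degSpan_lin (v : Fin n → R) :
    ∀ᶠ B in zariski (Fin n × Fin n) K, ∀ d, degSpan K (lin v B) d = degSpan K v d := by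
  filter_upwards [eventually_mem_span_lin v Function.injective_id] with B hB d
  exact le_antisymm (degSpan_le_of_mem (lin_mem_span v B) d) (degSpan_le_of_mem hB d)

variable (K) in
/-- The exponents that are initial for generic linear combinations of `v`. -/
def genSet (v : Fin n → R) : Set (Fin n →₀ ℕ) :=
  {b | ∀ᶠ B in zariski (Fin n × Fin n) K, b ∈ initSet K (lin v B)}

theorem mem_genSet {v : Fin n → R} {b : Fin n →₀ ℕ} :
    b ∈ genSet K v ↔ ∀ᶠ B in zariski (Fin n × Fin n) K, b ∈ initSet K (lin v B) := Iff.rfl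

/-- An exponent is initial exactly when adding it to the segment of smaller exponents does not raise
the rank of the span. Both ranks are generically constant, so generically it is either always or
never initial. -/
theorem eventually_mem_initSet_iff [Infinite K] (v : Fin n → R) (b : Fin n →₀ ℕ) :
    ∀ᶠ B in zariski (Fin n × Fin n) K, (b ∈ initSet K (lin v B) ↔ b ∈ genSet K v) := by
  suffices h : (∀ᶠ B in zariski (Fin n × Fin n) K, b ∈ initSet K (lin v B)) ∨
      ∀ᶠ B in zariski (Fin n × Fin n) K, b ∉ initSet K (lin v B) by
    rcases h with h | h
    · have hb : b ∈ genSet K v := h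
      filter_upwards [h] with B hB
      exact iff_of_true hB hb
    · have hb : b ∉ genSet K v := fun h' => by
        obtain ⟨B, h1, h2⟩ := (h.and h').exists
        exact h1 h2
      filter_upwards [h] with B hB
      exact iff_of_false hB hb
  have hfin := isSegment_lt b |>.finite
  have hfin' := isSegment_le b |>.finite
  obtain ⟨r, hr⟩ := exists_eventually_finrank_span_eq hfin
    (v := fun c (B : Fin n × Fin n → K) => mon (lin v B) c)
    (mon_mem_polyFun (lin_mem_polyFun v))
  obtain ⟨r', hr'⟩ := exists_eventually_finrank_span_eq hfin'
    (v := fun c (B : Fin n × Fin n → K) => mon (lin v B) c)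
    (mon_mem_polyFun (lin_mem_polyFun v))
  have key : ∀ B : Fin n × Fin n → K, b ∈ initSet K (lin v B) ↔
      Module.finrank K (Submodule.span K
        (mon (lin v B) '' {c | c.degree = b.degree ∧ c ≼[degRevLex n] b})) =
      Module.finrank K (Submodule.span K
        (mon (lin v B) '' {c | c.degree = b.degree ∧ c ≺[degRevLex n] b})) := by
    intro B
    rw [(isSegment_lt b).finrank_span, (isSegment_le b).finrank_span]
    have hsub : {c : Fin n →₀ ℕ | c.degree = b.degree ∧ c ≺[degRevLex n] b} \
        initSet K (lin v B) ⊆ {c | c.degree = b.degree ∧ c ≼[degRevLex n] b} \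
        initSet K (lin v B) := fun c hc => ⟨⟨hc.1.1, hc.1.2.le⟩, hc.2⟩
    constructor
    · intro hb
      congr 1
      refine (Set.Subset.antisymm hsub ?_).symm
      rintro c ⟨⟨h1, h2⟩, h3⟩
      refine ⟨⟨h1, lt_of_le_of_ne h2 fun h => h3 ?_⟩, h3⟩
      rwa [(degRevLex n).toSyn.injective h]
    · intro h
      have := Set.eq_of_subset_of_ncard_le hsub h.le (hfin'.subset Set.sdiff_subset)
      by_contra hb
      have hmem : b ∈ {c : Fin n →₀ ℕ | c.degree = b.degree ∧ c ≺[degRevLex n] b} \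
        initSet K (lin v B) := this ▸ ⟨⟨rfl, le_rfl⟩, hb⟩
      exact lt_irrefl _ hmem.1.2
  by_cases h : r' = r
  · left
    filter_upwards [hr, hr'] with B h1 h2
    rw [key]
    exact h2.trans (h.trans h1.symm)
  · right
    filter_upwards [hr, hr'] with B h1 h2
    rw [key]
    exact fun h3 => h (h2.symm.trans (h3.trans h1))

theorem genSet_add_mem (v : Fin n → R) (b : Fin n →₀ ℕ) (hb : b ∈ genSet K v) (a : Fin n →₀ ℕ) :
    b + a ∈ genSet K v :=
  Eventually.mono (mem_genSet.1 hb) fun _ h => add_mem_initSet h a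

theorem exists_finite_generators {U : Set (Fin n →₀ ℕ)} :
    {a | Minimal (· ∈ U) a}.Finite ∧ ∀ b ∈ U, ∃ a, Minimal (· ∈ U) a ∧ a ≤ b := by
  refine ⟨WellQuasiOrderedLE.finite_of_isAntichain (setOfPred_minimal_antichain _), fun b hb => ?_⟩
  obtain ⟨a, hab, ha⟩ := exists_minimal_le_of_wellFoundedLT (· ∈ U) b hb
  exact ⟨a, ha, hab⟩

theorem ncard_compl_genSet [Infinite K] (v : Fin n → R) (d : ℕ) :
    ({c | c.degree = d} \ genSet K v).ncard = Module.finrank K (degSpan K v d) := by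
  have h : ∀ᶠ B in zariski (Fin n × Fin n) K, ∀ b ∈ {c : Fin n →₀ ℕ | c.degree = d},
      (b ∈ initSet K (lin v B) ↔ b ∈ genSet K v) :=
    (eventually_all_finite (Finsupp.finite_of_degree_eq d)).2
      fun b _ => eventually_mem_initSet_iff v b
  obtain ⟨B, h1, h2⟩ := (h.and (eventually_degSpan_lin v)).exists
  rw [← h2, ← ncard_compl_initSet]
  congr 1
  ext c
  exact and_congr_right fun hc => not_congr (h1 c hc).symm

/-- The set of initial exponents is the same for almost all linear combinations. -/
theorem eventually_initSet_eq [Infinite K] (v : Fin n → R) :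
    ∀ᶠ B in zariski (Fin n × Fin n) K, initSet K (lin v B) = genSet K v := by
  -- Only finitely many open conditions may be intersected, so membership is imposed on the minimal
  -- generators alone. The other exponents follow by divisibility, and the reverse inclusion by
  -- comparing dimensions in each degree.
  obtain ⟨hfin, hgen⟩ := exists_finite_generators (U := genSet K v)
  have h : ∀ᶠ B in zariski (Fin n × Fin n) K, ∀ b ∈ {a | Minimal (· ∈ genSet K v) a},
      b ∈ initSet K (lin v B) :=
    (eventually_all_finite hfin).2 fun b hb => hb.1
  filter_upwards [h, eventually_degSpan_lin v] with B h1 h2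
  have hsub : genSet K v ⊆ initSet K (lin v B) := by
    intro b hb
    obtain ⟨a, ha, hab⟩ := hgen b hb
    exact mem_initSet_of_le (h1 a ha) hab
  refine Set.Subset.antisymm (fun b hb => ?_) hsub
  have hcard : ({c | c.degree = b.degree} \ genSet K v).ncard ≤
      ({c | c.degree = b.degree} \ initSet K (lin v B)).ncard := by
    rw [ncard_compl_genSet, ncard_compl_initSet, h2]
  have := Set.eq_of_subset_of_ncard_le (Set.sdiff_subset_sdiff_right hsub) hcard
    ((Finsupp.finite_of_degree_eq _).subset Set.sdiff_subset)
  by_contra hb'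
  have hmem : b ∈ {c | c.degree = b.degree} \ initSet K (lin v B) := this ▸ ⟨rfl, hb'⟩
  exact hmem.2 hb

theorem genSet_subset_of_map [Infinite K] {R' : Type*} [CommRing R'] [Algebra K R']
    (ψ : R →ₐ[K] R') (v : Fin n → R) : genSet K v ⊆ genSet K fun i => ψ (v i) := by
  intro b hb
  refine Eventually.mono (mem_genSet.1 hb) fun B h => ?_
  have := initSet_subset_map ψ _ h
  simpa only [map_lin] using this

end Generic

end SymmetricShifting

namespace SymmetricShifting

open MvPolynomial Filter
open scoped MonomialOrder

/-! ### Strong stability of the generic initial exponents -/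

section Stable

variable {K : Type*} [Field K] {R : Type*} [CommRing R] [Algebra K R] {n N : ℕ}

/-- The factor `m` in the linear coefficient is where characteristic 0 will enter. For `m = 0` it
also makes the truncated exponent `m - 1` harmless. -/
theorem exists_expand_pow (a b : R) (m : ℕ) :
    ∃ g ∈ polyFun Unit K R, ∀ t : Unit → K, (a + t () • b) ^ m =
      a ^ m + t () • ((m : R) * a ^ (m - 1) * b) + (t () ^ 2) • g t := by
  induction m with
  | zero => exact ⟨_, const_mem_polyFun 0, fun t => by simp⟩
  | succ m ih =>
    obtain ⟨g, hg, h⟩ := ih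
    refine ⟨fun t => g t * (a + t () • b) + (m : R) * a ^ (m - 1) * b * b, ?_, fun t => ?_⟩
    · exact add_mem (mul_mem_polyFun hg (add_mem (const_mem_polyFun a)
        (smul_mem_polyFun (coord_mem_polyFun ()) (const_mem_polyFun b)))) (const_mem_polyFun _)
    · rw [pow_succ, h]
      have : (m : R) * a ^ (m - 1) * b * a = m * a ^ m * b := by
        cases m with
        | zero => simp
        | succ m => simp only [Nat.add_sub_cancel]; ring
      simp only [Algebra.smul_def, map_pow, Nat.add_sub_cancel, Nat.cast_add, Nat.cast_one]
      linear_combination (algebraMap K R (t ())) * this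

/-- The family obtained from `f` by adding `t • f i` to `f j`. -/
def shear (f : Fin N → R) (i j : Fin N) (t : K) : Fin N → R :=
  Function.update f j (f j + t • f i)

/-- The first order expansion of a monomial in a sheared family. -/
theorem exists_expand_mon (f : Fin N → R) {i j : Fin N} (c : Fin N →₀ ℕ) :
    ∃ g ∈ polyFun Unit K R, ∀ t : Unit → K, mon (shear f i j (t ())) c =
      mon f c + t () • ((c j : R) * mon f (c - Finsupp.single j 1 + Finsupp.single i 1)) +
        (t () ^ 2) • g t := by
  obtain ⟨g, hg, h⟩ := exists_expand_pow (K := K) (f j) (f i) (c j)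
  have hprod : ∀ (f' : Fin N → R) (c' : Fin N →₀ ℕ), (∀ k, k ≠ j → f' k = f k ∧ c' k = c k) →
      mon f' c' = (∏ k ∈ Finset.univ.erase j, f k ^ c k) * f' j ^ c' j := by
    intro f' c' hf'
    rw [mon_eq_prod, ← Finset.prod_erase_mul _ _ (Finset.mem_univ j)]
    congr 1
    exact Finset.prod_congr rfl fun k hk => by
      rw [(hf' k (Finset.ne_of_mem_erase hk)).1, (hf' k (Finset.ne_of_mem_erase hk)).2]
  refine ⟨fun t => (∏ k ∈ Finset.univ.erase j, f k ^ c k) * g t,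
    mul_mem_polyFun (const_mem_polyFun _) hg, fun t => ?_⟩
  rw [hprod (shear f i j (t ())) c fun k hk => ⟨Function.update_of_ne hk _ _, rfl⟩,
    hprod f c fun k hk => ⟨rfl, rfl⟩, mon_add, mon_single,
    hprod f (c - Finsupp.single j 1) fun k hk => ⟨rfl, by
      simp [Finsupp.single_eq_of_ne hk]⟩, shear, Function.update_self, h]
  simp only [Algebra.smul_def, map_pow, Finsupp.tsub_apply, Finsupp.single_eq_same]
  ring

theorem shear_mem_polyFun (f : Fin N → R) (i j k : Fin N) :
    (fun t : Unit → K => shear f i j (t ()) k) ∈ polyFun Unit K R := by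
  by_cases h : k = j
  · subst h
    simp only [shear, Function.update_self]
    exact add_mem (const_mem_polyFun _)
      (smul_mem_polyFun (coord_mem_polyFun ()) (const_mem_polyFun _))
  · simp only [shear, Function.update_of_ne h]
    exact const_mem_polyFun _

/-- The initial exponents of a sheared family cannot remain the same if the exchange property
fails. -/
theorem exchange_of_eventually_shear [CharZero K] {f : Fin N → R} {i j : Fin N} (hij : i < j)
    (h : ∀ᶠ t in zariski Unit K, initSet K (shear f i j (t ())) = initSet K f)
    (a : Fin N →₀ ℕ) (ha : a + Finsupp.single j 1 ∈ initSet K f) :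
    a + Finsupp.single i 1 ∈ initSet K f := by
  classical
  by_contra hb'
  set b := a + Finsupp.single j 1 with hb
  set b' := a + Finsupp.single i 1 with hb'_def
  have hdeg : b'.degree = b.degree := by simp [hb, hb'_def]
  have hlt : b ≺[degRevLex N] b' := add_single_lt_add_single_degRevLex a hij
  have hli := linearIndepOn_compl_initSet (K := K) b.degree f
  obtain ⟨l, hl⟩ := exists_dual_of_linearIndepOn hli
  set S : Set (Fin N →₀ ℕ) := {c | c.degree = b.degree ∧ c ≺[degRevLex N] b} \ initSet K f with hS
  have : Finite S := ((isSegment_lt b).finite.subset Set.sdiff_subset).to_subtype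
  have := Fintype.ofFinite S
  -- If `b'` is standard, this functional reads off its coefficient. It kills every smaller monomial
  -- of the same degree, because those are combinations of standard monomials below `b'`.
  obtain ⟨ℓ, hℓ⟩ : ∃ ℓ, ℓ = l b' := ⟨_, rfl⟩
  have hℓb' : ℓ (mon f b') = 1 := by
    have := hl b' ⟨hdeg, hb'⟩ b' ⟨hdeg, hb'⟩
    rwa [if_pos rfl, ← hℓ] at this
  have hℓ0 : ∀ c : Fin N →₀ ℕ, c.degree = b'.degree → c ≺[degRevLex N] b' → ℓ (mon f c) = 0 := by
    intro c h1 h2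
    have hmem : mon f c ∈ Submodule.span K
        (mon f '' {c | c.degree = b'.degree ∧ c ≺[degRevLex N] b'}) :=
      Submodule.subset_span ⟨c, ⟨h1, h2⟩, rfl⟩
    rw [(isSegment_lt b').span_eq f] at hmem
    refine (Submodule.span_le (p := LinearMap.ker ℓ)).2 ?_ hmem
    rintro _ ⟨c', ⟨⟨h3, h4⟩, h5⟩, rfl⟩
    have := hl b' ⟨hdeg, hb'⟩ c' ⟨h3.trans hdeg, h5⟩
    rwa [if_neg (fun h => by
      rw [h] at h4
      exact lt_irrefl _ h4), ← hℓ] at this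
  obtain ⟨L, hL⟩ : ∃ L : S → R →ₗ[K] K, ∀ c c' : S, L c (mon f c') = if c = c' then 1 else 0 := by
    refine ⟨fun c => l c, fun c c' => ?_⟩
    have := hl c ⟨c.2.1.1, c.2.2⟩ c' ⟨c'.2.1.1, c'.2.2⟩
    simpa only [Subtype.ext_iff] using this
  obtain ⟨e, he_inl, he_inr⟩ : ∃ e : S ⊕ Unit → Fin N →₀ ℕ,
      (∀ c, e (Sum.inl c) = c) ∧ e (Sum.inr ()) = b :=
    ⟨Sum.elim (fun c => (c : Fin N →₀ ℕ)) fun _ => b, fun _ => rfl, rfl⟩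
  have he : ∀ r, (e r).degree = b.degree := by
    rintro (c | _)
    · rw [he_inl]
      exact c.2.1.1
    · rw [he_inr]
  have hele : ∀ r, (e r) ≼[degRevLex N] b := by
    rintro (c | _)
    · rw [he_inl]
      exact c.2.1.2.le
    · rw [he_inr]
  choose g hg hexp using fun r => exists_expand_mon (K := K) f (i := i) (j := j) (e r)
  -- `ℓ` vanishes on the unsheared monomials up to `b`, so its value on the sheared ones is
  -- divisible by `t`; `q` is the quotient.
  obtain ⟨q, hq_def⟩ : ∃ q : S ⊕ Unit → (Unit → K) → K, ∀ r t, q r t =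
    ℓ (((e r) j : R) * mon f (e r - Finsupp.single j 1 + Finsupp.single i 1)) +
      t () * ℓ (g r t) := ⟨_, fun _ _ => rfl⟩
  have hq : ∀ r t, ℓ (mon (shear f i j (t ())) (e r)) = t () * q r t := by
    intro r t
    rw [hexp, map_add, map_add, map_smul, map_smul,
      hℓ0 (e r) ((he r).trans hdeg.symm) ((hele r).trans_lt hlt)]
    simp only [hq_def, smul_eq_mul]
    ring
  have hqpoly : ∀ r, q r ∈ polyFun Unit K K := fun r => by
    rw [funext (hq_def r)]
    exact add_mem (const_mem_polyFun _)
      (mul_mem_polyFun (coord_mem_polyFun ()) (linearMap_mem_polyFun ℓ (hg r)))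
  -- For `c < b`, replacing one `x_j` by `x_i` gives a monomial below `b'`, which `ℓ` kills. For `b`
  -- itself the same replacement gives `b'` with multiplicity `b j`.
  have hq0 : ∀ c : S, q (Sum.inl c) (fun _ => 0) = 0 := by
    intro c
    simp only [hq_def, zero_mul, add_zero]
    by_cases hc : (c : Fin N →₀ ℕ) j = 0
    · simp [he_inl, hc]
    · obtain ⟨c', hc'⟩ := exists_eq_add_single hc
      have hc'' : e (Sum.inl c) - Finsupp.single j 1 = c' := by
        simp [he_inl, hc']
      rw [hc'', ← nsmul_eq_mul, map_nsmul, hℓ0, smul_zero]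
      · have := he (Sum.inl c)
        rw [hdeg, ← this]
        simp [he_inl, hc']
      · have h1 : (c' + Finsupp.single j 1) ≺[degRevLex N] (a + Finsupp.single j 1) :=
          hc' ▸ c.2.1.2
        exact add_lt_add_degRevLex _ (lt_of_add_lt_add_degRevLex _ h1)
  have hqb : q (Sum.inr ()) (fun _ => 0) = (b j : K) := by
    have hb'' : e (Sum.inr ()) - Finsupp.single j 1 + Finsupp.single i 1 = b' := by
      simp [he_inr, hb, hb'_def]
    simp only [hq_def, zero_mul, add_zero]
    rw [hb'', ← nsmul_eq_mul, map_nsmul, hℓb']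
    simp [he_inr]
  -- The columns are the coordinates on the standard monomials below `b`, followed by the rescaled
  -- functional. At `t = 0` the matrix is block triangular with determinant `b j`, which is nonzero
  -- in `K` by characteristic 0.
  obtain ⟨M, hM_inl, hM_inr⟩ : ∃ M : (Unit → K) → Matrix (S ⊕ Unit) (S ⊕ Unit) K,
      (∀ t r c, M t r (Sum.inl c) = L c (mon (shear f i j (t ())) (e r))) ∧
        ∀ t r, M t r (Sum.inr ()) = q r t :=
    ⟨fun t => Matrix.of fun r s => Sum.elim (fun c => L c (mon (shear f i j (t ())) (e r)))
      (fun _ => q r t) s, fun _ _ _ => rfl, fun _ _ => rfl⟩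
  have hMpoly : ∀ r s, (fun t => M t r s) ∈ polyFun Unit K K := by
    rintro r (c | _)
    · simp_rw [hM_inl]
      exact linearMap_mem_polyFun (L c) (mon_mem_polyFun (shear_mem_polyFun f i j) (e r))
    · simp_rw [hM_inr]
      exact hqpoly r
  have hshear0 : shear f i j (0 : K) = f := by simp [shear]
  have hM0 : (M fun _ => 0).det ≠ 0 := by
    have : (M fun _ => 0) = Matrix.fromBlocks 1 0
        (Matrix.of fun _ c => L c (mon f b)) (Matrix.of fun _ _ => (b j : K)) := by
      ext r s
      rcases r with r | r <;> rcases s with s | s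
      · simp only [hM_inl, he_inl, hshear0, Matrix.fromBlocks_apply₁₁,
          Matrix.one_apply, hL, eq_comm]
      · simpa [hM_inr] using hq0 r
      · simp [hM_inl, hshear0, he_inr]
      · simpa [hM_inr] using hqb
    rw [this, Matrix.det_fromBlocks_zero₁₂, Matrix.det_one, one_mul, Matrix.det_unique,
      Matrix.of_apply]
    have : b j ≠ 0 := by simp [hb]
    exact_mod_cast this
  have ht0 : ∀ᶠ t in zariski Unit K, t () ≠ 0 :=
    eventually_ne_zero_of_polyFun (x₀ := fun _ => 1) (coord_mem_polyFun ()) one_ne_zero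
  obtain ⟨t, ⟨h1, h2⟩, h3⟩ := ((h.and
    (eventually_ne_zero_of_polyFun (det_mem_polyFun hMpoly) hM0)).and ht0).exists
  have hrows := Matrix.linearIndependent_rows_of_det_ne_zero h2
  have hind : LinearIndependent K fun r => mon (shear f i j (t ())) (e r) := by
    have hcomp : ⇑(LinearMap.pi (φ := fun _ : S ⊕ Unit => K) (Sum.elim L fun _ => (t ())⁻¹ • ℓ)) ∘
        (fun r => mon (shear f i j (t ())) (e r)) = fun r => M t r := by
      ext r s
      rcases s with s | s
      · exact (hM_inl _ _ _).symm
      · simp [hM_inr, hq, h3]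
    exact LinearIndependent.of_comp _ (hcomp ▸ hrows)
  -- For generic `t` the sheared monomials of `S` and of `b` are independent. But the initial set is
  -- unchanged, so the monomial of `b` lies in the span of those of `S`, a contradiction.
  have hbt : b ∈ initSet K (shear f i j (t ())) := h1 ▸ ha
  rw [mem_initSet, (isSegment_lt b).span_eq, h1] at hbt
  refine hind.notMem_span_image (s := Set.range Sum.inl) (x := Sum.inr ()) (by simp) ?_
  rw [he_inr]
  refine Submodule.span_mono ?_ hbt
  rintro _ ⟨c, hc, rfl⟩
  exact ⟨Sum.inl ⟨c, hc⟩, ⟨_, rfl⟩, congrArg _ (he_inl _)⟩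

theorem stronglyStable_genSet [CharZero K] (v : Fin n → R) : StronglyStable (genSet K v) where
  add_mem := genSet_add_mem v
  exchange := by
    intro a i j hij ha
    have hev := eventually_initSet_eq (K := K) v
    obtain ⟨P, hP, h⟩ := eventually_zariski.1 hev
    obtain ⟨B₀, hB₀⟩ := (eventually_eval_ne_zero hP).exists
    -- Adding `t` times column `i` to column `j` realizes the shear on a line through `B₀`. Since
    -- the line meets the open set at `t = 0`, its generic points lie in it and have the same
    -- initial set.
    obtain ⟨Bt, hBt_def⟩ : ∃ Bt : (Unit → K) → (Fin n × Fin n → K), ∀ t p,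
        Bt t p = B₀ p + t () * (if p.2 = j then B₀ (p.1, i) else 0) := ⟨_, fun _ _ => rfl⟩
    have hBt : ∀ t : Unit → K, lin v (Bt t) = shear (lin v B₀) i j (t ()) := by
      intro t
      ext k
      by_cases hk : k = j
      · subst hk
        simp [lin, hBt_def, shear, add_smul, mul_smul, Finset.sum_add_distrib, Finset.smul_sum]
      · simp [lin, hBt_def, shear, hk]
    have hBtpoly : (fun t => eval (Bt t) P) ∈ polyFun Unit K K :=
      comp_mem_polyFun (g := fun B => eval B P) (mem_polyFun.2 ⟨P, fun x => rfl⟩) fun p => by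
        simp_rw [hBt_def]
        exact add_mem (const_mem_polyFun _)
          (mul_mem_polyFun (coord_mem_polyFun ()) (const_mem_polyFun _))
    have hB00 : Bt (fun _ => 0) = B₀ := by
      ext p; simp [hBt_def]
    have hevt := eventually_ne_zero_of_polyFun hBtpoly (x₀ := fun _ => 0) (by rwa [hB00])
    have hU := h B₀ hB₀
    rw [← hU] at ha ⊢
    refine exchange_of_eventually_shear hij ?_ a ha
    filter_upwards [hevt] with t ht
    rw [← hBt, h _ ht, hU]

end Stable

end SymmetricShifting

namespace SymmetricShifting

open MvPolynomial Filter
open scoped MonomialOrder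

/-! ### Face rings and generic initial ideals -/

section FaceRing

variable (K : Type*) [Field K] {n N : ℕ}

/-- The exponent of the squarefree monomial with support `F`. -/
noncomputable def faceExp (F : Finset (Fin n)) : Fin n →₀ ℕ := ∑ i ∈ F, Finsupp.single i 1

theorem faceExp_apply (F : Finset (Fin n)) (i : Fin n) : faceExp F i = if i ∈ F then 1 else 0 := by
  simp [faceExp, Finsupp.finsetSum_apply, Finsupp.single_apply]

theorem degree_faceExp (F : Finset (Fin n)) : (faceExp F).degree = F.card := by
  simp [faceExp]

theorem faceExp_le_iff {F : Finset (Fin n)} {a : Fin n →₀ ℕ} : faceExp F ≤ a ↔ F ⊆ a.support := by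
  constructor
  · intro h i hi
    have := h i
    rw [faceExp_apply, if_pos hi] at this
    rw [Finsupp.mem_support_iff]
    omega
  · intro h i
    rw [faceExp_apply]
    split_ifs with hi
    · have := Finsupp.mem_support_iff.1 (h hi)
      omega
    · exact Nat.zero_le _

theorem prod_X_eq_monomial (F : Finset (Fin n)) :
    (∏ i ∈ F, X i : MvPolynomial (Fin n) K) = monomial (faceExp F) 1 :=
  (monomial_sum_one F fun i => Finsupp.single i 1).symm

/-- The monomial ideal generated by a set of exponents. -/
noncomputable def monIdeal {σ : Type*} (U : Set (σ →₀ ℕ)) : Ideal (MvPolynomial σ K) :=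
  Ideal.span ((fun s => monomial s 1) '' U)

variable {K}

theorem mem_monIdeal {σ : Type*} {U : Set (σ →₀ ℕ)} {p : MvPolynomial σ K} :
    p ∈ monIdeal K U ↔ ∀ a ∈ p.support, ∃ b ∈ U, b ≤ a :=
  mem_ideal_span_monomial_image

theorem monomial_mem_monIdeal {σ : Type*} {U : Set (σ →₀ ℕ)} {a : σ →₀ ℕ} :
    monomial a (1 : K) ∈ monIdeal K U ↔ ∃ b ∈ U, b ≤ a := by
  classical
  rw [mem_monIdeal, support_monomial, if_neg one_ne_zero]
  simp

theorem stanleyReisnerIdeal_eq (Γ : Complex n) :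
    stanleyReisnerIdeal K Γ = monIdeal K (faceExp '' {F | F ∉ Γ}) := by
  rw [stanleyReisnerIdeal, monIdeal, Set.image_image]
  congr 1
  ext p
  constructor
  · rintro ⟨F, hF, rfl⟩
    exact ⟨F, hF, (prod_X_eq_monomial K F).symm⟩
  · rintro ⟨F, hF, rfl⟩
    exact ⟨F, hF, (prod_X_eq_monomial K F).symm⟩

theorem mem_stanleyReisnerIdeal {Γ : Complex n} {p : MvPolynomial (Fin n) K} :
    p ∈ stanleyReisnerIdeal K Γ ↔ ∀ a ∈ p.support, a.support ∉ Γ := by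
  rw [stanleyReisnerIdeal_eq, mem_monIdeal]
  refine forall₂_congr fun a _ => ⟨?_, fun h => ?_⟩
  · rintro ⟨_, ⟨F, hF, rfl⟩, h⟩ ha
    exact hF (Γ.lower (faceExp_le_iff.1 h) ha)
  · exact ⟨_, ⟨a.support, h, rfl⟩, faceExp_le_iff.2 subset_rfl⟩

theorem stanleyReisnerIdeal_anti {Γ Γ' : Complex n} (h : Γ ≤ Γ') :
    stanleyReisnerIdeal K Γ' ≤ stanleyReisnerIdeal K Γ := fun _ hp =>
  mem_stanleyReisnerIdeal.2 fun a ha ha' => mem_stanleyReisnerIdeal.1 hp a ha (h ha')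

variable (K)

/-- The face ring of a complex. -/
abbrev FaceRing (Γ : Complex n) : Type _ := MvPolynomial (Fin n) K ⧸ stanleyReisnerIdeal K Γ

/-- The classes of the variables in the face ring. -/
noncomputable def faceVar (Γ : Complex n) (j : Fin n) : FaceRing K Γ :=
  Ideal.Quotient.mkₐ K (stanleyReisnerIdeal K Γ) (X j)

theorem mon_faceVar (Γ : Complex n) (a : Fin n →₀ ℕ) :
    mon (faceVar K Γ) a = Ideal.Quotient.mkₐ K (stanleyReisnerIdeal K Γ) (monomial a 1) := by
  rw [← mon_X, map_mon]
  rfl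

theorem mon_faceVar_eq_zero {Γ : Complex n} {a : Fin n →₀ ℕ} (h : a.support ∉ Γ) :
    mon (faceVar K Γ) a = 0 := by
  classical
  rw [mon_faceVar, Ideal.Quotient.mkₐ_eq_mk, Ideal.Quotient.eq_zero_iff_mem,
    mem_stanleyReisnerIdeal, support_monomial, if_neg one_ne_zero]
  simpa using h

theorem linearIndepOn_mon_faceVar (Γ : Complex n) :
    LinearIndepOn K (mon (faceVar K Γ)) {a | a.support ∈ Γ} := by
  classical
  rw [linearIndepOn_iff']
  intro s g hs hsum i hi
  have h : ∑ a ∈ s, monomial a (g a) ∈ stanleyReisnerIdeal K Γ := by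
    rw [← Ideal.Quotient.eq_zero_iff_mem, ← Ideal.Quotient.mkₐ_eq_mk K, map_sum, ← hsum]
    refine Finset.sum_congr rfl fun a _ => ?_
    rw [mon_faceVar, ← map_smul, smul_monomial, smul_eq_mul, mul_one]
  have hcoeff : coeff i (∑ a ∈ s, monomial a (g a)) = g i := by
    rw [coeff_sum]
    simp [coeff_monomial, hi]
  by_contra h0
  exact mem_stanleyReisnerIdeal.1 h i (mem_support_iff.2 (hcoeff ▸ h0)) (hs hi)

theorem finrank_degSpan_faceVar (Γ : Complex n) (d : ℕ) :
    Module.finrank K (degSpan K (faceVar K Γ) d) =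
      {a : Fin n →₀ ℕ | a.degree = d ∧ a.support ∈ Γ}.ncard := by
  have hli : LinearIndepOn K (mon (faceVar K Γ)) {a | a.degree = d ∧ a.support ∈ Γ} :=
    (linearIndepOn_mon_faceVar K Γ).mono fun a ha => ha.2
  have hfin : Fintype ↑{a : Fin n →₀ ℕ | a.degree = d ∧ a.support ∈ Γ} :=
    ((Finsupp.finite_of_degree_eq d).subset fun a ha => ha.1).fintype
  have hspan : degSpan K (faceVar K Γ) d =
      Submodule.span K (mon (faceVar K Γ) '' {a | a.degree = d ∧ a.support ∈ Γ}) := by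
    refine le_antisymm (Submodule.span_le.2 ?_)
      (Submodule.span_mono (Set.image_mono fun a ha => ha.1))
    rintro _ ⟨a, ha, rfl⟩
    by_cases h : a.support ∈ Γ
    · exact Submodule.subset_span ⟨a, ⟨ha, h⟩, rfl⟩
    · rw [mon_faceVar_eq_zero K h]
      exact zero_mem _
  rw [hspan, Set.image_eq_range, finrank_span_eq_card hli, Set.ncard_eq_toFinset_card',
    Set.toFinset_card]

/-- The exponents of the monomials in the generic initial ideal of the Stanley-Reisner ideal. -/
def gin (Γ : Complex n) : Set (Fin n →₀ ℕ) := genSet K (faceVar K Γ)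

theorem stronglyStable_gin [CharZero K] (Γ : Complex n) : StronglyStable (gin K Γ) :=
  stronglyStable_genSet _

theorem ncard_compl_gin [Infinite K] (Γ : Complex n) (d : ℕ) :
    ({c | c.degree = d} \ gin K Γ).ncard =
      {a : Fin n →₀ ℕ | a.degree = d ∧ a.support ∈ Γ}.ncard := by
  rw [gin, ncard_compl_genSet, finrank_degSpan_faceVar]

theorem ncard_gin [Infinite K] (Γ : Complex n) (d : ℕ) :
    {c | c.degree = d ∧ c ∈ gin K Γ}.ncard =
      {a : Fin n →₀ ℕ | a.degree = d ∧ a.support ∉ Γ}.ncard := by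
  have hfin : {c : Fin n →₀ ℕ | c.degree = d}.Finite := Finsupp.finite_of_degree_eq d
  have h1 := Set.ncard_inter_add_ncard_sdiff_eq_ncard {c : Fin n →₀ ℕ | c.degree = d} (gin K Γ) hfin
  have h2 := Set.ncard_inter_add_ncard_sdiff_eq_ncard {c : Fin n →₀ ℕ | c.degree = d}
    {c | c.support ∉ Γ} hfin
  have h3 : {c : Fin n →₀ ℕ | c.degree = d} \ {c | c.support ∉ Γ} =
      {a : Fin n →₀ ℕ | a.degree = d ∧ a.support ∈ Γ} := by
    ext a
    simp
  rw [h3] at h2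
  rw [ncard_compl_gin] at h1
  have h4 : {c | c.degree = d ∧ c ∈ gin K Γ} = {c | c.degree = d} ∩ gin K Γ := rfl
  have h5 : {a : Fin n →₀ ℕ | a.degree = d ∧ a.support ∉ Γ} =
    {c | c.degree = d} ∩ {c | c.support ∉ Γ} := rfl
  rw [h4, h5]
  omega

theorem gin_anti [Infinite K] {Γ Γ' : Complex n} (h : Γ ≤ Γ') : gin K Γ' ⊆ gin K Γ :=
  genSet_subset_of_map (Ideal.Quotient.factorₐ K (stanleyReisnerIdeal_anti h)) (faceVar K Γ')

end FaceRing

/-! ### Initial ideals after a change of coordinates, read off in the face ring -/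

section InitialIdeal

variable {K : Type*} [Field K] {n N : ℕ}

theorem linearSubst_linearSubst (A B : Matrix (Fin n) (Fin n) K) (p : MvPolynomial (Fin n) K) :
    linearSubst A (linearSubst B p) = linearSubst (A * B) p := by
  have : (linearSubst A).comp (linearSubst B) = linearSubst (A * B) := by
    refine MvPolynomial.algHom_ext fun j => ?_
    simp only [linearSubst, AlgHom.comp_apply, aeval_X, map_sum, map_mul, Matrix.mul_apply,
      Finset.mul_sum, Finset.sum_mul]
    rw [Finset.sum_comm]
    refine Finset.sum_congr rfl fun i _ => Finset.sum_congr rfl fun k _ => ?_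
    rw [← algebraMap_eq, AlgHom.commutes]
    ring
  rw [← this]
  rfl

theorem linearSubst_one (p : MvPolynomial (Fin n) K) : linearSubst 1 p = p := by
  have : linearSubst (1 : Matrix (Fin n) (Fin n) K) = AlgHom.id K _ := by
    refine MvPolynomial.algHom_ext fun j => ?_
    simp [linearSubst, Matrix.one_apply]
  rw [this]
  rfl

theorem mem_map_linearSubst {A : Matrix (Fin n) (Fin n) K} (hA : A.det ≠ 0)
    {I : Ideal (MvPolynomial (Fin n) K)} {p : MvPolynomial (Fin n) K} :
    p ∈ I.map (linearSubst A) ↔ linearSubst A⁻¹ p ∈ I := by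
  have hA' := isUnit_iff_ne_zero.2 hA
  constructor
  · intro h
    have := Ideal.mem_map_of_mem (linearSubst A⁻¹) h
    rw [Ideal.map_mapₐ] at this
    have hid : (linearSubst A⁻¹).comp (linearSubst A) = AlgHom.id K _ := by
      refine AlgHom.ext fun q => ?_
      rw [AlgHom.comp_apply, linearSubst_linearSubst, Matrix.nonsing_inv_mul _ hA',
        linearSubst_one]
      rfl
    rw [hid] at this
    simpa using this
  · intro h
    have := Ideal.mem_map_of_mem (linearSubst A) h
    rwa [linearSubst_linearSubst, Matrix.mul_nonsing_inv _ hA', linearSubst_one] at this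

theorem homogeneousComponent_linearSubst (A : Matrix (Fin n) (Fin n) K) (d : ℕ)
    (p : MvPolynomial (Fin n) K) :
    homogeneousComponent d (linearSubst A p) = linearSubst A (homogeneousComponent d p) := by
  have hom : ∀ i, (linearSubst A (homogeneousComponent i p)).IsHomogeneous i := by
    intro i
    have := (homogeneousComponent_isHomogeneous i p).aeval
      (fun j => ∑ i, C (A i j) * X i) (n := 1) fun j =>
        IsHomogeneous.sum _ _ _ fun i _ => by
          simpa using (isHomogeneous_C (Fin n) (A i j)).mul (isHomogeneous_X K i)
    simpa [linearSubst] using this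
  conv_lhs => rw [← sum_homogeneousComponent p, map_sum, map_sum]
  rw [Finset.sum_congr rfl fun i _ => homogeneousComponent_of_mem (m := d)
    ((mem_homogeneousSubmodule _ _).2 (hom i))]
  by_cases hd : d ∈ Finset.range (p.totalDegree + 1)
  · simp [hd]
  · rw [Finset.sum_ite_eq, if_neg hd, homogeneousComponent_eq_zero, map_zero]
    rw [Finset.mem_range] at hd
    omega

theorem homogeneousComponent_mem_stanleyReisnerIdeal {Γ : Complex n} {p : MvPolynomial (Fin n) K}
    (h : p ∈ stanleyReisnerIdeal K Γ) (d : ℕ) :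
    homogeneousComponent d p ∈ stanleyReisnerIdeal K Γ := by
  rw [mem_stanleyReisnerIdeal] at h ⊢
  intro a ha
  refine h a ?_
  rw [mem_support_iff, coeff_homogeneousComponent] at ha
  rw [mem_support_iff]
  intro h0
  simp [h0] at ha

theorem mk_linearSubst (Γ : Complex n) (A : Matrix (Fin n) (Fin n) K)
    (p : MvPolynomial (Fin n) K) :
    Ideal.Quotient.mkₐ K (stanleyReisnerIdeal K Γ) (linearSubst A p) =
      ∑ c ∈ p.support, coeff c p • mon (lin (faceVar K Γ) fun e => A e.1 e.2) c := by
  have : (Ideal.Quotient.mkₐ K (stanleyReisnerIdeal K Γ)).comp (linearSubst A) =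
      aeval (lin (faceVar K Γ) fun e => A e.1 e.2) := by
    refine MvPolynomial.algHom_ext fun j => ?_
    simp only [linearSubst, AlgHom.comp_apply, aeval_X, map_sum, map_mul, lin]
    refine Finset.sum_congr rfl fun i _ => ?_
    rw [← algebraMap_eq, AlgHom.commutes, Algebra.smul_def]
    rfl
  rw [← AlgHom.comp_apply, this]
  conv_lhs => rw [p.as_sum, map_sum]
  refine Finset.sum_congr rfl fun c _ => ?_
  rw [aeval_monomial]
  exact (Algebra.smul_def _ _).symm

theorem initialIdeal_eq_monIdeal (I : Ideal (MvPolynomial (Fin n) K)) :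
    initialIdeal I = monIdeal K {b | ∃ p ∈ I, p ≠ 0 ∧ (degRevLex n).degree p = b} := by
  refine le_antisymm (Ideal.span_le.2 ?_) (Ideal.span_le.2 ?_)
  · rintro _ ⟨p, hp, rfl⟩
    by_cases h0 : p = 0
    · rw [h0, MonomialOrder.leadingTerm_zero]
      exact zero_mem _
    · have : (degRevLex n).leadingTerm p = C ((degRevLex n).leadingCoeff p) *
          monomial ((degRevLex n).degree p) 1 := by
        rw [MonomialOrder.leadingTerm, C_mul_monomial, mul_one]
      rw [this]
      exact Ideal.mul_mem_left _ _ (Ideal.subset_span ⟨_, ⟨p, hp, h0, rfl⟩, rfl⟩)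
  · rintro _ ⟨_, ⟨p, hp, h0, rfl⟩, rfl⟩
    have : monomial ((degRevLex n).degree p) (1 : K) = C ((degRevLex n).leadingCoeff p)⁻¹ *
          (degRevLex n).leadingTerm p := by
        rw [MonomialOrder.leadingTerm, C_mul_monomial, inv_mul_cancel₀]
        exact (degRevLex n).leadingCoeff_ne_zero_iff.2 h0
    simp only [this]
    exact Ideal.mul_mem_left _ _ (Ideal.subset_span ⟨p, hp, rfl⟩)

/-- A polynomial lies in φ_A(I) exactly when φ_{A⁻¹} sends it into I, that is, when it vanishes at
the linear forms given by A⁻¹ in the face ring. Its homogeneous component containing the leading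
term is then a relation solving for the leading monomial; conversely, such a relation is a
polynomial with that leading exponent. -/
theorem exists_degree_eq_iff_mem_initSet (Γ : Complex n) {A : Matrix (Fin n) (Fin n) K}
    (hA : A.det ≠ 0) (b : Fin n →₀ ℕ) :
    (∃ p ∈ (stanleyReisnerIdeal K Γ).map (linearSubst A), p ≠ 0 ∧ (degRevLex n).degree p = b) ↔
      b ∈ initSet K (lin (faceVar K Γ) fun e => A⁻¹ e.1 e.2) := by
  classical
  set f := lin (faceVar K Γ) fun e => A⁻¹ e.1 e.2
  constructor
  · rintro ⟨p, hp, h0, rfl⟩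
    set b := (degRevLex n).degree p
    rw [mem_map_linearSubst hA] at hp
    have hp' := homogeneousComponent_mem_stanleyReisnerIdeal hp b.degree
    rw [homogeneousComponent_linearSubst, ← Ideal.Quotient.eq_zero_iff_mem,
      ← Ideal.Quotient.mkₐ_eq_mk K, mk_linearSubst] at hp'
    set q := homogeneousComponent b.degree p
    have hqb : coeff b q ≠ 0 := by
      rw [coeff_homogeneousComponent, if_pos rfl]
      exact (degRevLex n).coeff_degree_ne_zero_iff.2 h0
    rw [← Finset.add_sum_erase _ _ (mem_support_iff.2 hqb)] at hp'
    rw [mem_initSet]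
    have : mon f b = -((coeff b q)⁻¹ • ∑ x ∈ q.support.erase b, coeff x q • mon f x) := by
      have := congrArg (fun y => (coeff b q)⁻¹ • y) hp'
      simp only [smul_add, smul_smul, inv_mul_cancel₀ hqb, one_smul, smul_zero] at this
      exact eq_neg_of_add_eq_zero_left this
    rw [this]
    refine neg_mem (Submodule.smul_mem _ _ (Submodule.sum_mem _ fun c hc =>
      Submodule.smul_mem _ _ (Submodule.subset_span ⟨c, ?_, rfl⟩)))
    rw [Finset.mem_erase, mem_support_iff, coeff_homogeneousComponent] at hc
    obtain ⟨hcb, hc⟩ := hc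
    have hdeg : c.degree = b.degree := by
      by_contra h
      simp [h] at hc
    rw [if_pos hdeg] at hc
    exact ⟨hdeg, lt_of_le_of_ne ((degRevLex n).le_degree (mem_support_iff.2 hc))
      fun h => hcb ((degRevLex n).toSyn.injective h)⟩
  · intro h
    rw [mem_initSet] at h
    obtain ⟨l, hl, hlsum⟩ := (Finsupp.mem_span_image_iff_linearCombination K).1 h
    rw [Finsupp.mem_supported] at hl
    have hlb : b ∉ l.support := fun hb => lt_irrefl _ (hl hb).2
    set p : MvPolynomial (Fin n) K := monomial b 1 - ∑ c ∈ l.support, monomial c (l c) with hp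
    have hcoeff : ∀ c, coeff c p = (if b = c then 1 else 0) - l c := by
      intro c
      rw [hp, coeff_sub, coeff_monomial, coeff_sum]
      congr 1
      simp only [coeff_monomial]
      rw [Finset.sum_ite_eq']
      split_ifs with h
      · rfl
      · rw [Finsupp.notMem_support_iff] at h
        exact h.symm
    have hpb : coeff b p = 1 := by
      rw [hcoeff, if_pos rfl, Finsupp.notMem_support_iff.1 hlb, sub_zero]
    have hp0 : p ≠ 0 := by
      rintro h0
      rw [h0, coeff_zero] at hpb
      exact zero_ne_one hpb
    refine ⟨p, ?_, hp0, ?_⟩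
    · rw [mem_map_linearSubst hA, ← Ideal.Quotient.eq_zero_iff_mem,
        ← Ideal.Quotient.mkₐ_eq_mk K]
      have hmono : ∀ (c : Fin n →₀ ℕ) (r : K), Ideal.Quotient.mkₐ K (stanleyReisnerIdeal K Γ)
          (linearSubst A⁻¹ (monomial c r)) = r • mon f c := by
        intro c r
        rw [mk_linearSubst, support_monomial]
        split_ifs with hr
        · simp [hr]
        · simp [f]
      rw [hp, map_sub, map_sub, map_sum, map_sum, hmono, one_smul, ← hlsum, sub_eq_zero,
        Finsupp.linearCombination_apply, Finsupp.sum]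
      exact Finset.sum_congr rfl fun c _ => (hmono c _).symm
    · refine (degRevLex n).toSyn.injective (le_antisymm ?_ ?_)
      · rw [(degRevLex n).degree_le_iff]
        intro c hc
        rw [mem_support_iff, hcoeff] at hc
        by_cases hbc : b = c
        · rw [hbc]
        · rw [if_neg hbc, zero_sub, neg_ne_zero, ← Finsupp.mem_support_iff] at hc
          exact (hl hc).2.le
      · exact (degRevLex n).le_degree (mem_support_iff.2 (by rw [hpb]; exact one_ne_zero))

theorem initialIdeal_map_linearSubst (Γ : Complex n) {A : Matrix (Fin n) (Fin n) K}
    (hA : A.det ≠ 0) :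
    initialIdeal ((stanleyReisnerIdeal K Γ).map (linearSubst A)) =
      monIdeal K (initSet K (lin (faceVar K Γ) fun e => A⁻¹ e.1 e.2)) := by
  rw [initialIdeal_eq_monIdeal]
  congr 1
  ext b
  exact exists_degree_eq_iff_mem_initSet Γ hA b

/-- A polynomial function of the inverse matrix is a polynomial function of the matrix, up to a
power of the determinant. -/
theorem exists_polyFun_inv (P : MvPolynomial (Fin n × Fin n) K) :
    ∃ (r : ℕ) (g : (Fin n × Fin n → K) → K), g ∈ polyFun (Fin n × Fin n) K K ∧
      ∀ A : Matrix (Fin n) (Fin n) K, A.det ≠ 0 →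
        g (fun e => A e.1 e.2) = A.det ^ r * eval (fun e => A⁻¹ e.1 e.2) P := by
  have hdet : (fun B : Fin n × Fin n → K => (Matrix.of fun i j => B (i, j)).det) ∈
      polyFun (Fin n × Fin n) K K := det_mem_polyFun fun i j => coord_mem_polyFun (i, j)
  induction P using MvPolynomial.induction_on with
  | C a => exact ⟨0, _, const_mem_polyFun a, fun A _ => by simp⟩
  | add p q hp hq =>
    obtain ⟨r, g, hg, h⟩ := hp
    obtain ⟨r', g', hg', h'⟩ := hq
    refine ⟨r + r', _, add_mem (mul_mem hg (pow_mem hdet r')) (mul_mem hg' (pow_mem hdet r)),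
      fun A hA => ?_⟩
    simp only [Pi.add_apply, Pi.mul_apply, Pi.pow_apply, h A hA, h' A hA, map_add]
    have : (Matrix.of fun i j => A i j).det = A.det := rfl
    rw [this]
    ring
  | mul_X p e hp =>
    obtain ⟨r, g, hg, h⟩ := hp
    refine ⟨r + 1, _, mul_mem_polyFun (h := fun B : Fin n × Fin n → K =>
      (Matrix.of fun i j => B (i, j)).adjugate e.1 e.2) hg ?_, fun A hA => ?_⟩
    · simp_rw [Matrix.adjugate_apply]
      refine det_mem_polyFun fun i j => ?_
      by_cases hi : i = e.2
      · simp only [hi, Matrix.updateRow_self]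
        exact const_mem_polyFun _
      · simp only [Matrix.updateRow_ne hi]
        exact coord_mem_polyFun (i, j)
    · rw [h A hA, map_mul, eval_X, Matrix.inv_def, Matrix.smul_apply, Ring.inverse_eq_inv',
        smul_eq_mul]
      have : (Matrix.of fun i j => A i j) = A := rfl
      simp only [this]
      field_simp
      ring

/-- The linear forms are governed by the inverse matrix, whereas the generic initial ideal is
defined by openness in the matrix. Clearing a power of the determinant transfers one to the other.
-/
theorem eventually_inv [Infinite K] {p : (Fin n × Fin n → K) → Prop}
    (h : ∀ᶠ B in zariski (Fin n × Fin n) K, p B) :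
    ∃ P : MvPolynomial (Fin n × Fin n) K, P ≠ 0 ∧ ∀ A : Matrix (Fin n) (Fin n) K, A.det ≠ 0 →
      eval (fun e => A e.1 e.2) P ≠ 0 → p fun e => A⁻¹ e.1 e.2 := by
  obtain ⟨P, hP, hPp⟩ := eventually_zariski.1 h
  obtain ⟨r, g, hg, hgP⟩ := exists_polyFun_inv P
  obtain ⟨Q, hQ⟩ := mem_polyFun.1 hg
  have hQ' : ∀ B, g B = eval B Q := hQ
  refine ⟨Q, ?_, fun A hA hAQ => hPp _ fun h0 => hAQ ?_⟩
  · rintro rfl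
    -- The polynomial obtained is nonzero because it does not vanish at the inverse of an invertible
    -- matrix `B` with P(B) ≠ 0.
    obtain ⟨B, h1, h2⟩ := ((eventually_eval_ne_zero hP).and
      (eventually_det_submatrix_ne_zero (K := K) Function.injective_id
        (Function.injective_id (α := Fin n)))).exists
    set M : Matrix (Fin n) (Fin n) K := Matrix.of fun i j => B (i, j)
    have hM : M.det ≠ 0 := h2
    have hMi : M⁻¹.det ≠ 0 := by
      rw [Matrix.det_nonsing_inv, Ring.inverse_eq_inv']
      exact inv_ne_zero hM
    have := hgP M⁻¹ hMi
    rw [hQ', map_zero, Matrix.nonsing_inv_nonsing_inv _ (isUnit_iff_ne_zero.2 hM)] at this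
    exact mul_ne_zero (pow_ne_zero _ hMi) h1 this.symm
  · rw [← hQ', hgP A hA, h0, mul_zero]

theorem isGenericInitialIdeal_gin [Infinite K] (Γ : Complex n) :
    IsGenericInitialIdeal (stanleyReisnerIdeal K Γ) (monIdeal K (gin K Γ)) := by
  obtain ⟨P, hP, h⟩ := eventually_inv (eventually_initSet_eq (K := K) (faceVar K Γ))
  refine ⟨P, hP, fun A hA hAP => ?_⟩
  rw [initialIdeal_map_linearSubst Γ hA, h A hA hAP]
  rfl

theorem IsGenericInitialIdeal.unique [Infinite K] {I J J' : Ideal (MvPolynomial (Fin n) K)}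
    (h : IsGenericInitialIdeal I J) (h' : IsGenericInitialIdeal I J') : J = J' := by
  obtain ⟨P, hP, h⟩ := h
  obtain ⟨P', hP', h'⟩ := h'
  obtain ⟨B, ⟨h1, h2⟩, h3⟩ := (((eventually_eval_ne_zero hP).and (eventually_eval_ne_zero hP')).and
    (eventually_det_submatrix_ne_zero (K := K) Function.injective_id
        (Function.injective_id (α := Fin n)))).exists
  rw [← h (Matrix.of fun i j => B (i, j)) h3 h1, ← h' (Matrix.of fun i j => B (i, j)) h3 h2]

theorem isGenericInitialIdeal_iff [Infinite K] {Γ : Complex n}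
    {J : Ideal (MvPolynomial (Fin n) K)} :
    IsGenericInitialIdeal (stanleyReisnerIdeal K Γ) J ↔ J = monIdeal K (gin K Γ) :=
  ⟨fun h => h.unique (isGenericInitialIdeal_gin Γ), fun h => h ▸ isGenericInitialIdeal_gin Γ⟩

theorem monomial_mem_monIdeal_gin {Γ : Complex n} {a : Fin n →₀ ℕ} :
    monomial a (1 : K) ∈ monIdeal K (gin K Γ) ↔ a ∈ gin K Γ := by
  rw [monomial_mem_monIdeal]
  constructor
  · rintro ⟨b, hb, hba⟩
    obtain ⟨c, rfl⟩ := exists_add_of_le hba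
    exact genSet_add_mem _ _ hb _
  · exact fun h => ⟨a, h, le_rfl⟩

end InitialIdeal

end SymmetricShifting

namespace SymmetricShifting

open MvPolynomial Filter
open scoped MonomialOrder

/-! ### Elimination with the last generic linear forms -/

section Elimination

variable {K : Type*} [Field K] {R : Type*} [CommRing R] [Algebra K R] {n N : ℕ}

/-- The exponents of degree `d` that involve one of the last `r` variables. -/
def tailSet (n r d : ℕ) : Set (Fin n →₀ ℕ) :=
  {c | c.degree = d ∧ ∃ k : Fin n, n ≤ k + r ∧ c k ≠ 0}

/-- This is the characteristic property of the reverse lexicographic order: in a fixed degree,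
monomials involving one of the last `r` variables precede all others. So reduction modulo the last
`r` forms is compatible with initial exponents. -/
theorem isSegment_tailSet (r d : ℕ) : IsSegment d (tailSet n r d) := by
  refine ⟨fun c hc => hc.1, ?_⟩
  rintro c ⟨hc, k, hk, hck⟩ c' hc' hlt
  refine ⟨hc', ?_⟩
  rcases degRevLex_lt_iff.1 hlt with h | ⟨-, i, hi, hj⟩
  · omega
  · by_cases hik : i < k
    · exact ⟨k, hk, (hj k hik) ▸ hck⟩
    · refine ⟨i, ?_, by omega⟩
      have : (k : ℕ) ≤ i := by simpa using hik
      omega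

/-- The span of the monomials of degree `d` that involve one of the last `r` elements of `f`. -/
def tailSpan (K : Type*) [Field K] {R : Type*} [CommRing R] [Algebra K R] (f : Fin n → R)
    (r d : ℕ) : Submodule K R :=
  Submodule.span K (mon f '' tailSet n r d)

theorem mul_mem_tailSpan {f : Fin n → R} {r d : ℕ} {y : R} (hy : y ∈ degSpan K f d) {k : Fin n}
    (hk : n ≤ k + r) : y * f k ∈ tailSpan K f r (d + 1) := by
  have := Submodule.mem_map_of_mem (f := LinearMap.mulRight K (f k)) hy
  rw [degSpan, Submodule.map_span] at this
  refine Submodule.span_mono ?_ this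
  rintro _ ⟨_, ⟨c, hc, rfl⟩, rfl⟩
  refine ⟨c + Finsupp.single k 1, ⟨?_, k, hk, by simp⟩, ?_⟩
  · rw [map_add, Finsupp.degree_single k 1, show c.degree = d from hc]
  · simp [mon_add]

theorem mem_initSet_of_mem_tailSpan {f : Fin n → R} {r d : ℕ} {c : Fin n →₀ ℕ}
    (hd : c.degree = d) (hc : ∀ k : Fin n, n ≤ k + r → c k = 0)
    (h : mon f c ∈ tailSpan K f r d) : c ∈ initSet K f := by
  rw [mem_initSet]
  refine Submodule.span_mono (Set.image_mono ?_) h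
  intro c' hc'
  refine ⟨hc'.1.trans hd.symm, ?_⟩
  by_contra hlt
  have hne : c ≠ c' := by
    rintro rfl
    obtain ⟨-, k, hk, hck⟩ := hc'
    exact hck (hc k hk)
  have hlt' : c ≺[degRevLex n] c' := lt_of_le_of_ne (not_lt.1 hlt)
    fun h => hne ((degRevLex n).toSyn.injective h)
  obtain ⟨-, k, hk, hck⟩ := (isSegment_tailSet r d).mem_of_lt c' hc' c hd hlt'
  exact hck (hc k hk)

/-- Modulo the last `r` generic linear forms, any variable `x_i` with `i ∈ T` is a linear
combination of the variables outside of `T`, if `T` has at most `r` elements. -/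
def EliminationProperty (v : Fin n → R) (f : Fin n → R) : Prop :=
  ∀ (T : Finset (Fin n)) (r : ℕ), T.card ≤ r → ∀ i ∈ T, ∃ ν : Fin n → K,
    ∀ a : Fin n →₀ ℕ, mon v (a + Finsupp.single i 1) -
      ∑ j ∈ Tᶜ, ν j • mon v (a + Finsupp.single j 1) ∈ tailSpan K f r (a.degree + 1)

theorem exists_sum_eq_single {B : Fin n × Fin n → K} {T : Finset (Fin n)} {m : ℕ}
    (hm : T.card = m) {e' : Fin m → Fin n}
    (h : (Matrix.of fun i j => B (T.orderEmbOfFin hm i, e' j)).det ≠ 0) {i : Fin n} (hi : i ∈ T) :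
    ∃ μ : Fin m → K, ∀ j ∈ T, ∑ k, μ k * B (j, e' k) = if j = i then 1 else 0 := by
  set M : Matrix (Fin m) (Fin m) K := Matrix.of fun i j => B (T.orderEmbOfFin hm i, e' j)
  have hM := Matrix.mul_nonsing_inv M (isUnit_iff_ne_zero.2 h)
  have hrange : ∀ j ∈ T, ∃ p, T.orderEmbOfFin hm p = j := by
    intro j hj
    rw [← Finset.mem_coe, ← Finset.range_orderEmbOfFin T hm] at hj
    exact hj
  obtain ⟨p, rfl⟩ := hrange i hi
  refine ⟨fun k => M⁻¹ k p, fun j hj => ?_⟩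
  obtain ⟨q, rfl⟩ := hrange j hj
  have := congrFun (congrFun hM q) p
  rw [Matrix.mul_apply, Matrix.one_apply] at this
  simp only [EmbeddingLike.apply_eq_iff_eq]
  rw [← this]
  exact Finset.sum_congr rfl fun k _ => mul_comm _ _

theorem eventually_eliminationProperty (v : Fin n → R) :
    ∀ᶠ B in zariski (Fin n × Fin n) K, EliminationProperty (K := K) v (lin v B) := by
  have htail : ∀ {m : ℕ} (hm : m ≤ n), Function.Injective
      (fun b : Fin m => (⟨n - m + b, by omega⟩ : Fin n)) := by
    intro m hm b b' h
    simp only [Fin.mk.injEq] at h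
    exact Fin.ext (by omega)
  -- The minors with rows `T` and the last `|T|` columns are generically nonzero, so the last forms
  -- can be solved for the variables in `T`.
  have h : ∀ᶠ B in zariski (Fin n × Fin n) K, ∀ T : Finset (Fin n),
      (Matrix.of fun i j : Fin T.card => B (T.orderEmbOfFin rfl i,
        ⟨n - T.card + j, by have := card_finset_fin_le T; omega⟩)).det ≠ 0 :=
    eventually_all.2 fun T => eventually_det_submatrix_ne_zero
      (T.orderEmbOfFin rfl).injective (htail (card_finset_fin_le T))
  filter_upwards [h, eventually_degSpan_lin v] with B hB hspan
  intro T r hT i hi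
  obtain ⟨μ, hμ⟩ := exists_sum_eq_single rfl (hB T) hi
  have hTn := card_finset_fin_le T
  set e' : Fin T.card → Fin n := fun j => ⟨n - T.card + j, by omega⟩
  refine ⟨fun j => -∑ k, μ k * B (j, e' k), fun a => ?_⟩
  have key : ∑ k, μ k • lin v B (e' k) =
      v i + ∑ j ∈ Tᶜ, (∑ k, μ k * B (j, e' k)) • v j := by
    simp_rw [lin, Finset.smul_sum, smul_smul]
    rw [Finset.sum_comm]
    simp_rw [← Finset.sum_smul]
    rw [← Finset.sum_add_sum_compl T]
    congr 1
    rw [Finset.sum_congr rfl fun j hj => by rw [hμ j hj]]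
    simp [hi]
  have : mon v (a + Finsupp.single i 1) -
      ∑ j ∈ Tᶜ, (-∑ k, μ k * B (j, e' k)) • mon v (a + Finsupp.single j 1) =
      ∑ k, μ k • (mon v a * lin v B (e' k)) := by
    simp only [mon_add, mon_single, neg_smul, ← mul_smul_comm]
    rw [← Finset.mul_sum, ← Finset.mul_sum, key, mul_add, Finset.sum_neg_distrib, mul_neg,
      sub_neg_eq_add]
  rw [this]
  refine Submodule.sum_mem _ fun k _ => Submodule.smul_mem _ _ (mul_mem_tailSpan ?_ ?_)
  · rw [hspan]
    exact mon_mem_degSpan v a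
  · change n ≤ n - T.card + k + r
    omega

end Elimination

/-! ### Upper bound for the standard monomials in the first variables -/

section Bound

variable {K : Type*} [Field K] {n : ℕ}

/-- The exponents of degree `d` of the faces with at least `r` elements that are `1` at the `r`
smallest elements of their support. -/
def reducedSet (Γ : Complex n) (r d : ℕ) : Set (Fin n →₀ ℕ) :=
  {a | a.degree = d ∧ a.support ∈ Γ ∧ r ≤ a.support.card ∧
    ∀ i ∈ a.support, (a.support.filter (· < i)).card < r → a i = 1}

theorem card_filter_lt_lt {F : Finset (Fin n)} {i j : Fin n} (hi : i ∈ F) (hij : i < j) :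
    (F.filter (· < i)).card < (F.filter (· < j)).card := by
  refine Finset.card_lt_card ((Finset.ssubset_iff_of_subset ?_).2 ⟨i, ?_, ?_⟩)
  · exact Finset.monotone_filter_right _ fun k _ hk => lt_trans hk hij
  · simp [hi, hij]
  · simp

theorem card_filter_rank_lt (F : Finset (Fin n)) (r : ℕ) :
    (F.filter fun i => (F.filter (· < i)).card < r).card ≤ r := by
  calc _ ≤ (Finset.range r).card := by
        refine Finset.card_le_card_of_injOn (fun i => (F.filter (· < i)).card) ?_ ?_
        · intro i hi
          simp only [Finset.coe_filter, Set.mem_ofPred_eq] at hi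
          simpa using hi.2
        · intro i hi j hj h
          simp only [Finset.coe_filter, Set.mem_ofPred_eq] at hi hj
          rcases lt_trichotomy i j with hij | hij | hij
          · exact absurd h (card_filter_lt_lt hi.1 hij).ne
          · exact hij
          · exact absurd h (card_filter_lt_lt hj.1 hij).ne'
    _ = r := Finset.card_range r

theorem exists_two_le_of_card_lt_degree {a : Fin n →₀ ℕ} (h : a.support.card < a.degree) :
    ∃ i, 2 ≤ a i := by
  by_contra! hlt
  rw [Finsupp.degree_apply] at h
  have : ∑ i ∈ a.support, a i ≤ ∑ i ∈ a.support, 1 :=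
    Finset.sum_le_sum fun i _ => by have := hlt i; omega
  simp at this
  omega

theorem support_add_single (a : Fin n →₀ ℕ) (i : Fin n) :
    (a + Finsupp.single i 1).support = insert i a.support := by
  ext j
  by_cases h : i = j
  · subst h; simp
  · simp [Ne.symm h]

/-- If some variable among the `r` smallest of the support has exponent at least 2, trade one copy
for variables outside this set `T`, modulo the tail. If the new variable lies in the support, `T`
stays the same and its exponent sum drops. Otherwise the support grows, and the weight `d + 1`
outweighs the exponent sum, which is at most `d`. Hence the measure decreases. -/
theorem mon_mem_tailSpan_sup (Γ : Complex n) {f : Fin n → FaceRing K Γ}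
    (hf : EliminationProperty (K := K) (faceVar K Γ) f) {r d : ℕ} (hrd : r ≤ d) :
    ∀ (m : ℕ) (a : Fin n →₀ ℕ), a.degree = d → (n - a.support.card) * (d + 1) +
      ∑ i ∈ a.support with (a.support.filter (· < i)).card < r, a i = m →
      mon (faceVar K Γ) a ∈ tailSpan K f r d ⊔
        Submodule.span K (mon (faceVar K Γ) '' reducedSet Γ r d) := by
  intro m
  induction m using Nat.strong_induction_on with
  | _ m ih =>
    intro a ha hm
    by_cases hΓ : a.support ∈ Γ
    swap
    · rw [mon_faceVar_eq_zero K hΓ]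
      exact zero_mem _
    by_cases hred : a ∈ reducedSet Γ r d
    · exact Submodule.mem_sup_right (Submodule.subset_span ⟨a, hred, rfl⟩)
    set T := a.support.filter fun i => (a.support.filter (· < i)).card < r with hT
    have hex : ∃ i ∈ T, 2 ≤ a i := by
      by_cases hcard : r ≤ a.support.card
      · by_contra! hlt
        refine hred ⟨ha, hΓ, hcard, fun i hi hir => ?_⟩
        have := hlt i (Finset.mem_filter.2 ⟨hi, hir⟩)
        have := Finsupp.mem_support_iff.1 hi
        omega
      -- With fewer than `r ≤ d` elements in the support, `T` is the whole support and some exponent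
      -- exceeds 1.
      · obtain ⟨i, hi⟩ := exists_two_le_of_card_lt_degree (a := a) (by omega)
        have his : i ∈ a.support := Finsupp.mem_support_iff.2 (by omega)
        exact ⟨i, Finset.mem_filter.2 ⟨his, lt_of_le_of_lt
          (Finset.card_le_card (Finset.filter_subset _ _)) (by omega)⟩, hi⟩
    obtain ⟨i, hiT, hi2⟩ := hex
    obtain ⟨ν, hν⟩ := hf T r (card_filter_rank_lt _ _) i hiT
    obtain ⟨a₀, rfl⟩ := exists_eq_add_single (b := a) (i := i) (by omega)
    have hia₀ : i ∈ a₀.support := by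
      rw [Finsupp.add_apply, Finsupp.single_eq_same] at hi2
      exact Finsupp.mem_support_iff.2 (by omega)
    have hsupp : (a₀ + Finsupp.single i 1).support = a₀.support := by
      rw [support_add_single, Finset.insert_eq_of_mem hia₀]
    rw [hsupp] at hT hm hΓ
    have hdeg : ∀ j, (a₀ + Finsupp.single j 1).degree = d := fun j => by
      rw [← ha]; simp
    have ha₀ : a₀.degree + 1 = d := by rw [← ha]; simp
    have h1 := Submodule.mem_sup_left
      (T := Submodule.span K (mon (faceVar K Γ) '' reducedSet Γ r d)) (ha₀ ▸ hν a₀)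
    rw [← sub_add_cancel (mon (faceVar K Γ) (a₀ + Finsupp.single i 1))
      (∑ j ∈ Tᶜ, ν j • mon (faceVar K Γ) (a₀ + Finsupp.single j 1))]
    refine add_mem h1 (Submodule.sum_mem _ fun j hj => Submodule.smul_mem _ _ ?_)
    rw [Finset.mem_compl] at hj
    refine ih _ ?_ _ (hdeg j) rfl
    rw [← hm]
    by_cases hja : j ∈ a₀.support
    · have hsupp' : (a₀ + Finsupp.single j 1).support = a₀.support := by
        rw [support_add_single, Finset.insert_eq_of_mem hja]
      rw [hsupp', ← hT]
      refine Nat.add_lt_add_left (Finset.sum_lt_sum (fun k hk => ?_) ⟨i, hiT, ?_⟩) _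
      · have : k ≠ j := fun h => hj (h ▸ hk)
        simp [Finsupp.single_eq_of_ne this]
      · have : i ≠ j := fun h => hj (h ▸ hiT)
        simp [Finsupp.single_eq_of_ne this]
    · have hcard : (a₀ + Finsupp.single j 1).support.card = a₀.support.card + 1 := by
        rw [support_add_single, Finset.card_insert_of_notMem hja]
      have hle : (a₀ + Finsupp.single j 1).support.card ≤ n := card_finset_fin_le _
      have hsum : ∀ b : Fin n →₀ ℕ,
          ∑ i ∈ b.support with (b.support.filter (· < i)).card < r, b i ≤ b.degree := fun b => by
        rw [Finsupp.degree_apply]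
        exact Finset.sum_le_sum_of_subset (Finset.filter_subset _ _)
      have hsum := (hsum (a₀ + Finsupp.single j 1)).trans_eq (hdeg j)
      have hmul : (n - (a₀ + Finsupp.single j 1).support.card) * (d + 1) + (d + 1) =
          (n - a₀.support.card) * (d + 1) := by
        rw [← Nat.succ_mul]
        congr 1
        omega
      omega

/-- The standard exponents of degree `d` in all but the last `r` variables. -/
def headStd (U : Set (Fin n →₀ ℕ)) (r d : ℕ) : Set (Fin n →₀ ℕ) :=
  {c | c.degree = d ∧ (∀ k : Fin n, n ≤ k + r → c k = 0) ∧ c ∉ U}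

theorem finite_headStd (U : Set (Fin n →₀ ℕ)) (r d : ℕ) : (headStd U r d).Finite :=
  (Finsupp.finite_of_degree_eq d).subset fun _ h => h.1

theorem finite_reducedSet (Γ : Complex n) (r d : ℕ) : (reducedSet Γ r d).Finite :=
  (Finsupp.finite_of_degree_eq d).subset fun _ h => h.1

/-- Modulo the tail, the reduced monomials span the degree `d` part of the face ring. The tail
accounts for the standard exponents involving the last `r` variables; the remaining ones are
therefore at most as many as the reduced exponents. -/
theorem ncard_headStd_le [Infinite K] (Γ : Complex n) {r d : ℕ} (hrd : r ≤ d) :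
    (headStd (gin K Γ) r d).ncard ≤ (reducedSet Γ r d).ncard := by
  obtain ⟨B, ⟨h1, h2⟩, h3⟩ := (((eventually_initSet_eq (K := K) (faceVar K Γ)).and
    (eventually_degSpan_lin (faceVar K Γ))).and
    (eventually_eliminationProperty (K := K) (faceVar K Γ))).exists
  set f := lin (faceVar K Γ) B
  have hle : degSpan K (faceVar K Γ) d ≤ tailSpan K f r d ⊔
      Submodule.span K (mon (faceVar K Γ) '' reducedSet Γ r d) := by
    refine Submodule.span_le.2 ?_
    rintro _ ⟨a, ha, rfl⟩
    exact mon_mem_tailSpan_sup Γ h3 hrd _ a ha rfl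
  have hfin1 : FiniteDimensional K (tailSpan K f r d) :=
    FiniteDimensional.span_of_finite K ((isSegment_tailSet r d).finite.image _)
  have hfin2 : FiniteDimensional K
      (Submodule.span K (mon (faceVar K Γ) '' reducedSet Γ r d)) :=
    FiniteDimensional.span_of_finite K ((finite_reducedSet Γ r d).image _)
  have hrank := (Submodule.finrank_mono hle).trans (Submodule.finrank_add_le_finrank_add_finrank _ _)
  have hred : Module.finrank K (Submodule.span K (mon (faceVar K Γ) '' reducedSet Γ r d)) ≤
      (reducedSet Γ r d).ncard := by
    classical
    have hF := finite_reducedSet Γ r d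
    have := finrank_span_finset_le_card (R := K) (hF.toFinset.image (mon (faceVar K Γ)))
    rw [Finset.coe_image, hF.coe_toFinset] at this
    rw [Set.ncard_eq_toFinset_card _ hF]
    exact this.trans Finset.card_image_le
  rw [← h2, ← ncard_compl_initSet, tailSpan, (isSegment_tailSet r d).finrank_span, h1] at hrank
  have hsub : tailSet n r d \ gin K Γ ⊆ {c | c.degree = d} \ gin K Γ :=
    Set.sdiff_subset_sdiff_left (isSegment_tailSet r d).degree_eq
  have hfin : ({c : Fin n →₀ ℕ | c.degree = d} \ gin K Γ).Finite :=
    (Finsupp.finite_of_degree_eq d).subset Set.sdiff_subset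
  have hdiff := Set.ncard_sdiff_add_ncard_of_subset hsub hfin
  have heq : ({c | c.degree = d} \ gin K Γ) \ (tailSet n r d \ gin K Γ) =
      headStd (gin K Γ) r d := by
    ext c
    simp only [tailSet, headStd, Set.mem_sdiff, Set.mem_ofPred_eq]
    constructor
    · rintro ⟨⟨hc, hg⟩, h⟩
      refine ⟨hc, fun k hk => ?_, hg⟩
      by_contra h0
      exact h ⟨⟨hc, k, hk, h0⟩, hg⟩
    · rintro ⟨hc, h, hg⟩
      exact ⟨⟨hc, hg⟩, fun ⟨⟨_, k, hk, h0⟩, _⟩ => h0 (h k hk)⟩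
  rw [heq] at hdiff
  change _ ≤ (tailSet n r d \ gin K Γ).ncard + _ at hrank
  change ({c | c.degree = d} \ gin K Γ).ncard ≤ _ at hrank
  omega

end Bound

end SymmetricShifting

namespace SymmetricShifting

open MvPolynomial Filter
open scoped MonomialOrder

/-! ### The degrees of the generators of the generic initial ideal -/

section Bound

variable {K : Type*} [Field K] {n : ℕ}

theorem ncard_headStd_zero [Infinite K] (Γ : Complex n) (d : ℕ) :
    (headStd (gin K Γ) 0 d).ncard = (reducedSet Γ 0 d).ncard := by
  have h1 : headStd (gin K Γ) 0 d = {c | c.degree = d} \ gin K Γ := by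
    ext c
    refine ⟨fun h => ⟨h.1, h.2.2⟩, fun h => ⟨h.1, fun k hk => ?_, h.2⟩⟩
    have := k.2
    omega
  have h2 : reducedSet Γ 0 d = {a | a.degree = d ∧ a.support ∈ Γ} := by
    ext a
    exact ⟨fun h => ⟨h.1, h.2.1⟩,
      fun h => ⟨h.1, h.2, Nat.zero_le _, fun i _ h => absurd h (Nat.not_lt_zero _)⟩⟩
  rw [h1, h2, ncard_compl_gin]

theorem add_single_injective (j : Fin n) :
    Function.Injective fun c : Fin n →₀ ℕ => c + Finsupp.single j 1 :=
  add_left_injective _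

/-- The standard exponents that involve the last of the first `n - r` variables. -/
theorem headStd_succ_subset {U : Set (Fin n →₀ ℕ)} (hU : ∀ a ∈ U, ∀ c, a + c ∈ U) {r d : ℕ}
    {j : Fin n} (hj : (j : ℕ) + r + 1 = n) :
    headStd U r (d + 1) \ headStd U (r + 1) (d + 1) ⊆
      (fun c => c + Finsupp.single j 1) '' headStd U r d := by
  rintro c ⟨⟨hc, h0, hcU⟩, h⟩
  have hcj : c j ≠ 0 := by
    intro hcj
    refine h ⟨hc, fun k hk => ?_, hcU⟩
    rcases eq_or_ne k j with rfl | hkj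
    · exact hcj
    · refine h0 k ?_
      have : (k : ℕ) ≠ j := fun h => hkj (Fin.ext h)
      omega
  obtain ⟨c', rfl⟩ := exists_eq_add_single hcj
  refine ⟨c', ⟨?_, fun k hk => ?_, fun hc' => hcU (hU c' hc' _)⟩, rfl⟩
  · simpa using hc
  · have := h0 k hk
    simp at this
    exact this.1

theorem headStd_succ_subset_self (U : Set (Fin n →₀ ℕ)) (r d : ℕ) :
    headStd U (r + 1) d ⊆ headStd U r d :=
  fun _ hc => ⟨hc.1, fun k hk => hc.2.1 k (by omega), hc.2.2⟩

theorem ncard_headStd_succ_le {U : Set (Fin n →₀ ℕ)} (hU : ∀ a ∈ U, ∀ c, a + c ∈ U) {r d : ℕ}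
    {j : Fin n} (hj : (j : ℕ) + r + 1 = n) :
    (headStd U r (d + 1)).ncard ≤
      (headStd U r d).ncard + (headStd U (r + 1) (d + 1)).ncard := by
  have h1 := Set.ncard_sdiff_add_ncard_of_subset (headStd_succ_subset_self U r (d + 1))
    (finite_headStd U r (d + 1))
  have h2 := Set.ncard_le_ncard (headStd_succ_subset hU hj (d := d))
    ((finite_headStd U r d).image _)
  rw [Set.ncard_image_of_injective _ (add_single_injective j)] at h2
  omega

theorem card_filter_lt_inj {F : Finset (Fin n)} {i j : Fin n} (hi : i ∈ F) (hj : j ∈ F)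
    (h : (F.filter (· < i)).card = (F.filter (· < j)).card) : i = j := by
  rcases lt_trichotomy i j with hij | hij | hij
  · exact absurd h (card_filter_lt_lt hi hij).ne
  · exact hij
  · exact absurd h (card_filter_lt_lt hj hij).ne'

theorem exists_card_filter_lt_eq {F : Finset (Fin n)} {r : ℕ} (h : r < F.card) :
    ∃ i ∈ F, (F.filter (· < i)).card = r := by
  have hinj : Set.InjOn (fun i => (F.filter (· < i)).card) F := fun i hi j hj h =>
    card_filter_lt_inj hi hj h
  have himg : F.image (fun i => (F.filter (· < i)).card) = Finset.range F.card := by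
    refine Finset.eq_of_subset_of_card_le ?_ ?_
    · intro k hk
      obtain ⟨i, hi, rfl⟩ := Finset.mem_image.1 hk
      rw [Finset.mem_range]
      exact Finset.card_lt_card ((Finset.filter_ssubset).2 ⟨i, hi, lt_irrefl i⟩)
    · rw [Finset.card_range, Finset.card_image_of_injOn hinj]
  have : r ∈ F.image (fun i => (F.filter (· < i)).card) := by
    rw [himg, Finset.mem_range]
    exact h
  simpa using this

/-- Multiply a reduced monomial by the variable in position `r`, counted from 0, of its support. The
result is still reduced for `r` but has exponent at least 2 in that position, so it is not reduced
for `r + 1`. The support does not change, so the map is injective. -/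
theorem ncard_reducedSet_add_le (Γ : Complex n) {r d : ℕ} (hrd : r < d) :
    (reducedSet Γ r d).ncard + (reducedSet Γ (r + 1) (d + 1)).ncard ≤
      (reducedSet Γ r (d + 1)).ncard := by
  have hsub : reducedSet Γ (r + 1) (d + 1) ⊆ reducedSet Γ r (d + 1) := fun a ha =>
    ⟨ha.1, ha.2.1, by have := ha.2.2.1; omega, fun i hi hir => ha.2.2.2 i hi (by omega)⟩
  rw [← Set.ncard_sdiff_add_ncard_of_subset hsub (finite_reducedSet Γ r (d + 1))]
  refine Nat.add_le_add_right ?_ _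
  have hex : ∀ a ∈ reducedSet Γ r d, ∃ i ∈ a.support, (a.support.filter (· < i)).card = r := by
    rintro a ⟨ha, -, hr, h1⟩
    -- A support of exactly `r` elements would have all exponents 1, hence degree `r < d`.
    refine exists_card_filter_lt_eq (lt_of_le_of_ne hr ?_)
    rintro rfl
    have : a.degree = a.support.card := by
      rw [Finsupp.degree_apply, Finset.card_eq_sum_ones]
      exact Finset.sum_congr rfl fun i hi => h1 i hi
        (Finset.card_lt_card ((Finset.filter_ssubset).2 ⟨i, hi, lt_irrefl i⟩))
    omega
  rcases (reducedSet Γ r d).eq_empty_or_nonempty with h0 | ⟨a₀, ha₀⟩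
  · rw [h0, Set.ncard_empty]
    exact Nat.zero_le _
  have : Nonempty (Fin n) := ⟨(hex a₀ ha₀).choose⟩
  choose! g hg hgr using hex
  have hsupp : ∀ a ∈ reducedSet Γ r d, (a + Finsupp.single (g a) 1).support = a.support :=
    fun a ha => by rw [support_add_single, Finset.insert_eq_of_mem (hg a ha)]
  refine Set.ncard_le_ncard_of_injOn (fun a => a + Finsupp.single (g a) 1) ?_ ?_
    ((finite_reducedSet Γ r (d + 1)).subset Set.sdiff_subset)
  · intro a ha
    refine ⟨⟨?_, ?_, ?_, ?_⟩, fun h => ?_⟩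
    · rw [map_add, Finsupp.degree_single (g a) 1, ha.1]
    · rw [hsupp a ha]
      exact ha.2.1
    · rw [hsupp a ha]
      exact ha.2.2.1
    · rw [hsupp a ha]
      intro i hi hir
      have : i ≠ g a := by
        rintro rfl
        rw [hgr a ha] at hir
        exact lt_irrefl _ hir
      rw [Finsupp.add_apply, Finsupp.single_eq_of_ne this, ha.2.2.2 i hi hir, add_zero]
    · have := h.2.2.2 (g a)
      rw [hsupp a ha, hgr a ha] at this
      have h1 := this (hg a ha) (Nat.lt_succ_self r)
      have h2 := Finsupp.mem_support_iff.1 (hg a ha)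
      rw [Finsupp.add_apply, Finsupp.single_eq_same] at h1
      omega
  · intro a ha b hb h
    have h : a + Finsupp.single (g a) 1 = b + Finsupp.single (g b) 1 := h
    have hs : a.support = b.support := by rw [← hsupp a ha, ← hsupp b hb, h]
    have hgg : g a = g b := by
      refine card_filter_lt_inj (F := a.support) (hg a ha) (hs ▸ hg b hb) ?_
      rw [hgr a ha, hs, hgr b hb]
    rw [hgg] at h
    exact add_right_cancel h

/-- For `r = 0` both sides are the Hilbert function. In the step, elimination gives the upper bound,
and the lower bound is a difference of consecutive degrees: `headStd` grows by at most the next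
level, `reducedSet` by at least the next level. -/
theorem ncard_headStd_eq [Infinite K] (Γ : Complex n) {r d : ℕ} (hr : r ≤ n) (hrd : r < d) :
    (headStd (gin K Γ) r d).ncard = (reducedSet Γ r d).ncard := by
  induction r generalizing d with
  | zero => exact ncard_headStd_zero Γ d
  | succ r ih =>
    refine le_antisymm (ncard_headStd_le Γ hrd.le) ?_
    obtain ⟨d, rfl⟩ : ∃ e, d = e + 1 := ⟨d - 1, by omega⟩
    have h1 := ih (d := d) (by omega) (by omega)
    have h2 := ih (d := d + 1) (by omega) (by omega)
    have h3 := ncard_reducedSet_add_le Γ (r := r) (d := d) (by omega)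
    have h4 := ncard_headStd_succ_le (U := gin K Γ) (genSet_add_mem _) (r := r) (d := d)
      (j := ⟨n - r - 1, by omega⟩) (by simp only; omega)
    omega

/-- Multiplication by the variable `x_j` preserves standard monomials in `x_1, …, x_j` of large
degree. -/
theorem add_single_notMem_gin [Infinite K] (Γ : Complex n) {c : Fin n →₀ ℕ} {j : Fin n}
    (hc : c ∉ gin K Γ) (h0 : ∀ k, j < k → c k = 0) (hdeg : n ≤ c.degree + j) :
    c + Finsupp.single j 1 ∉ gin K Γ := by
  have hjn := j.2
  obtain ⟨r, hr⟩ : ∃ r, (j : ℕ) + r + 1 = n := ⟨n - j - 1, by omega⟩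
  have hU : ∀ a ∈ gin K Γ, ∀ c, a + c ∈ gin K Γ := genSet_add_mem _
  have hsub := headStd_succ_subset hU hr (d := c.degree)
  have h1 := Set.ncard_sdiff_add_ncard_of_subset
    (headStd_succ_subset_self (gin K Γ) r (c.degree + 1)) (finite_headStd _ r _)
  have h2 := ncard_headStd_eq (K := K) Γ (r := r) (d := c.degree) (by omega) (by omega)
  have h3 := ncard_headStd_eq (K := K) Γ (r := r) (d := c.degree + 1) (by omega) (by omega)
  have h4 := ncard_headStd_eq (K := K) Γ (r := r + 1) (d := c.degree + 1) (by omega) (by omega)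
  have h5 := ncard_reducedSet_add_le Γ (r := r) (d := c.degree) (by omega)
  -- The exact counts turn the inclusion of `headStd_succ_subset` into an equality: every product of
  -- such a standard monomial with `x_j` is again standard.
  have heq := Set.eq_of_subset_of_ncard_le hsub
    (by rw [Set.ncard_image_of_injective _ (add_single_injective j)]; omega)
    ((finite_headStd _ _ _).image _)
  have hmem : c ∈ headStd (gin K Γ) r c.degree := by
    refine ⟨rfl, fun k hk => h0 k ?_, hc⟩
    rw [Fin.lt_def]
    omega
  have : c + Finsupp.single j 1 ∈ headStd (gin K Γ) r (c.degree + 1) :=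
    (heq ▸ Set.mem_image_of_mem (fun c => c + Finsupp.single j 1) hmem :
      c + Finsupp.single j 1 ∈ headStd (gin K Γ) r (c.degree + 1) \
        headStd (gin K Γ) (r + 1) (c.degree + 1)).1
  exact this.2.2

/-- A minimal generator of the generic initial ideal of degree `t` that involves `x_j`, and no
variable after it, satisfies `j + t ≤ n + 1`. -/
theorem degree_add_le_of_minimal [Infinite K] (Γ : Complex n) {a : Fin n →₀ ℕ}
    (ha : Minimal (· ∈ gin K Γ) a) {j : Fin n} (hj : a j ≠ 0) (h0 : ∀ k, j < k → a k = 0) :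
    j + a.degree ≤ n := by
  by_contra! hlt
  obtain ⟨c, rfl⟩ := exists_eq_add_single hj
  have hc : c ∉ gin K Γ := fun hc => by
    have := ha.2 hc (le_self_add)
    have := this j
    simp at this
  refine add_single_notMem_gin Γ hc (fun k hk => ?_) ?_ ha.1
  · have := h0 k hk
    simp at this
    exact this.1
  · rw [map_add, Finsupp.degree_single j 1] at hlt
    omega

end Bound

/-! ### Complexes whose non-faces contain many of the first vertices -/

section Head

variable {K : Type*} [Field K] {n : ℕ}

/-- The number of elements of `F` among the first `m` vertices. -/
def headCard (m : ℕ) (F : Finset (Fin n)) : ℕ := (F.filter fun j : Fin n => (j : ℕ) < m).card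

theorem headCard_mono {m : ℕ} {F G : Finset (Fin n)} (h : F ⊆ G) : headCard m F ≤ headCard m G :=
  Finset.card_le_card (Finset.filter_subset_filter _ h)

/-- The complex of the sets with less than `k` elements among the first `m` vertices. -/
def headComplex (n m k : ℕ) : Complex n where
  carrier := {F | headCard m F < k}
  lower' _ _ hGF hF := (headCard_mono hGF).trans_lt hF

theorem mem_headComplex {m k : ℕ} {F : Finset (Fin n)} :
    F ∈ headComplex n m k ↔ headCard m F < k := Iff.rfl

/-- A monomial that is not yet zero has fewer than `k` support elements among the first `m`
vertices. It can trade a repeated variable, or one beyond the first `m`, for new variables among the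
first `m`. Repeating this, every monomial of degree `k` becomes zero modulo the tail. -/
theorem mon_mem_tailSpan_headComplex {m k i : ℕ} (hmn : m ≤ n) (hik : i + k = m + 1)
    {f : Fin n → FaceRing K (headComplex n m k)}
    (hf : EliminationProperty (K := K) (faceVar K (headComplex n m k)) f) :
    ∀ (s : ℕ) (a : Fin n →₀ ℕ), a.degree = k → n - headCard m a.support = s →
      mon (faceVar K (headComplex n m k)) a ∈ tailSpan K f (n - i) k := by
  classical
  intro s
  induction s using Nat.strong_induction_on with
  | _ s ih =>
    intro a ha hs
    by_cases hk : k ≤ headCard m a.support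
    · rw [mon_faceVar_eq_zero K fun h => not_lt.2 hk (mem_headComplex.1 h)]
      exact zero_mem _
    have hex : ∃ p ∈ a.support, m ≤ p ∨ 2 ≤ a p := by
      by_contra! hcon
      refine hk ?_
      rw [headCard, Finset.filter_true_of_mem fun p hp => (hcon p hp).1, ← ha,
        Finsupp.degree_apply, Finset.card_eq_sum_ones]
      exact Finset.sum_le_sum fun p hp => by have := (hcon p hp).2; omega
    obtain ⟨p, hp, hp2⟩ := hex
    -- Avoiding `T` forces the new variable to be among the first `m` and outside the support. The
    -- size of `T` is at most (k - 1) + (n - m) = n - i, which is where i + k = m + 1 comes from.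
    obtain ⟨T, hT⟩ : ∃ T : Finset (Fin n), T = (a.support.filter fun j : Fin n => (j : ℕ) < m) ∪
      Finset.univ.filter fun j : Fin n => m ≤ (j : ℕ) := ⟨_, rfl⟩
    have hcompl : (Finset.univ.filter fun j : Fin n => m ≤ (j : ℕ)).card ≤ n - m := by
      calc _ ≤ (Finset.Ico m n).card :=
            Finset.card_le_card_of_injOn (fun j : Fin n => (j : ℕ)) (fun j hj => by
              have := j.2
              simpa using hj) fun _ _ _ _ h => Fin.ext h
        _ = n - m := Nat.card_Ico _ _
    have hTcard : T.card ≤ n - i := by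
      have := Finset.card_union_le (a.support.filter fun j : Fin n => (j : ℕ) < m)
        (Finset.univ.filter fun j : Fin n => m ≤ (j : ℕ))
      rw [← hT] at this
      rw [headCard] at hk
      omega
    have hpT : p ∈ T := by
      rw [hT, Finset.mem_union, Finset.mem_filter, Finset.mem_filter]
      rcases lt_or_ge (p : ℕ) m with h | h
      · exact Or.inl ⟨hp, h⟩
      · exact Or.inr ⟨Finset.mem_univ _, h⟩
    obtain ⟨ν, hν⟩ := hf T (n - i) hTcard p hpT
    obtain ⟨a₀, rfl⟩ := exists_eq_add_single (Finsupp.mem_support_iff.1 hp)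
    have hdeg : ∀ j, (a₀ + Finsupp.single j 1).degree = k := fun j => by
      rw [← ha]; simp
    have ha₀ : a₀.degree + 1 = k := by rw [← ha]; simp
    rw [← sub_add_cancel (mon _ (a₀ + Finsupp.single p 1))
      (∑ j ∈ Tᶜ, ν j • mon (faceVar K (headComplex n m k)) (a₀ + Finsupp.single j 1))]
    refine add_mem (ha₀ ▸ hν a₀) (Submodule.sum_mem _ fun j hj => Submodule.smul_mem _ _ ?_)
    rw [Finset.mem_compl, hT, Finset.mem_union, not_or, Finset.mem_filter, Finset.mem_filter,
      not_and, not_and, not_le] at hj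
    have hjm : (j : ℕ) < m := hj.2 (Finset.mem_univ j)
    have hjs : j ∉ (a₀ + Finsupp.single p 1).support := fun h => hj.1 h hjm
    refine ih _ ?_ _ (hdeg j) rfl
    rw [← hs]
    have hlt : headCard m (a₀ + Finsupp.single p 1).support <
        headCard m (a₀ + Finsupp.single j 1).support := by
      refine Finset.card_lt_card ((Finset.ssubset_iff_of_subset ?_).2 ⟨j, ?_, ?_⟩)
      · intro q hq
        rw [Finset.mem_filter, support_add_single, Finset.mem_insert] at hq ⊢
        refine ⟨Or.inr ?_, hq.2⟩
        rcases hq.1 with rfl | h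
        · rcases hp2 with h | h
          · omega
          · rw [Finsupp.add_apply, Finsupp.single_eq_same] at h
            exact Finsupp.mem_support_iff.2 (by omega)
        · exact h
      · rw [Finset.mem_filter, support_add_single]
        exact ⟨Finset.mem_insert_self _ _, hjm⟩
      · rw [Finset.mem_filter]
        exact fun h => hjs h.1
    have hle : headCard m (a₀ + Finsupp.single j 1).support ≤ n :=
      (Finset.card_le_card (Finset.filter_subset _ _)).trans (card_finset_fin_le _)
    omega

/-- The set of exponents `a` with `a_1 + ⋯ + a_i ≥ k`. -/
def headExp (n i k : ℕ) : Set (Fin n →₀ ℕ) :=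
  {a | k ≤ ∑ j ∈ Finset.univ.filter fun j : Fin n => (j : ℕ) < i, a j}

/-- Everything of degree `k` lies in the span of the tail monomials, and a monomial in the first `i`
variables is larger than all of these. So all monomials of degree `k` in these variables are
initial. -/
theorem headExp_subset_gin [Infinite K] {m k i : ℕ} (hmn : m ≤ n) (hik : i + k = m + 1) :
    headExp n i k ⊆ gin K (headComplex n m k) := by
  classical
  intro a ha
  obtain ⟨a', ha', hdeg⟩ := Finsupp.exists_le_degree_eq
    (a.filter fun j : Fin n => (j : ℕ) < i) k (by
      rw [Finsupp.degree_eq_sum]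
      simp only [Finsupp.filter_apply]
      rw [← Finset.sum_filter]
      exact ha)
  have ha'a : a' ≤ a := fun j => (ha' j).trans (by
    rw [Finsupp.filter_apply]
    split_ifs
    · exact le_rfl
    · exact Nat.zero_le _)
  suffices h : a' ∈ gin K (headComplex n m k) by
    obtain ⟨c, rfl⟩ := exists_add_of_le ha'a
    exact genSet_add_mem _ _ h c
  obtain ⟨B, ⟨h1, h2⟩, h3⟩ := (((eventually_initSet_eq (K := K)
    (faceVar K (headComplex n m k))).and
    (eventually_degSpan_lin (faceVar K (headComplex n m k)))).and
    (eventually_eliminationProperty (K := K) (faceVar K (headComplex n m k)))).exists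
  rw [gin, ← h1]
  refine mem_initSet_of_mem_tailSpan (r := n - i) hdeg (fun j hj => ?_) ?_
  · have := ha' j
    rw [Finsupp.filter_apply, if_neg] at this
    · omega
    · have := j.2
      omega
  · have hle : degSpan K (faceVar K (headComplex n m k)) k ≤
        tailSpan K (lin (faceVar K (headComplex n m k)) B) (n - i) k := by
      refine Submodule.span_le.2 ?_
      rintro _ ⟨a, ha, rfl⟩
      exact mon_mem_tailSpan_headComplex hmn hik h3 _ a ha rfl
    refine hle ?_
    rw [← h2, ← hdeg]
    exact mon_mem_degSpan _ _

end Head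

end SymmetricShifting

namespace SymmetricShifting

open MvPolynomial Filter
open scoped MonomialOrder

/-! ### The operation `σ` on exponents -/

section Sequences

variable {n d : ℕ}

/-- The exponent of the monomial `x_{w 0} ⋯ x_{w (d - 1)}`. -/
noncomputable def expOf (w : Fin d → Fin n) : Fin n →₀ ℕ := ∑ k, Finsupp.single (w k) 1

theorem degree_expOf (w : Fin d → Fin n) : (expOf w).degree = d := by
  simp [expOf]

theorem expOf_succ {e : ℕ} (w : Fin (e + 1) → Fin n) :
    expOf w = expOf (fun k => w k.castSucc) + Finsupp.single (w (Fin.last e)) 1 := by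
  rw [expOf, Fin.sum_univ_castSucc]
  rfl

theorem expOf_apply (w : Fin d → Fin n) (j : Fin n) :
    expOf w j = (Finset.univ.filter fun k => w k = j).card := by
  simp [expOf, Finsupp.finsetSum_apply, Finsupp.single_apply]

theorem expOf_apply_ne_zero {w : Fin d → Fin n} {j : Fin n} :
    expOf w j ≠ 0 ↔ ∃ k, w k = j := by
  rw [expOf_apply, Finset.card_ne_zero]
  simp [Finset.Nonempty]

theorem toMultiset_expOf (w : Fin d → Fin n) :
    (expOf w).toMultiset = (List.ofFn w : Multiset (Fin n)) := by
  classical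
  rw [expOf, Finsupp.toMultiset_sum]
  simp only [Finsupp.toMultiset_single, one_smul]
  have : (fun k => ({w k} : Multiset (Fin n))) = (fun i => {i}) ∘ w := rfl
  rw [Finset.sum, this, ← Multiset.map_map, Multiset.sum_map_singleton, Fin.univ_val_map]

theorem sort_toMultiset_expOf {w : Fin d → Fin n} (hw : Monotone w) :
    (expOf w).toMultiset.sort (· ≤ ·) = List.ofFn w := by
  rw [toMultiset_expOf]
  refine List.Perm.eq_of_pairwise' (r := (· ≤ ·)) (Multiset.pairwise_sort _ _)
    hw.sortedLE_ofFn.pairwise ?_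
  rw [← Multiset.coe_eq_coe, Multiset.sort_eq]

theorem exists_monotone_expOf_eq {a : Fin n →₀ ℕ} (ha : a.degree = d) :
    ∃ w : Fin d → Fin n, Monotone w ∧ expOf w = a := by
  have hlen : (a.toMultiset.sort (· ≤ ·)).length = d := by
    rw [Multiset.length_sort, Finsupp.card_toMultiset, ← ha, Finsupp.degree_apply]
    rfl
  subst hlen
  have hm : Monotone (a.toMultiset.sort (· ≤ ·)).get := by
    rw [← List.sortedLE_ofFn_iff, List.ofFn_get]
    exact (Multiset.pairwise_sort _ _).sortedLE
  refine ⟨_, hm, Finsupp.orderIsoMultiset.injective ?_⟩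
  exact (toMultiset_expOf _).trans (by rw [List.ofFn_get, Multiset.sort_eq]; rfl)

theorem expOf_injOn : Set.InjOn (expOf (n := n) (d := d)) {w | Monotone w} := fun w hw w' hw' h => by
  have := sort_toMultiset_expOf hw
  rw [h, sort_toMultiset_expOf hw'] at this
  exact (List.ofFn_injective this).symm

/-- The set `{w_1, w_2 + 1, …, w_d + d - 1}`. -/
def sigmaSet (w : Fin d → Fin n) : Finset ℕ := Finset.univ.image fun k => (w k : ℕ) + k

theorem mem_sigmaSet {w : Fin d → Fin n} {x : ℕ} : x ∈ sigmaSet w ↔ ∃ k, (w k : ℕ) + k = x := by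
  simp [sigmaSet]

theorem strictMono_add_val {w : Fin d → Fin n} (hw : Monotone w) :
    StrictMono fun k => (w k : ℕ) + k := fun k l hkl => by
  have h1 : (w k : ℕ) ≤ w l := hw hkl.le
  have h2 : (k : ℕ) < l := hkl
  simp only
  omega

/-- The vertices whose indices belong to a set of natural numbers. -/
def restr (n : ℕ) (G : Finset ℕ) : Finset (Fin n) := Finset.univ.filter fun j : Fin n => (j : ℕ) ∈ G

theorem mem_restr {G : Finset ℕ} {j : Fin n} : j ∈ restr n G ↔ (j : ℕ) ∈ G := by
  simp [restr]

/-- This inverts σ: subtract `k` from the element in position `k`. Elements in positions `k ≤ l`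
differ by at least `l - k`, so the result is still weakly increasing. -/
theorem exists_monotone_of_card_eq {G : Finset ℕ} (hG : G.card = d) :
    ∃ w : Fin d → ℕ, Monotone w ∧ ∀ x, x ∈ G ↔ ∃ k, w k + k = x := by
  obtain ⟨g, hg⟩ : ∃ g, g = G.orderEmbOfFin hG := ⟨_, rfl⟩
  have key : ∀ k l : Fin d, k ≤ l → g k + (l - k) ≤ g l := by
    intro k l hkl
    have h : ((Finset.Icc k l).map g.toEmbedding).card ≤ (Finset.Icc (g k) (g l)).card := by
      refine Finset.card_le_card fun x hx => ?_
      obtain ⟨i, hi, rfl⟩ := Finset.mem_map.1 hx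
      rw [Finset.mem_Icc] at hi ⊢
      exact ⟨g.monotone hi.1, g.monotone hi.2⟩
    rw [Finset.card_map, Fin.card_Icc, Nat.card_Icc] at h
    have h1 : (k : ℕ) ≤ l := hkl
    have h2 : g k ≤ g l := g.monotone hkl
    omega
  have hk : ∀ k : Fin d, (k : ℕ) ≤ g k := by
    intro k
    have := key ⟨0, k.pos⟩ k (Fin.mk_le_of_le_val (Nat.zero_le _))
    simp only at this
    omega
  refine ⟨fun k => g k - k, fun k l hkl => ?_, fun x => ?_⟩
  · have := key k l hkl
    have := hk k
    have : (k : ℕ) ≤ l := hkl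
    simp only
    omega
  · rw [← Finset.mem_coe, ← Finset.range_orderEmbOfFin G hG, ← hg]
    refine exists_congr fun k => ?_
    have := hk k
    simp only
    rw [Nat.sub_add_cancel this]

theorem exists_sigmaSet_eq {e : ℕ} {G : Finset ℕ} (hG : G.card = e + 1)
    (hGn : ∀ x ∈ G, x < n + e) : ∃ w : Fin (e + 1) → Fin n, Monotone w ∧ sigmaSet w = G := by
  obtain ⟨w, hw, hwG⟩ := exists_monotone_of_card_eq hG
  have hlast : w (Fin.last e) < n := by
    have := hGn _ ((hwG _).2 ⟨Fin.last e, rfl⟩)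
    simp at this
    exact this
  refine ⟨fun k => ⟨w k, (hw (Fin.le_last k)).trans_lt hlast⟩, fun k l hkl => hw hkl, ?_⟩
  ext x
  rw [mem_sigmaSet, hwG]

theorem sigmaSet_lt {e : ℕ} (w : Fin (e + 1) → Fin n) {x : ℕ} (hx : x ∈ sigmaSet w) :
    x < n + e := by
  obtain ⟨k, rfl⟩ := mem_sigmaSet.1 hx
  have := (w k).2
  have := k.2
  omega

theorem card_sigmaSet {w : Fin d → Fin n} (hw : Monotone w) : (sigmaSet w).card = d := by
  rw [sigmaSet, Finset.card_image_of_injective _ (strictMono_add_val hw).injective,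
    Finset.card_univ, Fintype.card_fin]

theorem sigmaSet_injOn : Set.InjOn (sigmaSet (n := n) (d := d)) {w | Monotone w} :=
  fun w hw w' hw' h => by
    have hr : Set.range (fun k => (w k : ℕ) + k) = Set.range fun k => (w' k : ℕ) + k := by
      ext x
      have := Finset.ext_iff.1 h x
      rwa [mem_sigmaSet, mem_sigmaSet] at this
    have := ((strictMono_add_val hw).range_inj (strictMono_add_val hw')).1 hr
    funext k
    have := congrFun this k
    exact Fin.ext (by simpa using this)

/-- Such a set is determined by its elements outside the vertex set, an arbitrary subset of the `e`
extra indices of the right size. -/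
theorem card_finset_restr_eq (e : ℕ) (F : Finset (Fin n)) :
    (((Finset.range (n + e)).powersetCard (e + 1)).filter fun G => restr n G = F).card =
      if F.card ≤ e + 1 then e.choose (e + 1 - F.card) else 0 := by
  have hval : ∀ {G : Finset ℕ}, restr n G = F → F.map Fin.valEmbedding = G.filter (· < n) := by
    rintro G rfl
    ext x
    simp only [Finset.mem_map, mem_restr, Fin.valEmbedding_apply, Finset.mem_filter]
    exact ⟨by rintro ⟨j, hj, rfl⟩; exact ⟨hj, j.2⟩, fun h => ⟨⟨x, h.2⟩, h.1, rfl⟩⟩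
  have hsplit : ∀ {G : Finset ℕ}, restr n G = F →
      F.card + (G.filter fun x => ¬ x < n).card = G.card := by
    intro G hG
    rw [← Finset.card_map Fin.valEmbedding, hval hG]
    exact Finset.card_filter_add_card_filter_not _
  split_ifs with hF
  · have : e.choose (e + 1 - F.card) =
        ((Finset.Ico n (n + e)).powersetCard (e + 1 - F.card)).card := by
      rw [Finset.card_powersetCard, Nat.card_Ico, Nat.add_sub_cancel_left]
    rw [this]
    refine Finset.card_bij (fun G _ => G.filter fun x => ¬ x < n) ?_ ?_ ?_
    · intro G hG
      simp only [Finset.mem_filter, Finset.mem_powersetCard] at hG ⊢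
      refine ⟨fun x hx => ?_, ?_⟩
      · rw [Finset.mem_filter] at hx
        have := hG.1.1 hx.1
        rw [Finset.mem_range] at this
        rw [Finset.mem_Ico]
        omega
      · have := hsplit hG.2
        omega
    · intro G hG G' hG' h
      simp only [Finset.mem_filter] at hG hG'
      rw [← Finset.filter_union_filter_not_eq (· < n) G,
        ← Finset.filter_union_filter_not_eq (· < n) G', ← hval hG.2, ← hval hG'.2, h]
    · intro H hH
      rw [Finset.mem_powersetCard] at hH
      have hH' : ∀ x ∈ H, n ≤ x ∧ x < n + e := fun x hx => Finset.mem_Ico.1 (hH.1 hx)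
      have hdisj : Disjoint (F.map Fin.valEmbedding) H := by
        rw [Finset.disjoint_left]
        intro x hx hxH
        obtain ⟨j, -, rfl⟩ := Finset.mem_map.1 hx
        exact absurd (hH' _ hxH).1 (not_le.2 j.2)
      refine ⟨F.map Fin.valEmbedding ∪ H, ?_, ?_⟩
      · simp only [Finset.mem_filter, Finset.mem_powersetCard]
        refine ⟨⟨?_, ?_⟩, ?_⟩
        · intro x hx
          rw [Finset.mem_range]
          rcases Finset.mem_union.1 hx with hx | hx
          · obtain ⟨j, -, rfl⟩ := Finset.mem_map.1 hx
            exact j.2.trans_le (Nat.le_add_right _ _)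
          · exact (hH' x hx).2
        · rw [Finset.card_union_of_disjoint hdisj, Finset.card_map, hH.2]
          omega
        · ext j
          rw [mem_restr, Finset.mem_union, Finset.mem_map]
          constructor
          · rintro (⟨i, hi, hij⟩ | h)
            · rwa [← Fin.ext hij]
            · exact absurd (hH' _ h).1 (not_le.2 j.2)
          · exact fun h => Or.inl ⟨j, h, rfl⟩
      · ext x
        rw [Finset.mem_filter, Finset.mem_union]
        constructor
        · rintro ⟨h | h, hx⟩
          · obtain ⟨j, -, rfl⟩ := Finset.mem_map.1 h
            exact absurd j.2 hx
          · exact h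
        · exact fun h => ⟨Or.inr h, not_lt.2 (hH' x h).1⟩
  · rw [Finset.card_eq_zero, Finset.filter_eq_empty_iff]
    intro G hG hGF
    rw [Finset.mem_powersetCard] at hG
    have := hsplit hGF
    omega

/-- Subtracting 1 on `F` leaves arbitrary exponents supported in `F`, counted by stars and bars. The
binomial coefficient agrees with that of `card_finset_restr_eq`. -/
theorem ncard_support_eq (e : ℕ) (F : Finset (Fin n)) :
    {a : Fin n →₀ ℕ | a.degree = e + 1 ∧ a.support = F}.ncard =
      if F.card ≤ e + 1 then e.choose (e + 1 - F.card) else 0 := by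
  classical
  have hle : ∀ {a : Fin n →₀ ℕ}, a.support = F → faceExp F ≤ a := fun h =>
    faceExp_le_iff.2 h.ge
  split_ifs with hF
  · have h1 : {a : Fin n →₀ ℕ | a.degree = e + 1 ∧ a.support = F} =
        (fun b => b + faceExp F) '' (F.finsuppAntidiag (e + 1 - F.card) : Set (Fin n →₀ ℕ)) := by
      ext a
      constructor
      · rintro ⟨ha, hs⟩
        obtain ⟨b, rfl⟩ := exists_add_of_le (hle hs)
        rw [add_comm] at ha hs
        refine ⟨b, ?_, add_comm _ _⟩
        rw [Finset.mem_coe, Finset.mem_finsuppAntidiag']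
        refine ⟨?_, ?_⟩
        · rw [map_add, degree_faceExp, Finsupp.degree_apply] at ha
          rw [Finsupp.sum]
          omega
        · rw [← hs]
          exact Finsupp.support_mono le_self_add
      · rintro ⟨b, hb, rfl⟩
        rw [Finset.mem_coe, Finset.mem_finsuppAntidiag'] at hb
        refine ⟨?_, ?_⟩
        · rw [map_add, degree_faceExp, Finsupp.degree_apply]
          have := hb.1
          rw [Finsupp.sum] at this
          omega
        · ext j
          rw [Finsupp.mem_support_iff, Finsupp.add_apply, faceExp_apply]
          split_ifs with hj
          · simp [hj]
          · simp only [add_zero, hj, iff_false, not_not]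
            by_contra h
            exact hj (hb.2 (Finsupp.mem_support_iff.2 h))
    rw [h1, Set.ncard_image_of_injective _ (add_left_injective _), Set.ncard_coe_finset,
      Finset.card_finsuppAntidiag_nat_eq_choose]
    congr 1
    omega
  · rw [Set.ncard_eq_zero (((isSegment_degree (e + 1)).finite).subset fun a ha => ha.1),
      Set.eq_empty_iff_forall_notMem]
    rintro a ⟨ha, hs⟩
    obtain ⟨b, rfl⟩ := exists_add_of_le (hle hs)
    rw [map_add, degree_faceExp] at ha
    omega

/-- The number of elements of degree `d` of `J` is determined by the intersections of the sets
`σ(w)` with the vertex set. -/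
theorem ncard_eq_of_restr_sigmaSet {J : Set (Fin n →₀ ℕ)} {Γ : Complex n} (d : ℕ)
    (h : ∀ w : Fin d → Fin n, Monotone w → (expOf w ∈ J ↔ restr n (sigmaSet w) ∉ Γ)) :
    {c | c.degree = d ∧ c ∈ J}.ncard = {a : Fin n →₀ ℕ | a.degree = d ∧ a.support ∉ Γ}.ncard := by
  classical
  -- Degree 0 is separate because σ maps sequences of length `e + 1` onto the subsets of size `e +
  -- 1` of `n + e` indices.
  rcases d with _ | e
  · congr 1
    ext c
    refine and_congr_right fun hc => ?_
    have h0 := h Fin.elim0 fun k => k.elim0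
    rw [(Finsupp.degree_eq_zero_iff c).1 hc]
    simpa [expOf, sigmaSet, restr] using h0
  · have hJ : {c | c.degree = e + 1 ∧ c ∈ J} =
        expOf '' {w : Fin (e + 1) → Fin n | Monotone w ∧ restr n (sigmaSet w) ∉ Γ} := by
      ext c
      constructor
      · rintro ⟨hc, hcJ⟩
        obtain ⟨w, hw, rfl⟩ := exists_monotone_expOf_eq hc
        exact ⟨w, ⟨hw, (h w hw).1 hcJ⟩, rfl⟩
      · rintro ⟨w, hw, rfl⟩
        exact ⟨degree_expOf w, (h w hw.1).2 hw.2⟩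
    have hG : sigmaSet '' {w : Fin (e + 1) → Fin n | Monotone w ∧ restr n (sigmaSet w) ∉ Γ} =
        (((Finset.range (n + e)).powersetCard (e + 1)).filter fun G => restr n G ∉ Γ :
          Finset (Finset ℕ)) := by
      ext G
      rw [Finset.mem_coe, Finset.mem_filter, Finset.mem_powersetCard]
      constructor
      · rintro ⟨w, hw, rfl⟩
        exact ⟨⟨fun x hx => Finset.mem_range.2 (sigmaSet_lt w hx), card_sigmaSet hw.1⟩, hw.2⟩
      · rintro ⟨⟨h1, h2⟩, h3⟩
        obtain ⟨w, hw, rfl⟩ := exists_sigmaSet_eq h2 fun x hx => Finset.mem_range.1 (h1 hx)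
        exact ⟨w, ⟨hw, h3⟩, rfl⟩
    rw [hJ, (expOf_injOn.mono fun w hw => hw.1).ncard_image,
      ← (sigmaSet_injOn.mono fun w hw => hw.1).ncard_image, hG,
      Set.ncard_coe_finset]
    have hfin : {a : Fin n →₀ ℕ | a.degree = e + 1 ∧ a.support ∉ Γ}.Finite :=
      (isSegment_degree (e + 1)).finite.subset fun a ha => ha.1
    -- Both sides are sorted by the non-face `F`, as restriction to the vertices or as support; the
    -- fibres have the same size.
    rw [Set.ncard_eq_toFinset_card _ hfin,
      Finset.card_eq_sum_card_fiberwise (f := restr n)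
        (t := Finset.univ.filter fun F : Finset (Fin n) => F ∉ Γ) (fun G hG => by
          simpa using (Finset.mem_filter.1 hG).2),
      Finset.card_eq_sum_card_fiberwise (f := Finsupp.support) (s := hfin.toFinset)
        (t := Finset.univ.filter fun F : Finset (Fin n) => F ∉ Γ) (fun a ha => by
          have := (hfin.mem_toFinset.1 ha).2
          simpa using this)]
    refine Finset.sum_congr rfl fun F hF => ?_
    have hF : F ∉ Γ := (Finset.mem_filter.1 hF).2
    have h1 : (((Finset.range (n + e)).powersetCard (e + 1)).filter fun G => restr n G ∉ Γ).filter
        (fun G => restr n G = F) =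
        ((Finset.range (n + e)).powersetCard (e + 1)).filter fun G => restr n G = F := by
      rw [Finset.filter_filter]
      refine Finset.filter_congr fun G _ => ⟨fun h => h.2, fun h => ⟨h ▸ hF, h⟩⟩
    have h2 : (hfin.toFinset.filter fun a => a.support = F : Set (Fin n →₀ ℕ)) =
        {a : Fin n →₀ ℕ | a.degree = e + 1 ∧ a.support = F} := by
      ext a
      simp only [Finset.coe_filter, Set.Finite.mem_toFinset]
      exact ⟨fun h => ⟨h.1.1, h.2⟩, fun h => ⟨⟨h.1, h.2 ▸ hF⟩, h.2⟩⟩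
    rw [h1, card_finset_restr_eq, ← ncard_support_eq, ← h2, Set.ncard_coe_finset]

end Sequences

end SymmetricShifting

namespace SymmetricShifting

open MvPolynomial Filter
open scoped MonomialOrder

/-! ### The complex of a strongly stable set of exponents -/

section Shifted

variable {n d : ℕ}

theorem add_one_le_card_filter_lt_iff {g : Fin d → ℕ} (hg : Monotone g) {k i : ℕ} :
    k + 1 ≤ (Finset.univ.filter fun l => g l < i).card ↔ ∃ h : k < d, g ⟨k, h⟩ < i := by
  constructor
  · intro hk
    have hd := hk.trans (card_finset_fin_le _)
    refine ⟨hd, ?_⟩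
    by_contra! hlt
    have : (Finset.univ.filter fun l => g l < i) ⊆ Finset.Iio ⟨k, hd⟩ := fun l hl => by
      rw [Finset.mem_Iio]
      by_contra! hkl
      exact absurd ((Finset.mem_filter.1 hl).2) (not_lt.2 (hlt.trans (hg hkl)))
    have := Finset.card_le_card this
    rw [Fin.card_Iio] at this
    simp only at this
    omega
  · rintro ⟨h, hi⟩
    have : Finset.Iic (⟨k, h⟩ : Fin d) ⊆ Finset.univ.filter fun l => g l < i := fun l hl =>
      Finset.mem_filter.2 ⟨Finset.mem_univ _, (hg (Finset.mem_Iic.1 hl)).trans_lt hi⟩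
    have := Finset.card_le_card this
    rwa [Fin.card_Iic] at this

theorem expOf_mem_headExp {w : Fin d → Fin n} (hw : Monotone w) {i k : ℕ} :
    expOf w ∈ headExp n i (k + 1) ↔ ∃ h : k < d, (w ⟨k, h⟩ : ℕ) < i := by
  rw [← add_one_le_card_filter_lt_iff (g := fun l => (w l : ℕ)) fun a b hab => hw hab]
  have : (Finset.univ.filter fun l => (w l : ℕ) < i).card =
      ∑ j ∈ Finset.univ.filter fun j : Fin n => (j : ℕ) < i, expOf w j := by
    rw [Finset.card_eq_sum_card_fiberwise (f := w)
      (t := Finset.univ.filter fun j : Fin n => (j : ℕ) < i) fun l hl => by simpa using hl]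
    refine Finset.sum_congr rfl fun j hj => ?_
    rw [expOf_apply, Finset.filter_filter]
    congr 1
    refine Finset.filter_congr fun l _ => ⟨fun h => h.2, fun h => ⟨?_, h⟩⟩
    rw [h]
    exact (Finset.mem_filter.1 hj).2
  rw [this]
  rfl

/-- Together with `expOf_mem_headExp` this shows that the conditions on `w` and on σ(w) agree for m
= i + k. -/
theorem add_one_le_headCard_restr {w : Fin d → Fin n} (hw : Monotone w) {m k : ℕ} (hm : m ≤ n) :
    k + 1 ≤ headCard m (restr n (sigmaSet w)) ↔ ∃ h : k < d, (w ⟨k, h⟩ : ℕ) + k < m := by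
  rw [← add_one_le_card_filter_lt_iff (g := fun l => (w l : ℕ) + l) (strictMono_add_val hw).monotone]
  have : headCard m (restr n (sigmaSet w)) =
      (Finset.univ.filter fun l => (w l : ℕ) + l < m).card := by
    rw [headCard, ← Finset.card_map Fin.valEmbedding, ← Finset.card_image_of_injective
      (Finset.univ.filter fun l => (w l : ℕ) + l < m) (strictMono_add_val hw).injective]
    congr 1
    ext x
    simp only [Finset.mem_map, Finset.mem_filter, mem_restr, mem_sigmaSet,
      Fin.valEmbedding_apply, Finset.mem_image, Finset.mem_univ, true_and]
    constructor
    · rintro ⟨j, ⟨⟨l, hl⟩, hj⟩, rfl⟩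
      exact ⟨l, by omega, hl⟩
    · rintro ⟨l, hl, rfl⟩
      exact ⟨⟨_, hl.trans_le hm⟩, ⟨⟨l, rfl⟩, hl⟩, rfl⟩
  rw [this]

theorem mem_of_ncard_le {U V : Set (Fin n →₀ ℕ)} {d : ℕ} (h : ∀ c, c.degree = d → c ∈ U → c ∈ V)
    (hc : {c | c.degree = d ∧ c ∈ V}.ncard ≤ {c | c.degree = d ∧ c ∈ U}.ncard) {c : Fin n →₀ ℕ}
    (hd : c.degree = d) (hcV : c ∈ V) : c ∈ U := by
  have heq := Set.eq_of_subset_of_ncard_le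
    (show {c | c.degree = d ∧ c ∈ U} ⊆ {c | c.degree = d ∧ c ∈ V} from
      fun c hc => ⟨hc.1, h c hc.1 hc.2⟩) hc
    ((isSegment_degree d).finite.subset fun c hc => hc.1)
  have : c ∈ {c | c.degree = d ∧ c ∈ V} := ⟨hd, hcV⟩
  rw [← heq] at this
  exact this.2

/-- The reverse inclusion is known by elimination, and σ shows that both sets have the same number
of elements in each degree. -/
theorem gin_headComplex_subset (K : Type*) [Field K] [Infinite K] {m k i : ℕ} (hmn : m ≤ n)
    (hik : i + k = m) : gin K (headComplex n m (k + 1)) ⊆ headExp n i (k + 1) := by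
  intro c hc
  refine mem_of_ncard_le (d := c.degree)
    (fun c _ h => headExp_subset_gin (K := K) hmn (by omega) h) ?_ rfl hc
  rw [ncard_gin, ncard_eq_of_restr_sigmaSet (J := headExp n i (k + 1)) c.degree]
  intro w hw
  rw [expOf_mem_headExp hw, mem_headComplex, not_lt, add_one_le_headCard_restr hw hmn]
  refine exists_congr fun _ => ?_
  omega

theorem StronglyStable.expOf_mem_of_le {U : Set (Fin n →₀ ℕ)} (hU : StronglyStable U)
    {w w' : Fin d → Fin n} (h : ∀ k, w k ≤ w' k) (hw : expOf w' ∈ U) : expOf w ∈ U := by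
  have key : ∀ (d : ℕ) (w w' : Fin d → Fin n), (∀ k, w k ≤ w' k) → ∀ b, b + expOf w' ∈ U →
      b + expOf w ∈ U := by
    intro d
    induction d with
    | zero =>
      intro w w' _ b h
      rwa [Subsingleton.elim w w']
    | succ e ih =>
      intro w w' hle b h
      rw [expOf_succ] at h ⊢
      rw [← add_assoc] at h ⊢
      have h1 : b + expOf (fun k => w' k.castSucc) + Finsupp.single (w (Fin.last e)) 1 ∈ U := by
        rcases (hle (Fin.last e)).lt_or_eq with hlt | heq
        · exact hU.exchange _ _ _ hlt h
        · rwa [heq]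
      rw [add_right_comm] at h1 ⊢
      exact ih _ _ (fun k => hle k.castSucc) _ h1
  have := key d w w' h 0
  rw [zero_add, zero_add] at this
  exact this hw

theorem expOf_castLE_le {t : ℕ} (h : t ≤ d) (w : Fin d → Fin n) :
    expOf (fun k => w (Fin.castLE h k)) ≤ expOf w := by
  intro j
  rw [expOf_apply, expOf_apply]
  refine Finset.card_le_card_of_injOn (Fin.castLE h) (fun k hk => ?_)
    (Fin.castLE_injective h).injOn
  simpa using hk

/-- The elements of σ(u) occupy strictly increasing positions in σ(w), so the element in position
`k` of σ(u) sits at position at least `k` in σ(w). -/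
theorem le_of_sigmaSet_subset {t : ℕ} {u : Fin t → Fin n} {w : Fin d → Fin n} (hu : Monotone u)
    (hw : Monotone w) (h : sigmaSet u ⊆ sigmaSet w) :
    ∃ htd : t ≤ d, ∀ k, w (Fin.castLE htd k) ≤ u k := by
  have hp : ∀ k : Fin t, ∃ p : Fin d, (w p : ℕ) + p = u k + k := fun k =>
    mem_sigmaSet.1 (h (mem_sigmaSet.2 ⟨k, rfl⟩))
  choose p hp using hp
  have hmono : StrictMono p := fun k l hkl => by
    have h1 := strictMono_add_val hu hkl
    simp only at h1
    rw [← hp, ← hp] at h1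
    exact (strictMono_add_val hw).lt_iff_lt.1 h1
  have hle : ∀ (k : ℕ) (hk : k < t), k ≤ p ⟨k, hk⟩ := by
    intro k
    induction k with
    | zero => exact fun _ => Nat.zero_le _
    | succ k ih =>
      intro hk
      have h1 : p ⟨k, by omega⟩ < p ⟨k + 1, hk⟩ := hmono (by simp)
      have h2 := ih (by omega)
      rw [Fin.lt_def] at h1
      omega
  have htd : t ≤ d := by simpa using Fintype.card_le_of_injective p hmono.injective
  refine ⟨htd, fun k => ?_⟩
  have h1 : Fin.castLE htd k ≤ p k := hle k k.2
  have h2 := (strictMono_add_val hw).monotone h1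
  simp only [Fin.val_castLE] at h2
  rw [hp] at h2
  rw [Fin.le_def]
  omega

theorem sigmaSet_castSucc_subset {e : ℕ} (w : Fin (e + 1) → Fin n) :
    sigmaSet (fun k : Fin e => w k.castSucc) ⊆ sigmaSet w := fun x hx => by
  obtain ⟨k, rfl⟩ := mem_sigmaSet.1 hx
  exact mem_sigmaSet.2 ⟨k.castSucc, rfl⟩

/-- A monomial of `U` that is not a minimal generator stays in `U` after removing some variable. By
exchange it then stays in `U` after removing its last variable instead, and this only deletes the
largest element of σ(w). -/
theorem StronglyStable.exists_minimal_sigmaSet_subset {U : Set (Fin n →₀ ℕ)}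
    (hU : StronglyStable U) :
    ∀ {d : ℕ} (w : Fin d → Fin n), Monotone w → expOf w ∈ U →
      ∃ (t : ℕ) (u : Fin t → Fin n), Monotone u ∧ Minimal (· ∈ U) (expOf u) ∧
        sigmaSet u ⊆ sigmaSet w := by
  intro d
  induction d with
  | zero =>
    intro w hw hwU
    refine ⟨0, w, hw, ⟨hwU, fun y _ _ => ?_⟩, subset_rfl⟩
    have : expOf w = 0 := by simp [expOf]
    rw [this]
    exact zero_le
  | succ e ih =>
    intro w hw hwU
    by_cases hmin : Minimal (· ∈ U) (expOf w)
    · exact ⟨_, w, hw, hmin, subset_rfl⟩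
    suffices h : expOf (fun k : Fin e => w k.castSucc) ∈ U by
      obtain ⟨t, u, h1, h2, h3⟩ := ih _ (fun k l hkl => hw (Fin.castSucc_le_castSucc_iff.2 hkl)) h
      exact ⟨t, u, h1, h2, h3.trans (sigmaSet_castSucc_subset w)⟩
    obtain ⟨y, hyU, hyw, hwy⟩ : ∃ y ∈ U, y ≤ expOf w ∧ ¬ expOf w ≤ y := by
      by_contra! hcon
      exact hmin ⟨hwU, fun y hy hyw => hcon y hy hyw⟩
    obtain ⟨z, hz⟩ := exists_add_of_le hyw
    have hz0 : z ≠ 0 := by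
      rintro rfl
      exact hwy (by rw [hz, add_zero])
    obtain ⟨j, hj⟩ := Finsupp.ne_iff.1 hz0
    obtain ⟨z', rfl⟩ := exists_eq_add_single hj
    have hc : y + z' ∈ U := hU.add_mem _ hyU _
    rw [← add_assoc] at hz
    have hwj : expOf w j ≠ 0 := by rw [hz]; simp
    obtain ⟨k, rfl⟩ := expOf_apply_ne_zero.1 hwj
    rw [expOf_succ] at hz
    rcases (hw (Fin.le_last k)).eq_or_lt with heq | hlt
    · rw [heq] at hz
      rwa [add_right_cancel hz]
    · have hpj : expOf (fun k : Fin e => w k.castSucc) (w k) ≠ 0 := by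
        have := DFunLike.congr_fun hz (w k)
        rw [Finsupp.add_apply, Finsupp.single_eq_of_ne hlt.ne, Finsupp.add_apply,
          Finsupp.single_eq_same] at this
        omega
      obtain ⟨b, hb⟩ := exists_eq_add_single hpj
      rw [hb] at hz ⊢
      rw [add_right_comm] at hz
      refine hU.exchange b _ _ hlt ?_
      rwa [add_right_cancel hz]

/-- The complex whose non-faces are the sets that contain the set `{u_1, …, u_t + t - 1}` of some
minimal generator `x_{u_1} ⋯ x_{u_t}`. -/
def shiftComplex (U : Set (Fin n →₀ ℕ)) : Complex n where
  carrier := {F | ∀ (t : ℕ) (u : Fin t → Fin n), Monotone u → Minimal (· ∈ U) (expOf u) →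
    ¬ sigmaSet u ⊆ F.map Fin.valEmbedding}
  lower' _ _ hGF hF t u hu hmin h := hF t u hu hmin (h.trans (Finset.map_subset_map.2 hGF))

theorem notMem_shiftComplex {U : Set (Fin n →₀ ℕ)} {F : Finset (Fin n)} :
    F ∉ shiftComplex U ↔ ∃ (t : ℕ) (u : Fin t → Fin n), Monotone u ∧
      Minimal (· ∈ U) (expOf u) ∧ sigmaSet u ⊆ F.map Fin.valEmbedding := by
  change ¬ (∀ (t : ℕ) (u : Fin t → Fin n), Monotone u → Minimal (· ∈ U) (expOf u) →
    ¬ sigmaSet u ⊆ F.map Fin.valEmbedding) ↔ _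
  push Not
  rfl

/-- The supports of the monomials `u^σ`, for the minimal generators `u`, are sets of vertices. -/
def SigmaBounded (U : Set (Fin n →₀ ℕ)) : Prop :=
  ∀ (t : ℕ) (u : Fin t → Fin n), Monotone u → Minimal (· ∈ U) (expOf u) → ∀ x ∈ sigmaSet u, x < n

theorem map_restr_subset (G : Finset ℕ) : (restr n G).map Fin.valEmbedding ⊆ G := by
  intro x hx
  obtain ⟨j, hj, rfl⟩ := Finset.mem_map.1 hx
  exact mem_restr.1 hj

theorem subset_map_restr {G H : Finset ℕ} (hH : ∀ x ∈ H, x < n) (h : H ⊆ G) :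
    H ⊆ (restr n G).map Fin.valEmbedding := fun x hx =>
  Finset.mem_map.2 ⟨⟨x, hH x hx⟩, mem_restr.2 (h hx), rfl⟩

theorem restr_map (F : Finset (Fin n)) : restr n (F.map Fin.valEmbedding) = F := by
  ext j
  rw [mem_restr]
  exact Finset.mem_map' Fin.valEmbedding

theorem StronglyStable.expOf_mem_of_sigmaSet_subset {U : Set (Fin n →₀ ℕ)} (hU : StronglyStable U)
    {t : ℕ} {u : Fin t → Fin n} {w : Fin d → Fin n} (hu : Monotone u) (hw : Monotone w)
    (huU : expOf u ∈ U) (h : sigmaSet u ⊆ sigmaSet w) : expOf w ∈ U := by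
  obtain ⟨htd, hle⟩ := le_of_sigmaSet_subset hu hw h
  exact hU.mem_of_le (hU.expOf_mem_of_le hle huU) (expOf_castLE_le htd w)

/-- This is the hypothesis of `ncard_eq_of_restr_sigmaSet`, so `U` has the same number of exponents
in each degree as the Stanley–Reisner ideal of its complex. -/
theorem expOf_mem_iff_restr_notMem {U : Set (Fin n →₀ ℕ)} (hU : StronglyStable U)
    (hb : SigmaBounded U) {w : Fin d → Fin n} (hw : Monotone w) :
    expOf w ∈ U ↔ restr n (sigmaSet w) ∉ shiftComplex U := by
  rw [notMem_shiftComplex]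
  constructor
  · intro h
    obtain ⟨t, u, h1, h2, h3⟩ := hU.exists_minimal_sigmaSet_subset w hw h
    exact ⟨t, u, h1, h2, subset_map_restr (hb t u h1 h2) h3⟩
  · rintro ⟨t, u, h1, h2, h3⟩
    exact hU.expOf_mem_of_sigmaSet_subset h1 hw h2.1 (h3.trans (map_restr_subset _))

/-- The complex of the sets that do not contain `t` elements which are bounded by
`u_1, …, u_t + t - 1`. -/
def principalComplex {t : ℕ} (u : Fin t → Fin n) : Complex n where
  carrier := {F | ¬ ∀ k : Fin t, (k : ℕ) + 1 ≤ headCard (u k + k + 1) F}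
  lower' _ _ hGF hF h := hF fun k => (h k).trans (headCard_mono hGF)

theorem notMem_principalComplex {t : ℕ} {u : Fin t → Fin n} {F : Finset (Fin n)} :
    F ∉ principalComplex u ↔ ∀ k : Fin t, (k : ℕ) + 1 ≤ headCard (u k + k + 1) F :=
  not_not

/-- The complex contains each of the head complexes attached to `u`, so its gin lies in the
intersection of the corresponding sets `headExp`. That intersection contains `u`, and the count via
σ makes the inclusion an equality. -/
theorem expOf_mem_gin_principalComplex (K : Type*) [Field K] [Infinite K] {t : ℕ}
    {u : Fin t → Fin n} (hu : Monotone u) (hb : ∀ k : Fin t, (u k : ℕ) + k < n) :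
    expOf u ∈ gin K (principalComplex u) := by
  refine mem_of_ncard_le (d := t)
    (V := {c | ∀ k : Fin t, c ∈ headExp n (u k + 1) (k + 1)}) ?_ ?_ (degree_expOf u) ?_
  · intro c _ hc k
    refine gin_headComplex_subset K (m := u k + k + 1) (hb k) (by omega) (gin_anti K ?_ hc)
    intro F hF
    by_contra h
    exact not_lt.2 (notMem_principalComplex.1 h k) (mem_headComplex.1 hF)
  · rw [ncard_gin, ncard_eq_of_restr_sigmaSet (Γ := principalComplex u)]
    intro w hw
    rw [notMem_principalComplex]
    refine forall_congr' fun k => ?_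
    rw [expOf_mem_headExp hw, add_one_le_headCard_restr hw (hb k)]
    refine exists_congr fun _ => ?_
    omega
  · exact fun k => (expOf_mem_headExp hu).2 ⟨k.2, Nat.lt_succ_self _⟩

theorem exists_sigmaSet_eq_map (F : Finset (Fin n)) :
    ∃ w : Fin F.card → Fin n, Monotone w ∧ sigmaSet w = F.map Fin.valEmbedding := by
  obtain ⟨w, hw, h⟩ := exists_monotone_of_card_eq (Finset.card_map (s := F) Fin.valEmbedding)
  have hlt : ∀ k, w k < n := fun k => by
    obtain ⟨j, -, hj⟩ := Finset.mem_map.1 ((h _).2 ⟨k, rfl⟩)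
    have := j.2
    rw [Fin.valEmbedding_apply] at hj
    omega
  refine ⟨fun k => ⟨w k, hlt k⟩, fun k l hkl => hw hkl, ?_⟩
  ext x
  rw [mem_sigmaSet, h]

/-- The sorted elements of a non-face of the principal complex are bounded by those of σ(u). Strong
stability then puts the corresponding monomial into `U`. -/
theorem shiftComplex_le_principalComplex {U : Set (Fin n →₀ ℕ)} (hU : StronglyStable U)
    (hb : SigmaBounded U) {t : ℕ} {u : Fin t → Fin n} (huU : expOf u ∈ U)
    (hub : ∀ k : Fin t, (u k : ℕ) + k < n) : shiftComplex U ≤ principalComplex u := by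
  intro F hF
  by_contra h
  have h : ∀ k : Fin t, _ := notMem_principalComplex.1 h
  obtain ⟨w, hw, hwF⟩ := exists_sigmaSet_eq_map F
  rw [← restr_map F, ← hwF] at hF
  refine (expOf_mem_iff_restr_notMem hU hb hw).1 ?_ hF
  have key : ∀ k : Fin t, ∃ hk : (k : ℕ) < F.card, (w ⟨k, hk⟩ : ℕ) + k < u k + k + 1 := fun k => by
    have := h k
    rwa [← restr_map F, ← hwF, add_one_le_headCard_restr hw (hub k)] at this
  have ht : t ≤ F.card := by
    by_contra! hlt
    obtain ⟨h1, -⟩ := key ⟨F.card, hlt⟩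
    exact lt_irrefl _ h1
  refine hU.mem_of_le (hU.expOf_mem_of_le (w := fun k => w (Fin.castLE ht k)) (fun k => ?_) huU)
    (expOf_castLE_le ht w)
  obtain ⟨_, h2⟩ := key k
  rw [Fin.le_def]
  change (w ⟨k, _⟩ : ℕ) ≤ u k
  omega

/-- Each minimal generator `u` of `U` lies in the gin of its principal complex, which contains the
complex of `U`; since gin reverses inclusions, `U` is contained in the gin sought. Equal counts in
every degree finish the proof. -/
theorem gin_shiftComplex (K : Type*) [Field K] [CharZero K] {U : Set (Fin n →₀ ℕ)}
    (hU : StronglyStable U) (hb : SigmaBounded U) : gin K (shiftComplex U) = U := by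
  have hsub : U ⊆ gin K (shiftComplex U) := by
    intro a ha
    obtain ⟨d, hd⟩ : ∃ d, a.degree = d := ⟨_, rfl⟩
    obtain ⟨w, hw, rfl⟩ := exists_monotone_expOf_eq hd
    obtain ⟨t, u, h1, h2, h3⟩ := hU.exists_minimal_sigmaSet_subset w hw ha
    have hub : ∀ k : Fin t, (u k : ℕ) + k < n := fun k =>
      hb t u h1 h2 _ (mem_sigmaSet.2 ⟨k, rfl⟩)
    exact (stronglyStable_gin K _).expOf_mem_of_sigmaSet_subset h1 hw
      (gin_anti K (shiftComplex_le_principalComplex hU hb h2.1 hub)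
        (expOf_mem_gin_principalComplex K h1 hub)) h3
  refine Set.Subset.antisymm (fun c hc => ?_) hsub
  refine mem_of_ncard_le (d := c.degree) (fun c _ h => hsub h) ?_ rfl hc
  rw [ncard_gin, ncard_eq_of_restr_sigmaSet (J := U) c.degree fun w hw =>
    expOf_mem_iff_restr_notMem hU hb hw]

theorem sigmaBounded_gin (K : Type*) [Field K] [Infinite K] (Γ : Complex n) :
    SigmaBounded (gin K Γ) := by
  rintro (_ | e) u hu hmin x hx
  · obtain ⟨k, -⟩ := mem_sigmaSet.1 hx
    exact k.elim0
  · obtain ⟨k, rfl⟩ := mem_sigmaSet.1 hx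
    -- With indices from 0 the degree is `e + 1` and the largest element of σ(u) is the last index
    -- plus `e`, so the bound gives exactly the strict inequality required.
    have h1 := degree_add_le_of_minimal Γ hmin (j := u (Fin.last e))
      (expOf_apply_ne_zero.2 ⟨_, rfl⟩) fun j hj => by
        by_contra h
        obtain ⟨l, rfl⟩ := expOf_apply_ne_zero.1 h
        exact absurd hj (not_lt.2 (hu (Fin.le_last l)))
    rw [degree_expOf] at h1
    have h2 : (u k : ℕ) ≤ u (Fin.last e) := hu (Fin.le_last k)
    have := k.2
    omega

end Shifted

/-! ### Existence and uniqueness of the symmetric algebraic shifted complex -/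

section Shift

variable (K : Type*) [Field K] {n : ℕ}

theorem prod_X_eq_monomial_nat (G : Finset ℕ) :
    (∏ i ∈ G, X i : MvPolynomial ℕ K) = monomial (∑ i ∈ G, Finsupp.single i 1) 1 :=
  (monomial_sum_one G fun i => Finsupp.single i 1).symm

theorem prod_X_mem_span_iff {S : Set (Finset ℕ)} {G : Finset ℕ} :
    (∏ i ∈ G, X i : MvPolynomial ℕ K) ∈ Ideal.span ((fun H : Finset ℕ => ∏ i ∈ H, X i) '' S) ↔
      ∃ H ∈ S, H ⊆ G := by
  simp_rw [prod_X_eq_monomial_nat]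
  have := monomial_mem_monIdeal (K := K) (U := (fun H : Finset ℕ => ∑ i ∈ H, Finsupp.single i 1) '' S)
    (a := ∑ i ∈ G, Finsupp.single i 1)
  rw [monIdeal, Set.image_image] at this
  rw [this, Set.exists_mem_image]
  refine exists_congr fun H => and_congr_right fun _ => ?_
  rw [Finsupp.le_def]
  refine forall_congr' fun i => ?_
  simp only [Finsupp.finsetSum_apply, Finsupp.single_apply, Finset.sum_ite_eq']
  split_ifs <;> simp_all

theorem map_stanleyReisnerIdeal (Γ : Complex n) :
    (stanleyReisnerIdeal K Γ).map (rename (R := K) (Fin.val : Fin n → ℕ)) =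
      Ideal.span ((fun H : Finset ℕ => ∏ i ∈ H, X i) ''
        ((fun F : Finset (Fin n) => F.map Fin.valEmbedding) '' {F | F ∉ Γ})) := by
  rw [stanleyReisnerIdeal, Ideal.map_span, Set.image_image]
  congr 1
  ext p
  constructor
  · rintro ⟨_, ⟨F, hF, rfl⟩, rfl⟩
    exact ⟨F, hF, by simp⟩
  · rintro ⟨F, hF, rfl⟩
    exact ⟨_, ⟨F, hF, rfl⟩, by simp⟩

theorem sigmaMonomial_expOf {d : ℕ} {w : Fin d → Fin n} (hw : Monotone w) :
    sigmaMonomial K (expOf w) = ∏ i ∈ sigmaSet w, X i := by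
  rw [sigmaMonomial, sort_toMultiset_expOf hw, sigmaSet,
    Finset.prod_image (strictMono_add_val hw).injective.injOn, ← List.prod_ofFn]
  congr 1
  refine List.ext_getElem (by simp) fun k h1 h2 => by simp

theorem sigmaIdeal_monIdeal_gin (Γ : Complex n) :
    sigmaIdeal (monIdeal K (gin K Γ)) = Ideal.span ((fun H : Finset ℕ => ∏ i ∈ H, X i) ''
      {G | ∃ (t : ℕ) (u : Fin t → Fin n), Monotone u ∧ Minimal (· ∈ gin K Γ) (expOf u) ∧
        sigmaSet u = G}) := by
  rw [sigmaIdeal]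
  simp_rw [monomial_mem_monIdeal_gin]
  congr 1
  ext p
  constructor
  · rintro ⟨a, ha, rfl⟩
    obtain ⟨d, hd⟩ : ∃ d, a.degree = d := ⟨_, rfl⟩
    obtain ⟨w, hw, rfl⟩ := exists_monotone_expOf_eq hd
    exact ⟨_, ⟨_, w, hw, ha, rfl⟩, (sigmaMonomial_expOf K hw).symm⟩
  · rintro ⟨_, ⟨t, u, hu, hmin, rfl⟩, rfl⟩
    exact ⟨expOf u, hmin, sigmaMonomial_expOf K hu⟩

/-- A complex is recovered from the squarefree monomials in its ideal, which gives uniqueness. For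
existence, each monomial u^σ must come from a non-face of the `n` vertices, and this is the
boundedness of the generators. -/
theorem isSymmetricShift_iff [Infinite K] {Γ Δ : Complex n} :
    IsSymmetricShift K Γ Δ ↔ Δ = shiftComplex (gin K Γ) := by
  have h : IsSymmetricShift K Γ Δ ↔
      (stanleyReisnerIdeal K Δ).map (rename (R := K) (Fin.val : Fin n → ℕ)) =
        sigmaIdeal (monIdeal K (gin K Γ)) := by
    simp [IsSymmetricShift, isGenericInitialIdeal_iff]
  rw [h, map_stanleyReisnerIdeal, sigmaIdeal_monIdeal_gin]
  constructor
  · intro heq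
    refine SetLike.ext fun F => not_iff_not.1 ?_
    rw [notMem_shiftComplex]
    have h1 : F ∉ Δ ↔ (∏ i ∈ F.map Fin.valEmbedding, X i : MvPolynomial ℕ K) ∈
        Ideal.span ((fun H : Finset ℕ => ∏ i ∈ H, X i) ''
          ((fun F : Finset (Fin n) => F.map Fin.valEmbedding) '' {F | F ∉ Δ})) := by
      rw [prod_X_mem_span_iff, Set.exists_mem_image]
      constructor
      · exact fun h => ⟨F, h, subset_rfl⟩
      · rintro ⟨F', hF', h⟩ hF
        exact hF' (Δ.lower (Finset.map_subset_map.1 h) hF)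
    rw [h1, heq, prod_X_mem_span_iff]
    constructor
    · rintro ⟨_, ⟨t, u, hu, hmin, rfl⟩, h⟩
      exact ⟨t, u, hu, hmin, h⟩
    · rintro ⟨t, u, hu, hmin, h⟩
      exact ⟨_, ⟨t, u, hu, hmin, rfl⟩, h⟩
  · rintro rfl
    refine le_antisymm (Ideal.span_le.2 ?_) (Ideal.span_le.2 ?_)
    · rintro _ ⟨_, ⟨F, hF, rfl⟩, rfl⟩
      obtain ⟨t, u, hu, hmin, h⟩ := notMem_shiftComplex.1 hF
      exact (prod_X_mem_span_iff K).2 ⟨_, ⟨t, u, hu, hmin, rfl⟩, h⟩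
    · rintro _ ⟨_, ⟨t, u, hu, hmin, rfl⟩, rfl⟩
      refine (prod_X_mem_span_iff K).2 ⟨_, ⟨restr n (sigmaSet u), ?_, rfl⟩, map_restr_subset _⟩
      exact notMem_shiftComplex.2 ⟨t, u, hu, hmin,
        subset_map_restr (sigmaBounded_gin K Γ t u hu hmin) subset_rfl⟩

theorem symmetricShift_eq [Infinite K] (Γ : Complex n) :
    symmetricShift K Γ = shiftComplex (gin K Γ) :=
  (isSymmetricShift_iff K).1
    (Classical.epsilon_spec (p := IsSymmetricShift K Γ) ⟨_, (isSymmetricShift_iff K).2 rfl⟩)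

theorem gin_symmetricShift [CharZero K] (Γ : Complex n) :
    gin K (symmetricShift K Γ) = gin K Γ := by
  rw [symmetricShift_eq, gin_shiftComplex K (stronglyStable_gin K Γ) (sigmaBounded_gin K Γ)]

end Shift

end SymmetricShifting

namespace SymmetricShifting

open MvPolynomial Filter
open scoped MonomialOrder

/-! ### More generic linear forms than variables -/

section LastForms

variable {K : Type*} [Field K] {R : Type*} [CommRing R] [Algebra K R] {n N : ℕ}

/-- The inclusion of the last `n` of `N` indices. -/
def lastEmb (h : n ≤ N) (j : Fin n) : Fin N := ⟨N - n + j, by omega⟩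

theorem lastEmb_strictMono (h : n ≤ N) : StrictMono (lastEmb h) := fun i j hij => by
  rw [Fin.lt_def] at hij ⊢
  exact Nat.add_lt_add_left hij _

theorem exists_lastEmb_eq (h : n ≤ N) {i : Fin N} (hi : N - n ≤ i) : ∃ j, lastEmb h j = i :=
  ⟨⟨i - (N - n), by omega⟩, Fin.ext (by simp only [lastEmb]; omega)⟩

/-- The exponents that involve one of the first `N - n` variables, and those that are in `U` when
considered as exponents of the last `n` variables. -/
def lastSet (h : n ≤ N) (U : Set (Fin n →₀ ℕ)) : Set (Fin N →₀ ℕ) :=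
  {b | (∃ i : Fin N, (i : ℕ) < N - n ∧ b i ≠ 0) ∨ ∃ a ∈ U, a.mapDomain (lastEmb h) = b}

theorem mon_mapDomain {e : Fin n → Fin N} (he : Function.Injective e) (f : Fin N → R)
    (a : Fin n →₀ ℕ) : mon f (a.mapDomain e) = mon (fun k => f (e k)) a :=
  Finsupp.prod_mapDomain_index_inj he

theorem mapDomain_lastEmb_lt (h : n ≤ N) {a b : Fin n →₀ ℕ} (hab : a ≺[degRevLex n] b) :
    a.mapDomain (lastEmb h) ≺[degRevLex N] b.mapDomain (lastEmb h) := by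
  have hinj := (lastEmb_strictMono h).injective
  rw [degRevLex_lt_iff] at hab ⊢
  rw [Finsupp.degree_mapDomain, Finsupp.degree_mapDomain]
  refine hab.imp_right fun ⟨h1, i, hi, hij⟩ => ⟨h1, lastEmb h i, ?_, fun j hj => ?_⟩
  · rwa [Finsupp.mapDomain_apply hinj, Finsupp.mapDomain_apply hinj]
  · obtain ⟨j, rfl⟩ := exists_lastEmb_eq h (i := j) (by
      rw [Fin.lt_def] at hj
      simp only [lastEmb] at hj
      omega)
    rw [Finsupp.mapDomain_apply hinj, Finsupp.mapDomain_apply hinj]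
    exact hij j ((lastEmb_strictMono h).lt_iff_lt.1 hj)

/-- The first forms are combinations of the last `n`, which are smaller variables in the order.
Hence a monomial involving a first form is a combination of smaller monomials. -/
theorem lastSet_subset_initSet (h : n ≤ N) {f : Fin N → R}
    (hf : ∀ i, f i ∈ Submodule.span K (Set.range fun k => f (lastEmb h k))) :
    lastSet h (initSet K fun k => f (lastEmb h k)) ⊆ initSet K f := by
  have hinj := (lastEmb_strictMono h).injective
  rintro b (⟨i, hi, hbi⟩ | ⟨a, ha, rfl⟩)
  · obtain ⟨c, rfl⟩ := exists_eq_add_single hbi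
    rw [mem_initSet, mon_add, mon_single]
    have := Submodule.mem_map_of_mem (f := LinearMap.mulLeft K (mon f c)) (hf i)
    rw [Submodule.map_span] at this
    refine Submodule.span_mono ?_ this
    rintro _ ⟨_, ⟨k, rfl⟩, rfl⟩
    refine ⟨c + Finsupp.single (lastEmb h k) 1, ⟨by simp, ?_⟩, by simp [mon_add]⟩
    refine add_single_lt_add_single_degRevLex c ?_
    rw [Fin.lt_def]
    exact hi.trans_le (Nat.le_add_right _ _)
  · rw [mem_initSet] at ha ⊢
    rw [mon_mapDomain hinj]
    refine Submodule.span_mono ?_ ha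
    rintro _ ⟨c, ⟨h1, h2⟩, rfl⟩
    refine ⟨c.mapDomain (lastEmb h), ⟨?_, mapDomain_lastEmb_lt h h2⟩, mon_mapDomain hinj f c⟩
    rw [Finsupp.degree_mapDomain, Finsupp.degree_mapDomain, h1]

theorem degree_eq_sdiff_lastSet (h : n ≤ N) (U : Set (Fin n →₀ ℕ)) (d : ℕ) :
    {c | c.degree = d} \ lastSet h U =
      Finsupp.mapDomain (lastEmb h) '' ({c | c.degree = d} \ U) := by
  have hinj := (lastEmb_strictMono h).injective
  ext b
  constructor
  · rintro ⟨hb, hbU⟩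
    have hrange : ↑b.support ⊆ Set.range (lastEmb h) := fun i hi => by
      refine exists_lastEmb_eq h ?_
      by_contra! hlt
      exact hbU (Or.inl ⟨i, hlt, Finsupp.mem_support_iff.1 hi⟩)
    have heq := Finsupp.mapDomain_comapDomain _ hinj b hrange
    refine ⟨_, ⟨?_, fun hU => hbU (Or.inr ⟨_, hU, heq⟩)⟩, heq⟩
    rw [← heq] at hb
    exact (Finsupp.degree_mapDomain _ _).symm.trans hb
  · rintro ⟨a, ⟨ha, haU⟩, rfl⟩
    refine ⟨(Finsupp.degree_mapDomain _ _).trans ha, ?_⟩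
    rintro (⟨i, hi, hai⟩ | ⟨a', ha', heq⟩)
    · refine hai (Finsupp.mapDomain_of_notMem_range _ _ ?_)
      rintro ⟨j, rfl⟩
      exact absurd hi (not_lt.2 (Nat.le_add_right _ _))
    · exact haU (Finsupp.mapDomain_injective hinj heq ▸ ha')

/-- Generically the last `n` forms span all the variables, so one inclusion is
`lastSet_subset_initSet`. The complements have the same size in each degree, namely the dimension of
the span of the monomials in `v`. -/
theorem eventually_initSet_lin_eq_lastSet [Infinite K] (h : n ≤ N) (v : Fin n → R) :
    ∀ᶠ B in zariski (Fin n × Fin N) K, initSet K (lin v B) = lastSet h (genSet K v) := by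
  have hinj := (lastEmb_strictMono h).injective
  filter_upwards [eventually_mem_span_lin v hinj,
    (tendsto_comp_zariski (K := K) (e := Prod.map (id : Fin n → Fin n) (lastEmb h))
      (Function.injective_id.prodMap hinj)).eventually (eventually_initSet_eq v)] with B h1 h2
  have h2' : initSet K (fun k => lin v B (lastEmb h k)) = genSet K v := h2
  have hle : Submodule.span K (Set.range v) ≤
      Submodule.span K (Set.range fun k => lin v B (lastEmb h k)) := by
    rw [Submodule.span_le]
    rintro _ ⟨j, rfl⟩
    exact h1 j
  have hsub : lastSet h (genSet K v) ⊆ initSet K (lin v B) := by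
    rw [← h2']
    exact lastSet_subset_initSet h fun i => hle (lin_mem_span v B i)
  refine Set.Subset.antisymm (fun b hb => ?_) hsub
  have hspan : degSpan K (lin v B) b.degree = degSpan K v b.degree :=
    le_antisymm (degSpan_le_of_mem (lin_mem_span v B) _) (degSpan_le_of_mem (fun j =>
      Submodule.span_mono (by rintro _ ⟨k, rfl⟩; exact ⟨_, rfl⟩) (h1 j)) _)
  have hcard : ({c | c.degree = b.degree} \ lastSet h (genSet K v)).ncard ≤
      ({c | c.degree = b.degree} \ initSet K (lin v B)).ncard := by
    rw [degree_eq_sdiff_lastSet, Set.ncard_image_of_injective _ (Finsupp.mapDomain_injective hinj),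
      ncard_compl_genSet, ncard_compl_initSet, hspan]
  have := Set.eq_of_subset_of_ncard_le (Set.sdiff_subset_sdiff_right hsub) hcard
    ((Finsupp.finite_of_degree_eq _).subset Set.sdiff_subset)
  by_contra hb'
  have hmem : b ∈ {c | c.degree = b.degree} \ initSet K (lin v B) := this ▸ ⟨rfl, hb'⟩
  exact hmem.2 hb

end LastForms

/-! ### Strongly stable sets are determined by their cardinalities on certain segments -/

section Segments

variable {N : ℕ}

/-- The exponents of degree `deg b + 1` up to `x_1 x^b`. -/
def headSegment (b : Fin (N + 1) →₀ ℕ) : Set (Fin (N + 1) →₀ ℕ) :=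
  {c | c.degree = b.degree + 1 ∧ c ≼[degRevLex (N + 1)] b + Finsupp.single 0 1}

theorem isSegment_headSegment (b : Fin (N + 1) →₀ ℕ) : IsSegment (b.degree + 1) (headSegment b) :=
  ⟨fun _ h => h.1, fun _ h _ h1 h2 => ⟨h1, h2.le.trans h.2⟩⟩

/-- Divide by the variable of smallest index. The quotient is at most `b`, since at the last place
where it could exceed `b` the removed variable plays no role; so its product with any variable is at
most x_1 x^b. This closure property makes spans split over a product of rings. -/
theorem exists_eq_add_single_of_mem_headSegment {b c : Fin (N + 1) →₀ ℕ} (hc : c ∈ headSegment b) :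
    ∃ c' p, c = c' + Finsupp.single p 1 ∧ ∀ i, c' + Finsupp.single i 1 ∈ headSegment b := by
  have hne : c.support.Nonempty := by
    rw [Finsupp.support_nonempty_iff]
    rintro rfl
    have := hc.1
    simp at this
  obtain ⟨p, hp⟩ : ∃ p, p = c.support.min' hne := ⟨_, rfl⟩
  obtain ⟨c', rfl⟩ := exists_eq_add_single (Finsupp.mem_support_iff.1
    (hp ▸ c.support.min'_mem hne))
  have hmin : ∀ j, c' j ≠ 0 → p ≤ j := fun j hj => by
    rw [hp]
    refine Finset.min'_le _ _ (Finsupp.mem_support_iff.2 ?_)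
    rw [Finsupp.add_apply]
    omega
  have hdeg : c'.degree = b.degree := by
    have := hc.1
    rw [map_add, Finsupp.degree_single p 1] at this
    omega
  have hle : c' ≼[degRevLex (N + 1)] b := by
    by_contra hlt
    rw [not_le, degRevLex_lt_iff] at hlt
    rcases hlt with hlt | ⟨-, i, hi, hij⟩
    · omega
    rcases le_or_gt i p with hip | hip
    · have hcb : c' ≤ b := fun j => by
        rcases lt_trichotomy j i with hji | rfl | hji
        · by_contra! hj
          exact absurd (hmin j (by omega)) (not_le.2 (hji.trans_le hip))
        · exact hi.le
        · exact (hij j hji).ge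
      obtain ⟨z, rfl⟩ := exists_add_of_le hcb
      have hz : z = 0 := by
        rw [map_add] at hdeg
        exact (Finsupp.degree_eq_zero_iff z).1 (by omega)
      simp [hz] at hi
    · refine absurd hc.2 (not_le.2 (degRevLex_lt_iff.2 (Or.inr ⟨?_, i, ?_, fun j hj => ?_⟩)))
      · simp [hdeg]
      · rw [Finsupp.add_apply, Finsupp.add_apply, Finsupp.single_eq_of_ne hip.ne']
        omega
      · rw [Finsupp.add_apply, Finsupp.add_apply, Finsupp.single_eq_of_ne (hip.trans hj).ne',
          Finsupp.single_eq_of_ne ((Fin.zero_le p).trans_lt (hip.trans hj)).ne', hij j hj]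
  refine ⟨c', p, rfl, fun i => ⟨by simp [hdeg], le_trans (b := (degRevLex (N + 1)).toSyn
    (c' + Finsupp.single 0 1)) ?_ ?_⟩⟩
  · rcases (Fin.zero_le i).eq_or_lt with rfl | hi
    · exact le_rfl
    · exact (add_single_lt_add_single_degRevLex c' hi).le
  · rw [map_add, map_add]
    exact add_le_add_left hle _

/-- If x^b involves no variable before `x_k`, the part of the segment above x_k x^b consists only of
products of x^b with earlier variables. The exchange property controls exactly these. -/
theorem exists_eq_add_single_of_lt {b c : Fin (N + 1) →₀ ℕ} {k : Fin (N + 1)}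
    (hk : ∀ j < k, b j = 0) (hc : c ∈ headSegment b)
    (hlt : b + Finsupp.single k 1 ≺[degRevLex (N + 1)] c) :
    ∃ i < k, c = b + Finsupp.single i 1 := by
  suffices h : ∃ i, c = b + Finsupp.single i 1 by
    obtain ⟨i, rfl⟩ := h
    refine ⟨i, ?_, rfl⟩
    by_contra! hki
    rcases hki.eq_or_lt with rfl | hki
    · exact lt_irrefl _ hlt
    · exact lt_asymm hlt (add_single_lt_add_single_degRevLex b hki)
  rcases hc.2.eq_or_lt with heq | hlt'
  · exact ⟨0, (degRevLex (N + 1)).toSyn.injective heq⟩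
  have hdeg := hc.1
  rw [degRevLex_lt_iff] at hlt hlt'
  rcases hlt with hlt | ⟨-, i, hi, hij⟩
  · simp at hlt
    omega
  rcases hlt' with hlt' | ⟨-, l, hl, hlj⟩
  · simp at hlt'
    omega
  have hki : k ≤ i := by
    by_contra! h
    rw [Finsupp.add_apply, hk i h, Finsupp.single_eq_of_ne h.ne] at hi
    omega
  have hgt : ∀ j, i < j → c j = b j := fun j hj => by
    rw [← hij j hj, Finsupp.add_apply, Finsupp.single_eq_of_ne (hki.trans_lt hj).ne', add_zero]
  rw [Finsupp.add_apply] at hl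
  have hli : l ≤ i := by
    by_contra! h
    rw [hgt l h] at hl
    omega
  have hge : b i ≤ c i := by
    rcases hli.eq_or_lt with rfl | h
    · omega
    · rw [hlj i h, Finsupp.add_apply]
      omega
  have hik : i = k := by
    by_contra h
    rw [Finsupp.add_apply, Finsupp.single_eq_of_ne h] at hi
    omega
  subst hik
  have hbc : b ≤ c := fun j => by
    rcases lt_trichotomy j i with hj | rfl | hj
    · rw [hk j hj]
      exact Nat.zero_le _
    · exact hge
    · exact (hgt j hj).ge
  obtain ⟨z, rfl⟩ := exists_add_of_le hbc
  have hz : z.degree = 1 := by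
    rw [map_add] at hdeg
    omega
  have hz' : z ∈ {c : Fin (N + 1) →₀ ℕ | c.degree = 1} := hz
  rw [← Finsupp.range_single_one] at hz'
  obtain ⟨j, rfl⟩ := hz'
  exact ⟨j, rfl⟩

/-- Write the exponent as `b` plus its variable of smallest index and consider the segment of `b`.
Below the exponent the hypothesis compares the sets, and above it everything is in `U` by exchange.
If the exponent were not in `V`, the complement of `U` in the segment would be strictly smaller than
that of `V`. -/
theorem StronglyStable.mem_of_ncard_sdiff_headSegment_le {U V : Set (Fin (N + 1) →₀ ℕ)}
    (hU : StronglyStable U)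
    (h : ∀ b, (headSegment b \ V).ncard ≤ (headSegment b \ U).ncard) {c : Fin (N + 1) →₀ ℕ}
    (hc0 : c ≠ 0) (ih : ∀ c' : Fin (N + 1) →₀ ℕ, c'.degree = c.degree →
      c' ≺[degRevLex (N + 1)] c → c' ∈ V → c' ∈ U) (hc : c ∈ U) : c ∈ V := by
  obtain ⟨k, hk⟩ : ∃ k, k = c.support.min' (Finsupp.support_nonempty_iff.2 hc0) := ⟨_, rfl⟩
  obtain ⟨b, rfl⟩ := exists_eq_add_single (Finsupp.mem_support_iff.1
    (hk ▸ c.support.min'_mem (Finsupp.support_nonempty_iff.2 hc0)))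
  have hmin : ∀ j < k, b j = 0 := fun j hj => by
    by_contra hbj
    refine absurd hj (not_lt.2 ?_)
    rw [hk]
    refine Finset.min'_le _ _ (Finsupp.mem_support_iff.2 ?_)
    rw [Finsupp.add_apply]
    omega
  by_contra hcV
  have hmem : b + Finsupp.single k 1 ∈ headSegment b := by
    refine ⟨by simp, ?_⟩
    rcases (Fin.zero_le k).eq_or_lt with h | h
    · rw [h]
    · exact (add_single_lt_add_single_degRevLex b h).le
  have hss : headSegment b \ U ⊂ headSegment b \ V := by
    refine (Set.ssubset_iff_of_subset ?_).2 ⟨_, ⟨hmem, hcV⟩, fun h => h.2 hc⟩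
    rintro c ⟨hcb, hcU⟩
    refine ⟨hcb, fun hcV' => hcU ?_⟩
    rcases lt_trichotomy ((degRevLex (N + 1)).toSyn c)
      ((degRevLex (N + 1)).toSyn (b + Finsupp.single k 1)) with h1 | h1 | h1
    · exact ih c (hcb.1.trans hmem.1.symm) h1 hcV'
    · rwa [(degRevLex (N + 1)).toSyn.injective h1]
    · obtain ⟨i, hi, rfl⟩ := exists_eq_add_single_of_lt hmin hcb h1
      exact hU.exchange _ _ _ hi hc
  exact absurd (Set.ncard_lt_ncard hss ((isSegment_headSegment b).finite.subset Set.sdiff_subset))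
    (not_lt.2 (h b))

/-- Two strongly stable sets with the same number of elements in all the sets `headSegment b`
have the same elements of positive degree. -/
theorem StronglyStable.mem_iff_of_ncard_sdiff_headSegment_eq {U V : Set (Fin (N + 1) →₀ ℕ)}
    (hU : StronglyStable U) (hV : StronglyStable V)
    (h : ∀ b, (headSegment b \ U).ncard = (headSegment b \ V).ncard) {c : Fin (N + 1) →₀ ℕ}
    (hc : c ≠ 0) : c ∈ U ↔ c ∈ V := by
  have key : ∀ s : (degRevLex (N + 1)).syn, ∀ c : Fin (N + 1) →₀ ℕ, c ≠ 0 →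
      (degRevLex (N + 1)).toSyn c = s → (c ∈ U ↔ c ∈ V) := by
    intro s
    induction s using WellFoundedLT.induction with
    | ind s ih =>
      rintro c hc rfl
      have ih' : ∀ c' : Fin (N + 1) →₀ ℕ, c'.degree = c.degree → c' ≺[degRevLex (N + 1)] c →
          (c' ∈ U ↔ c' ∈ V) := fun c' hd hlt => ih _ hlt c' (by
        rintro rfl
        rw [map_zero] at hd
        exact hc ((Finsupp.degree_eq_zero_iff c).1 hd.symm)) rfl
      exact ⟨hU.mem_of_ncard_sdiff_headSegment_le (fun b => (h b).ge) hc
          fun c' hd hlt => (ih' c' hd hlt).2,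
        hV.mem_of_ncard_sdiff_headSegment_le (fun b => (h b).le) hc
          fun c' hd hlt => (ih' c' hd hlt).1⟩
  exact key _ c hc rfl

end Segments

end SymmetricShifting

namespace SymmetricShifting

open MvPolynomial Filter
open scoped MonomialOrder

/-! ### Generic initial ideals of disjoint unions -/

section Prod

variable {K : Type*} [Field K] {R₁ R₂ : Type*} [CommRing R₁] [Algebra K R₁] [CommRing R₂]
  [Algebra K R₂] {N : ℕ}

theorem mon_prod (f : Fin N → R₁ × R₂) (c : Fin N →₀ ℕ) :
    mon f c = (mon (fun i => (f i).1) c, mon (fun i => (f i).2) c) :=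
  Prod.ext (map_mon (RingHom.fst R₁ R₂) f c) (map_mon (RingHom.snd R₁ R₂) f c)

theorem mul_mem_span_mon {R : Type*} [CommRing R] [Algebra K R] {f : Fin N → R}
    {T : Set (Fin N →₀ ℕ)} {c : Fin N →₀ ℕ} (hc : ∀ i, c + Finsupp.single i 1 ∈ T) {x : R}
    (hx : x ∈ Submodule.span K (Set.range f)) :
    mon f c * x ∈ Submodule.span K (mon f '' T) := by
  have := Submodule.mem_map_of_mem (f := LinearMap.mulLeft K (mon f c)) hx
  rw [Submodule.map_span] at this
  refine Submodule.span_mono ?_ this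
  rintro _ ⟨_, ⟨i, rfl⟩, rfl⟩
  exact ⟨_, hc i, by simp [mon_add]⟩

/-- A monomial in the first components is a monomial f^{c'} times (f_p.1, 0), and the latter is a
combination of the forms. Closure of `T` keeps all the products inside the span, and likewise for
the second components. -/
theorem span_mon_prod {f : Fin N → R₁ × R₂}
    (hf : ∀ i, ((f i).1, (0 : R₂)) ∈ Submodule.span K (Set.range f)) {T : Set (Fin N →₀ ℕ)}
    (hT : ∀ c ∈ T, ∃ c' p, c = c' + Finsupp.single p 1 ∧ ∀ i, c' + Finsupp.single i 1 ∈ T) :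
    Submodule.span K (mon f '' T) =
      (Submodule.span K (mon (fun i => (f i).1) '' T)).prod
        (Submodule.span K (mon (fun i => (f i).2) '' T)) := by
  have hf' : ∀ i, ((0 : R₁), (f i).2) ∈ Submodule.span K (Set.range f) := fun i => by
    have : ((0 : R₁), (f i).2) = f i - ((f i).1, 0) := by ext <;> simp
    rw [this]
    exact sub_mem (Submodule.subset_span ⟨i, rfl⟩) (hf i)
  refine le_antisymm (Submodule.span_le.2 ?_) ?_
  · rintro _ ⟨c, hc, rfl⟩
    rw [mon_prod]
    exact ⟨Submodule.subset_span ⟨c, hc, rfl⟩, Submodule.subset_span ⟨c, hc, rfl⟩⟩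
  have h1 : Submodule.span K (mon (fun i => (f i).1) '' T) ≤
      (Submodule.span K (mon f '' T)).comap (LinearMap.inl K R₁ R₂) := by
    rw [Submodule.span_le]
    rintro _ ⟨c, hc, rfl⟩
    obtain ⟨c', p, rfl, hc'⟩ := hT c hc
    have := mul_mem_span_mon hc' (hf p)
    rwa [mon_prod f c', Prod.mk_mul_mk, mul_zero, ← mon_single (fun i => (f i).1) p,
      ← mon_add] at this
  have h2 : Submodule.span K (mon (fun i => (f i).2) '' T) ≤
      (Submodule.span K (mon f '' T)).comap (LinearMap.inr K R₁ R₂) := by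
    rw [Submodule.span_le]
    rintro _ ⟨c, hc, rfl⟩
    obtain ⟨c', p, rfl, hc'⟩ := hT c hc
    have := mul_mem_span_mon hc' (hf' p)
    rwa [mon_prod f c', Prod.mk_mul_mk, mul_zero, ← mon_single (fun i => (f i).2) p,
      ← mon_add] at this
  rintro ⟨x, y⟩ ⟨hx, hy⟩
  have : (x, y) = LinearMap.inl K R₁ R₂ x + LinearMap.inr K R₁ R₂ y := by simp
  rw [this]
  exact add_mem (h1 hx) (h2 hy)

/-- The product of two submodules, as a product of modules. -/
def prodSubmoduleEquiv (p : Submodule K R₁) (q : Submodule K R₂) : p.prod q ≃ₗ[K] p × q where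
  toFun x := (⟨x.1.1, x.2.1⟩, ⟨x.1.2, x.2.2⟩)
  invFun x := ⟨(x.1, x.2), x.1.2, x.2.2⟩
  map_add' _ _ := rfl
  map_smul' _ _ := rfl

theorem ncard_sdiff_initSet_prod {f : Fin N → R₁ × R₂}
    (hf : ∀ i, ((f i).1, (0 : R₂)) ∈ Submodule.span K (Set.range f)) {T : Set (Fin N →₀ ℕ)}
    {d : ℕ} (hTd : IsSegment d T)
    (hT : ∀ c ∈ T, ∃ c' p, c = c' + Finsupp.single p 1 ∧ ∀ i, c' + Finsupp.single i 1 ∈ T) :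
    (T \ initSet K f).ncard = (T \ initSet K fun i => (f i).1).ncard +
      (T \ initSet K fun i => (f i).2).ncard := by
  have h1 : Module.Finite K (Submodule.span K (mon (fun i => (f i).1) '' T)) :=
    Module.Finite.span_of_finite K (hTd.finite.image _)
  have h2 : Module.Finite K (Submodule.span K (mon (fun i => (f i).2) '' T)) :=
    Module.Finite.span_of_finite K (hTd.finite.image _)
  rw [← hTd.finrank_span, ← hTd.finrank_span, ← hTd.finrank_span, span_mon_prod hf hT,
    ← Module.finrank_prod]
  exact LinearEquiv.finrank_eq (prodSubmoduleEquiv _ _)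

/-- Degree 0 needs its own treatment: the unit (1, 1) of a product does not split into its
components. -/
theorem zero_mem_initSet {R : Type*} [CommRing R] [Algebra K R] {f : Fin N → R} :
    (0 : Fin N →₀ ℕ) ∈ initSet K f ↔ (1 : R) = 0 := by
  rw [mem_initSet, mon_zero]
  have : {c : Fin N →₀ ℕ | c.degree = (0 : Fin N →₀ ℕ).degree ∧ c ≺[degRevLex N] 0} = ∅ := by
    rw [Set.eq_empty_iff_forall_notMem]
    rintro c ⟨h1, h2⟩
    rw [map_zero] at h1
    rw [(Finsupp.degree_eq_zero_iff c).1 h1] at h2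
    exact lt_irrefl _ h2
  rw [this, Set.image_empty, Submodule.span_empty, Submodule.mem_bot]

end Prod

/-! ### The face ring of a disjoint union inside a product -/

section Union

variable (K : Type*) [Field K] {n m : ℕ}

theorem castAdd_injective : Function.Injective (Fin.castAdd m : Fin n → Fin (n + m)) :=
  Fin.castAdd_injective n m

theorem natAdd_injective : Function.Injective (Fin.natAdd n : Fin m → Fin (n + m)) :=
  Fin.natAdd_injective m n

/-- The homomorphism to the face ring of a complex on part of the vertices that maps the other
variables to zero. -/
noncomputable def restrictHom {N : ℕ} {e : Fin n → Fin N} (he : Function.Injective e)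
    (Γ : Complex n) : MvPolynomial (Fin N) K →ₐ[K] FaceRing K Γ :=
  (Ideal.Quotient.mkₐ K (stanleyReisnerIdeal K Γ)).comp (killCompl he)

variable {K}

theorem restrictHom_X {N : ℕ} {e : Fin n → Fin N} (he : Function.Injective e) (Γ : Complex n)
    (i : Fin n) : restrictHom K he Γ (X (e i)) = faceVar K Γ i := by
  have := killCompl_rename_app (R := K) he (X i)
  rw [rename_X] at this
  rw [restrictHom, AlgHom.comp_apply, this]
  rfl

theorem restrictHom_X_eq_zero {N : ℕ} {e : Fin n → Fin N} (he : Function.Injective e)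
    (Γ : Complex n) {i : Fin N} (hi : i ∉ Set.range e) : restrictHom K he Γ (X i) = 0 := by
  rw [restrictHom, AlgHom.comp_apply, killCompl, aeval_X, dif_neg hi, map_zero]

theorem restrictHom_eq_zero_iff {N : ℕ} {e : Fin n → Fin N} (he : Function.Injective e)
    {Γ : Complex n} {p : MvPolynomial (Fin N) K} : restrictHom K he Γ p = 0 ↔
      ∀ a : Fin n →₀ ℕ, a.support ∈ Γ → coeff (a.mapDomain e) p = 0 := by
  rw [restrictHom, AlgHom.comp_apply, Ideal.Quotient.mkₐ_eq_mk, Ideal.Quotient.eq_zero_iff_mem,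
    mem_stanleyReisnerIdeal]
  refine forall_congr' fun a => ?_
  rw [mem_support_iff, coeff_killCompl]
  tauto

theorem mapDomain_support_eq_map {N : ℕ} (e : Fin n ↪ Fin N) (a : Fin n →₀ ℕ) :
    (a.mapDomain e).support = a.support.map e := by
  rw [Finsupp.mapDomain_support_of_injective e.injective, Finset.map_eq_image]

theorem exists_mapDomain_eq {N : ℕ} {e : Fin n ↪ Fin N} {b : Fin N →₀ ℕ} {G : Finset (Fin n)}
    (h : b.support = G.map e) : ∃ a : Fin n →₀ ℕ, a.support = G ∧ a.mapDomain e = b := by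
  have heq := Finsupp.mapDomain_comapDomain e e.injective b (by
    rw [h, Finset.coe_map]
    exact Set.image_subset_range _ _)
  refine ⟨_, ?_, heq⟩
  rw [← Finset.map_inj (f := e), ← mapDomain_support_eq_map, heq, h]

theorem mem_disjointUnion {Γ₁ : Complex n} {Γ₂ : Complex m} {F : Finset (Fin (n + m))} :
    F ∈ disjointUnion Γ₁ Γ₂ ↔ (∃ G ∈ Γ₁, F = G.map (Fin.castAddEmb m)) ∨
      (∃ G ∈ Γ₂, F = G.map (Fin.natAddEmb n)) := Iff.rfl

/-- A face lies entirely on one side, so a polynomial is in the ideal exactly when both of its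
restrictions vanish. Thus the face ring embeds in the product. -/
theorem mem_stanleyReisnerIdeal_disjointUnion {Γ₁ : Complex n} {Γ₂ : Complex m}
    {p : MvPolynomial (Fin (n + m)) K} : p ∈ stanleyReisnerIdeal K (disjointUnion Γ₁ Γ₂) ↔
      restrictHom K castAdd_injective Γ₁ p = 0 ∧ restrictHom K natAdd_injective Γ₂ p = 0 := by
  rw [restrictHom_eq_zero_iff, restrictHom_eq_zero_iff, mem_stanleyReisnerIdeal]
  constructor
  · intro h
    refine ⟨fun a ha => ?_, fun a ha => ?_⟩
    · by_contra h0
      exact h _ (mem_support_iff.2 h0) (Or.inl ⟨_, ha, mapDomain_support_eq_map (Fin.castAddEmb m) a⟩)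
    · by_contra h0
      exact h _ (mem_support_iff.2 h0) (Or.inr ⟨_, ha, mapDomain_support_eq_map (Fin.natAddEmb n) a⟩)
  · rintro ⟨h1, h2⟩ b hb hbΓ
    rcases mem_disjointUnion.1 hbΓ with ⟨G, hG, hbG⟩ | ⟨G, hG, hbG⟩
    · obtain ⟨a, rfl, rfl⟩ := exists_mapDomain_eq hbG
      exact mem_support_iff.1 hb (h1 a hG)
    · obtain ⟨a, rfl, rfl⟩ := exists_mapDomain_eq hbG
      exact mem_support_iff.1 hb (h2 a hG)

variable (K) in
/-- The embedding of the face ring of a disjoint union into the product of the face rings. -/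
noncomputable def unionHom (Γ₁ : Complex n) (Γ₂ : Complex m) :
    FaceRing K (disjointUnion Γ₁ Γ₂) →ₐ[K] FaceRing K Γ₁ × FaceRing K Γ₂ :=
  Ideal.Quotient.liftₐ _ ((restrictHom K castAdd_injective Γ₁).prod
    (restrictHom K natAdd_injective Γ₂)) fun _ hp =>
      Prod.ext (mem_stanleyReisnerIdeal_disjointUnion.1 hp).1
        (mem_stanleyReisnerIdeal_disjointUnion.1 hp).2

theorem unionHom_injective (Γ₁ : Complex n) (Γ₂ : Complex m) :
    Function.Injective (unionHom K Γ₁ Γ₂) := by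
  rw [injective_iff_map_eq_zero]
  intro x hx
  obtain ⟨p, rfl⟩ := Ideal.Quotient.mk_surjective x
  have hx' : (restrictHom K castAdd_injective Γ₁ p, restrictHom K natAdd_injective Γ₂ p) = 0 := hx
  rw [Ideal.Quotient.eq_zero_iff_mem, mem_stanleyReisnerIdeal_disjointUnion]
  exact Prod.ext_iff.1 hx'

theorem unionHom_faceVar_castAdd (Γ₁ : Complex n) (Γ₂ : Complex m) (i : Fin n) :
    unionHom K Γ₁ Γ₂ (faceVar K _ (Fin.castAdd m i)) = (faceVar K Γ₁ i, 0) := by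
  refine Prod.ext (restrictHom_X castAdd_injective Γ₁ i)
    (restrictHom_X_eq_zero natAdd_injective Γ₂ ?_)
  rintro ⟨j, hj⟩
  have := congrArg Fin.val hj
  simp at this
  omega

theorem unionHom_faceVar_natAdd (Γ₁ : Complex n) (Γ₂ : Complex m) (j : Fin m) :
    unionHom K Γ₁ Γ₂ (faceVar K _ (Fin.natAdd n j)) = (0, faceVar K Γ₂ j) := by
  refine Prod.ext (restrictHom_X_eq_zero castAdd_injective Γ₁ ?_)
    (restrictHom_X natAdd_injective Γ₂ j)
  rintro ⟨i, hi⟩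
  have := congrArg Fin.val hi
  simp at this
  omega

theorem unionHom_lin (Γ₁ : Complex n) (Γ₂ : Complex m) {N : ℕ} (B : Fin (n + m) × Fin N → K)
    (k : Fin N) : unionHom K Γ₁ Γ₂ (lin (faceVar K _) B k) =
      (lin (faceVar K Γ₁) (B ∘ Prod.map (Fin.castAdd m) id) k,
        lin (faceVar K Γ₂) (B ∘ Prod.map (Fin.natAdd n) id) k) := by
  rw [map_lin, lin, Fin.sum_univ_add]
  simp only [unionHom_faceVar_castAdd, unionHom_faceVar_natAdd]
  ext <;> simp [lin, Prod.fst_sum, Prod.snd_sum]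

/-- The generic initial ideal of a disjoint union in terms of those of the two complexes. -/
theorem ncard_sdiff_gin_disjointUnion [Infinite K] {T : Set (Fin (n + m) →₀ ℕ)} {d : ℕ}
    (hTd : IsSegment d T)
    (hT : ∀ c ∈ T, ∃ c' p, c = c' + Finsupp.single p 1 ∧ ∀ i, c' + Finsupp.single i 1 ∈ T)
    (Γ₁ : Complex n) (Γ₂ : Complex m) :
    (T \ gin K (disjointUnion Γ₁ Γ₂)).ncard =
      (T \ lastSet (Nat.le_add_right n m) (gin K Γ₁)).ncard +
        (T \ lastSet (Nat.le_add_left m n) (gin K Γ₂)).ncard := by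
  -- One matrix is taken to be generic as a whole and also in its first `n` and its last `m` rows,
  -- which give the forms in the two factors.
  obtain ⟨B, ⟨h0, h1, h2⟩, h3⟩ := (((eventually_initSet_eq (K := K)
      (faceVar K (disjointUnion Γ₁ Γ₂))).and
    (((tendsto_comp_zariski (K := K) (e := Prod.map (Fin.castAdd m : Fin n → Fin (n + m)) id)
      (castAdd_injective.prodMap Function.injective_id)).eventually
        (eventually_initSet_lin_eq_lastSet (Nat.le_add_right n m) (faceVar K Γ₁))).and
    ((tendsto_comp_zariski (K := K) (e := Prod.map (Fin.natAdd n : Fin m → Fin (n + m)) id)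
      (natAdd_injective.prodMap Function.injective_id)).eventually
        (eventually_initSet_lin_eq_lastSet (Nat.le_add_left m n) (faceVar K Γ₂))))).and
    (eventually_mem_span_lin (K := K) (faceVar K (disjointUnion Γ₁ Γ₂))
      Function.injective_id)).exists
  rw [gin, gin, gin, ← h0, ← h1, ← h2, ← initSet_comp _ (unionHom_injective Γ₁ Γ₂),
    ncard_sdiff_initSet_prod ?_ hTd hT]
  · simp only [unionHom_lin]
  · intro k
    have hmem : ∀ j, unionHom K Γ₁ Γ₂ (faceVar K _ j) ∈ Submodule.span K
        (Set.range fun k => unionHom K Γ₁ Γ₂ (lin (faceVar K _) B k)) := fun j => by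
      have := Submodule.mem_map_of_mem (f := (unionHom K Γ₁ Γ₂).toLinearMap) (h3 j)
      rw [Submodule.map_span, ← Set.range_comp] at this
      exact this
    -- The first component alone is the same combination restricted to the variables of `Γ₁`, and
    -- each of these is a combination of the generic forms.
    have : ((unionHom K Γ₁ Γ₂ (lin (faceVar K _) B k)).1, (0 : FaceRing K Γ₂)) =
        ∑ i, B (Fin.castAdd m i, k) • unionHom K Γ₁ Γ₂ (faceVar K _ (Fin.castAdd m i)) := by
      simp only [unionHom_lin, unionHom_faceVar_castAdd]
      ext <;> simp [lin, Prod.fst_sum, Prod.snd_sum]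
    rw [this]
    exact Submodule.sum_mem _ fun i _ => Submodule.smul_mem _ _ (hmem _)

theorem zero_mem_gin_iff (Γ : Complex n) [Infinite K] : 0 ∈ gin K Γ ↔ ∅ ∉ Γ := by
  have h1 : 0 ∈ gin K Γ ↔ (1 : FaceRing K Γ) = 0 := by
    obtain ⟨B, hB⟩ := (eventually_initSet_eq (K := K) (faceVar K Γ)).exists
    rw [gin, ← hB, zero_mem_initSet]
  rw [h1, ← mon_zero (faceVar K Γ)]
  constructor
  · intro h he
    exact (linearIndepOn_mon_faceVar K Γ).ne_zero (i := 0) (by simpa using he) h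
  · intro h
    exact mon_faceVar_eq_zero K (by simpa using h)

theorem zero_mem_gin_disjointUnion [Infinite K] (Γ₁ : Complex n) (Γ₂ : Complex m) :
    0 ∈ gin K (disjointUnion Γ₁ Γ₂) ↔ 0 ∈ gin K Γ₁ ∧ 0 ∈ gin K Γ₂ := by
  rw [zero_mem_gin_iff, zero_mem_gin_iff, zero_mem_gin_iff, mem_disjointUnion, not_or]
  refine and_congr (not_congr ?_) (not_congr ?_)
  · constructor
    · rintro ⟨G, hG, h⟩
      rwa [Finset.map_eq_empty.1 h.symm] at hG
    · exact fun h => ⟨∅, h, rfl⟩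
  · constructor
    · rintro ⟨G, hG, h⟩
      rwa [Finset.map_eq_empty.1 h.symm] at hG
    · exact fun h => ⟨∅, h, rfl⟩

/-- Both sides are strongly stable and have the same counts on all head segments, because these
counts only involve the two gins. This settles positive degrees; in degree 0 the condition for each
part is also read from its gin. -/
theorem gin_disjointUnion_congr [CharZero K] {Γ₁ Γ₁' : Complex n} {Γ₂ Γ₂' : Complex m}
    (h₁ : gin K Γ₁ = gin K Γ₁') (h₂ : gin K Γ₂ = gin K Γ₂') :
    gin K (disjointUnion Γ₁ Γ₂) = gin K (disjointUnion Γ₁' Γ₂') := by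
  ext c
  by_cases hc : c = 0
  · rw [hc, zero_mem_gin_disjointUnion, zero_mem_gin_disjointUnion, h₁, h₂]
  obtain ⟨N, hN⟩ : ∃ N, n + m = N + 1 := by
    obtain ⟨i, -⟩ := Finsupp.ne_iff.1 hc
    exact ⟨n + m - 1, by have := i.2; omega⟩
  have key : ∀ T d, IsSegment d T →
      (∀ c ∈ T, ∃ c' p, c = c' + Finsupp.single p 1 ∧ ∀ i, c' + Finsupp.single i 1 ∈ T) →
      (T \ gin K (disjointUnion Γ₁ Γ₂)).ncard = (T \ gin K (disjointUnion Γ₁' Γ₂')).ncard := by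
    intro T d hTd hT
    rw [ncard_sdiff_gin_disjointUnion hTd hT, ncard_sdiff_gin_disjointUnion hTd hT, h₁, h₂]
  have hU := stronglyStable_gin K (disjointUnion Γ₁ Γ₂)
  have hV := stronglyStable_gin K (disjointUnion Γ₁' Γ₂')
  -- Head segments require a first variable, hence an index type of the form `Fin (N + 1)`.
  -- Abstracting the two sets makes it possible to substitute for `n + m`.
  generalize gin K (disjointUnion Γ₁ Γ₂) = U at hU key ⊢
  generalize gin K (disjointUnion Γ₁' Γ₂') = V at hV key ⊢
  generalize n + m = M at hN c U V key
  subst hN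
  exact hU.mem_iff_of_ncard_sdiff_headSegment_eq hV (fun b => key _ _ (isSegment_headSegment b)
    fun c hc => exists_eq_add_single_of_mem_headSegment hc) hc

end Union

end SymmetricShifting

theorem theorem4p1 (K : Type*) [Field K] [CharZero K] :
    (∀ (n : ℕ) (Γ : SymmetricShifting.Complex n),
      ∃! Δ : SymmetricShifting.Complex n, SymmetricShifting.IsSymmetricShift K Γ Δ) ∧
    ∀ (n m : ℕ) (Γ₁ : SymmetricShifting.Complex n) (Γ₂ : SymmetricShifting.Complex m),
      SymmetricShifting.symmetricShift K (SymmetricShifting.disjointUnion Γ₁ Γ₂) =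
        SymmetricShifting.symmetricShift K
          (SymmetricShifting.disjointUnion (SymmetricShifting.symmetricShift K Γ₁)
            (SymmetricShifting.symmetricShift K Γ₂)) := by
  refine ⟨fun n Γ => ⟨_, (SymmetricShifting.isSymmetricShift_iff K).2 rfl, fun Δ hΔ =>
    (SymmetricShifting.isSymmetricShift_iff K).1 hΔ⟩, fun n m Γ₁ Γ₂ => ?_⟩
  rw [SymmetricShifting.symmetricShift_eq, SymmetricShifting.symmetricShift_eq K
    (SymmetricShifting.disjointUnion (SymmetricShifting.symmetricShift K Γ₁) _),
    SymmetricShifting.gin_disjointUnion_congr (SymmetricShifting.gin_symmetricShift K Γ₁)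
      (SymmetricShifting.gin_symmetricShift K Γ₂)]
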